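/- **Setting.** Let $G$ be a $\mathbb Z^2$-periodic bipartite graph with finitely many edges modulo $\mathbb Z^2$ and with equally many white and black vertices in a fundamental domain, with positive periodic edge weights and a periodic choice of signs; write $K_e$ for the signed weight of $e$. (The case of interest is a planar graph with Kasteleyn signs; planarity and the sign condition are not needed under the hypotheses below.) If an edge $e$ joins a white vertex $\mathrm w$ of the domain $u$ to a black vertex $\mathrm b$ of the domain $u+(s_1,s_2)$, let $m_e=z^{-s_2}w^{s_1}$, and let $K(z,w)$ be the matrix with entries $K_{\mathrm w\mathrm b}(z,w)=\sum_{e=(\mathrm w,\mathrm b)}K_e\,m_e(z,w)$. Put $P=\det K$ and $Q_e=m_e\cdot\mathrm{adj}(K)_{\mathrm b\mathrm w}$ for $e=(\mathrm w,\mathrm b)$; $m_e=1$ if $e$ lies inside the fundamental domain. A dimer configuration of $G_1=G/\mathbb Z^2$ has a $w$-degree, the sum of the $s_1$ of its edges. Let $\delta_0$ be the smallest $w$-degree (the height of the lower horizontal side of the Newton polygon; at least one dimer configuration exists). Below, $P$ and all $Q_e$ are multiplied by $w^{-\delta_0}$, so that $P$ contains no negative power of $w$; write $P_0(z)=P(z,0)$.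 A *frozen thread* is a vertical dual path of period $(0,1)$ such that all edges crossing it have their white end on its left and their black end on its right, and such that no dimer configuration of $G_1$ of $w$-degree $\delta_0$ contains an edge crossing it. (For a general graph: a division of the vertices into vertical strips numbered by $\mathbb Z$, equivariant under the translations, along each edge of which the strip number does not decrease from the white to the black end; an edge crosses the thread if its strip number increases.) Let $c\in\mathbb R$ be such that $e^c$ is a simple root of $P_0$, no other complex root of $P_0$ has modulus $e^c$ (the asymptote $B_x=c$ of the tentacle is distinct from the others), and $\partial_2P(e^c,0)\ne0$. Let $$\beta=-e^{-c}\frac{\partial_2P(e^c,0)}{\partial_1P(e^c,0)},\qquad \rho_e=\frac{\partial_2Q_e(e^c,0)}{\partial_2P(e^c,0)} .$$ Fix $\gamma\in(-1,1)$. For an edge $e=(\mathrm w,\mathrm b)$ crossing a frozen thread and $(x,y)\in\mathbb Z^2$ let $\mathrm b_{x,y}$ be the black end of the translate of $e$ by $(x,y)$ and, for the magnetic field $(B_x,B_y)=(c+\beta\gamma t,\log t)$, $$K^{-1}_{\gamma,t}(\mathrm b_{x,y},\mathrm w)=\iint_{\mathbb T^2}\frac{z^{-y}w^{x}\,Q_e(e^{c+\beta\gamma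 t}z,tw)}{P(e^{c+\beta\gamma t}z,tw)}\,\frac{dz}{2i\pi z}\frac{dw}{2i\pi w}.$$ Let $$J_\gamma(x,\xi)=\begin{cases}\displaystyle\int_{[-1,1]}e^{-i\xi\phi}\bigl(\gamma+i\phi\sqrt{1-\gamma^2}\bigr)^x\frac{d\phi}{2\pi}&x\ge0,\\[2mm]\displaystyle-\int_{\mathbb R\setminus[-1,1]}e^{-i\xi\phi}\bigl(\gamma+i\phi\sqrt{1-\gamma^2}\bigr)^x\frac{d\phi}{2\pi}&x<0,\end{cases}$$ the second integral being an improper integral. **Proposition.** For an edge $e$ crossing a frozen thread: 1. For all sufficiently small $t>0$ the integral defining $K^{-1}_{\gamma,t}(\mathrm b_{x,y},\mathrm w)$ converges absolutely, for all $(x,y)\in\mathbb Z^2$. 2. For all $x\in\mathbb Z$ and $\xi\in\mathbb R$ with $(x,\xi)\neq(-1,0)$, the (improper) integral $J_\gamma(x,\xi)$ converges and, in the scaling limit $t\to0^+$, $t\beta y\sqrt{1-\gamma^2}\to\xi$ ($y\in\mathbb Z$), $$K^{-1}_{\gamma,t}(\mathrm b_{x,y},\mathrm w)= t\,\rho_e\,|\beta|\sqrt{1-\gamma^2}\,J_\gamma(x,\xi)+o(t).$$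 3. $K_e\rho_e$ is the limiting proportion of edges of type $e$ among the defects along the thread: if $p_t(e')=K_{e'}K^{-1}_{\gamma,t}(\mathrm b',\mathrm w')$ is the probability of $e'=(\mathrm w',\mathrm b')$ and $n(e')$ the number of lifts of $e'$ that cross the thread in one period, then $n(e)p_t(e)\big/\sum_{e'}n(e')p_t(e')\to K_e\rho_e$ as $t\to0^+$. -/

import Mathlib

open Filter Topology MeasureTheory

noncomputable section

namespace BeadDimer

/-- A `ℤ²`-periodic bipartite graph with a periodic weight function and a periodic choice of signs.
The fundamental domain contains one white and one black vertex for each element of `V`, and `E`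
indexes the edges of the quotient `G₁ = G / ℤ²`: the lifts of `e : E` join the white vertex
`white e` of the domain `u ∈ ℤ²` to the black vertex `black e` of the domain `u + shift e`.
(Planarity of `G` and the Kasteleyn condition on the signs around the faces are not imposed.) -/
structure PeriodicBipartiteGraph (V E : Type*) where
  white : E → V
  black : E → V
  shift : E → ℤ × ℤ
  weight : E → ℝ
  weight_pos : ∀ e, 0 < weight e
  sign : E → ℤˣ

/-- Laurent polynomials in two variables with real coefficients; the basis element with
exponent `(a, b)` is the monomial `z ^ a * w ^ b`. -/
abbrev Laurent : Type := AddMonoidAlgebra ℝ (ℤ × ℤ)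

/-- The value of a Laurent polynomial at `(z, w)`. (Since `0 ^ 0 = 1`, this is also the right value
at `w = 0` if only nonnegative powers of `w` occur.) -/
def Laurent.eval {𝕜 : Type*} [Field 𝕜] [Algebra ℝ 𝕜] (p : Laurent) (z w : 𝕜) : 𝕜 :=
  p.coeff.sum fun m a => algebraMap ℝ 𝕜 a * z ^ m.1 * w ^ m.2

/-- The partial derivative `∂₁ p (a, b)` of a Laurent polynomial at a real point. -/
def Laurent.d1 (p : Laurent) (a b : ℝ) : ℝ := deriv (fun s : ℝ => p.eval s b) a

/-- The partial derivative `∂₂ p (a, b)` of a Laurent polynomial at a real point. -/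
def Laurent.d2 (p : Laurent) (a b : ℝ) : ℝ := deriv (fun s : ℝ => p.eval a s) b

namespace PeriodicBipartiteGraph

variable {V E : Type*} (G : PeriodicBipartiteGraph V E)

/-- The entry `K_e` of the Kasteleyn operator on (all the lifts of) the edge `e`. -/
def kast (e : E) : ℝ := ((G.sign e : ℤ) : ℝ) * G.weight e

/-- The monomial `z ^ (-s₂) * w ^ s₁` attached to an edge with `shift e = (s₁, s₂)`. -/
def edgeMonomial (e : E) : Laurent := AddMonoidAlgebra.single (-(G.shift e).2, (G.shift e).1) 1

/-- The Fourier transform `K(z, w)` of the periodic Kasteleyn operator: rows are indexed by white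
vertices, columns by black vertices, and `K(z, w)` is the action of the operator on functions whose
value on the black vertex `b` of the domain `(x, y)` is `z ^ (-y) * w ^ x` times a function of
`b`. -/
def kastFourier [Fintype E] [DecidableEq V] : Matrix V V Laurent := fun i j =>
  ∑ e : E with G.white e = i ∧ G.black e = j, AddMonoidAlgebra.single 0 (G.kast e) * G.edgeMonomial e

/-- The matrix of complex numbers `K(z, w)`. -/
def kastMatrix [Fintype E] [DecidableEq V] (z w : ℂ) : Matrix V V ℂ :=
  (G.kastFourier).map fun p => p.eval z w

/-- The characteristic polynomial `P = det K(z, w)`. -/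
def charPoly [Fintype V] [Fintype E] [DecidableEq V] : Laurent := G.kastFourier.det

/-- The cofactor `Q_e` of the edge `e = (w, b)`: the entry `(b, w)` of the comatrix (the matrix
`Q` with `K Q = P`). The monomial of `e` is `1` if `e` does not leave the fundamental domain, and in
general makes `Q_e / P` independent of the choice of the fundamental domain. -/
def cofactor [Fintype V] [Fintype E] [DecidableEq V] (e : E) : Laurent :=
  G.edgeMonomial e * G.kastFourier.adjugate (G.black e) (G.white e)

/-- `M` is a dimer configuration (perfect matching) of the quotient graph `G₁`. -/
def IsDimerConfig (M : Finset E) : Prop :=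
  (∀ v : V, ∃! e, e ∈ M ∧ G.white e = v) ∧ (∀ v : V, ∃! e, e ∈ M ∧ G.black e = v)

/-- The second coordinate of the lattice point of the Newton polygon that corresponds to `M`,
i.e. the exponent of `w` in the term of `P` that comes from `M`. -/
def wDegree (M : Finset E) : ℤ := ∑ e ∈ M, (G.shift e).1

/-- `δ` is the height `δ₀` of the lower horizontal side of the Newton polygon (the smallest exponent
of `w`). A dimer configuration `M` of `G₁` lies on this side iff `G.wDegree M = δ`. -/
def IsLowerSide (δ : ℤ) : Prop := IsLeast {k | ∃ M, G.IsDimerConfig M ∧ G.wDegree M = k} δ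

/-- A frozen thread. A vertical dual path with period `(0, 1)`, together with its translates by
`(k, 0)`, `k ∈ ℤ`, cuts the periodic graph into vertical strips numbered by `ℤ` from left to right;
it is recorded by the strips `whiteStrip v`, `blackStrip v` that contain the vertices of the
fundamental domain (so the vertices of the domain `(x, y)` lie in the strips
`x + whiteStrip v`, `x + blackStrip v`). The edges that cross the path have their white end on its
left and their black end on its right, and the path is frozen: no edge of a dimer
configuration on the lower side of the Newton polygon crosses it. -/
structure FrozenThread (δ : ℤ) where
  whiteStrip : V → ℤ
  blackStrip : V → ℤ
  white_left : ∀ e, whiteStrip (G.white e) ≤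
    (G.shift e).1 + blackStrip (G.black e)
  frozen : ∀ M, G.IsDimerConfig M → G.wDegree M = δ → ∀ e ∈ M,
    whiteStrip (G.white e) = (G.shift e).1 + blackStrip (G.black e)

/-- The number of lifts of `e` that cross the thread, per vertical period of the thread. -/
def FrozenThread.crossing {G : PeriodicBipartiteGraph V E} {δ : ℤ} (T : G.FrozenThread δ) (e : E) :
    ℤ := (G.shift e).1 + T.blackStrip (G.black e) - T.whiteStrip (G.white e)

section Kasteleyn

variable [Fintype V] [Fintype E] [DecidableEq V]

/-- The integrand, in the angles `z = exp (i θ₁)`, `w = exp (i θ₂)`, of the inverse Kasteleyn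
operator: `z ^ (-y) * w ^ x * [K(e^{Bx} z, e^{By} w)]⁻¹` at `(b, w)`. -/
def invKastIntegrand (Bx By : ℝ) (b w : V) (u : ℤ × ℤ) (θ : ℝ × ℝ) : ℂ :=
  Complex.exp (Complex.I * θ.1) ^ (-u.2) * Complex.exp (Complex.I * θ.2) ^ u.1 *
    (G.kastMatrix (Complex.exp Bx * Complex.exp (Complex.I * θ.1))
      (Complex.exp By * Complex.exp (Complex.I * θ.2)))⁻¹ b w

/-- The unit torus, parametrised by angles. -/
def torus : Set (ℝ × ℝ) := Set.Ioc (-Real.pi) Real.pi ×ˢ Set.Ioc (-Real.pi) Real.pi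

/-- The entry `K_B⁻¹(b_u, w)` of the inverse Kasteleyn operator with magnetic field
`B = (Bx, By)`, between the black vertex `b` of the domain `u` and the white vertex `w` of the
domain `(0, 0)`; the normalised measure `dz / (2iπz) dw / (2iπw)` is `dθ₁ dθ₂ / (2π)²`. -/
def invKast (Bx By : ℝ) (b w : V) (u : ℤ × ℤ) : ℂ :=
  1 / (2 * (Real.pi : ℂ)) ^ 2 * ∫ θ in torus, G.invKastIntegrand Bx By b w u θ

/-- The entry `K_B⁻¹(b_u, w)`, where `e = (w, b)` is an edge starting in the domain `(0, 0)` and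
`b_u` is the black end of the translate of `e` by `u`, computed in the gauge where the
fundamental domain contains `e`. If `shift e = 0`, the prefactor is `1`. In general
this is the integral of `z ^ (-y) * w ^ x * Q_e / P`, with `Q_e` and `P` taken at
`(e^{Bx} z, e^{By} w)`. -/
def coupling (Bx By : ℝ) (e : E) (u : ℤ × ℤ) : ℂ :=
  (G.edgeMonomial e).eval (Complex.exp Bx) (Complex.exp By) *
    G.invKast Bx By (G.black e) (G.white e) (u + G.shift e)

/-- `K_e K_B⁻¹(b, w)`, the probability of the edge `e = (w, b)`. -/
def edgeProb (Bx By : ℝ) (e : E) : ℂ := G.kast e * G.coupling Bx By e 0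

/-- The polynomial `w ^ (-δ) P(z, w)`: the origin of the Newton polygon is moved to the line
that contains its lower side. -/
def normP (δ : ℤ) : Laurent := AddMonoidAlgebra.single (0, -δ) 1 * G.charPoly

/-- The polynomial `w ^ (-δ) Q_e(z, w)`. -/
def normQ (δ : ℤ) (e : E) : Laurent := AddMonoidAlgebra.single (0, -δ) 1 * G.cofactor e

/-- `β = - e^{-c} ∂₂P(e^c, 0) / ∂₁P(e^c, 0)`. -/
def beta (δ : ℤ) (c : ℝ) : ℝ :=
  -Real.exp (-c) * (G.normP δ).d2 (Real.exp c) 0 / (G.normP δ).d1 (Real.exp c) 0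

/-- `ρ_e = ∂₂Q_e(e^c, 0) / ∂₂P(e^c, 0)`. -/
def rho (δ : ℤ) (c : ℝ) (e : E) : ℝ :=
  (G.normQ δ e).d2 (Real.exp c) 0 / (G.normP δ).d2 (Real.exp c) 0

/-- The asymptote `B_x = c` of a nondegenerate tentacle of the amoeba that is distinct from the
other asymptotes: `e^c` is a simple root of `P₀ = P(·, 0)`, no other root of `P₀` has
the same modulus, and `∂₂P(e^c, 0) ≠ 0` (so that `β` is nonzero and the `ρ_e` are well defined). -/
structure IsTentacle (δ : ℤ) (c : ℝ) : Prop where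
  root : (G.normP δ).eval (Real.exp c) 0 = 0
  simple : (G.normP δ).d1 (Real.exp c) 0 ≠ 0
  asymptote_distinct : ∀ z : ℂ, ‖z‖ = Real.exp c → (G.normP δ).eval z 0 = 0 → z = Real.exp c
  nondegenerate : (G.normP δ).d2 (Real.exp c) 0 ≠ 0

/-- `K⁻¹_{γ,t}(b_u, w)`: the magnetic field is `(c + β γ t, log t)`. -/
def couplingInTentacle (δ : ℤ) (c γ t : ℝ) (e : E) (u : ℤ × ℤ) : ℂ :=
  G.coupling (c + G.beta δ c * γ * t) (Real.log t) e u

/-- The probability of `e` for the magnetic field `(c + β γ t, log t)`. -/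
def edgeProbInTentacle (δ : ℤ) (c γ t : ℝ) (e : E) : ℂ :=
  G.edgeProb (c + G.beta δ c * γ * t) (Real.log t) e

end Kasteleyn

end PeriodicBipartiteGraph

/-- The integrand `e^{-iξφ} (γ + iφ√(1-γ²))^x / (2π)` of the bead kernel. -/
def beadIntegrand (γ : ℝ) (x : ℤ) (ξ φ : ℝ) : ℂ :=
  Complex.exp (-Complex.I * ξ * φ) * (γ + Complex.I * φ * Real.sqrt (1 - γ ^ 2)) ^ x /
    (2 * Real.pi)

/-- The truncated integral over `[-R, S] \ [-1, 1]`, where `p = (R, S)`. -/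
def beadTail (γ : ℝ) (x : ℤ) (ξ : ℝ) (p : ℝ × ℝ) : ℂ :=
  (∫ φ in (-p.1)..(-1), beadIntegrand γ x ξ φ) + ∫ φ in (1)..p.2, beadIntegrand γ x ξ φ

/-- The kernel `J_γ(x, ξ)` of the bead model. For `x < 0` the integral over `ℝ \ [-1, 1]` is an
improper integral (for `x = -1` it is only conditionally convergent). -/
def beadKernel (γ : ℝ) (x : ℤ) (ξ : ℝ) : ℂ :=
  if 0 ≤ x then ∫ φ in (-1)..1, beadIntegrand γ x ξ φ
  else -limUnder (atTop ×ˢ atTop) (beadTail γ x ξ)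

/-- The scaling limit `t → 0⁺`, `t β y √(1-γ²) → ξ` for pairs `(t, y)`, `y ∈ ℤ`. -/
def scalingLimit (β γ ξ : ℝ) : Filter (ℝ × ℤ) :=
  comap (fun p : ℝ × ℤ => p.1) (𝓝[>] 0) ⊓
    comap (fun p : ℝ × ℤ => p.1 * β * p.2 * Real.sqrt (1 - γ ^ 2)) (𝓝 ξ)

end BeadDimer

end

/-!
The thread provides a gauge. Multiplying the row of the white vertex `v` of `K(z, w)` by
`w ^ (-whiteStrip v)` and the column of the black vertex `v` by `w ^ (blackStrip v)` gives the
matrix `FrozenThread.kastThread`, in which the contribution of an edge `e` carries the factor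
`w ^ n(e)`, where `n(e) ≥ 0` is the number of times that `e` crosses the thread. As the dimer
configurations of lowest `w`-degree do not cross the thread, the strips determine this degree
(`FrozenThread.delta_eq`), the determinant of the new matrix is `w ^ (-δ) P`, and `w ^ (-δ) Q_e` is
`w ^ n(e)` times one of its cofactors and a power of `z`. So both are polynomials in `w`, and the
second is divisible by `w` if `e` crosses the thread: this is the factor `t` of the asymptotics.

After the substitution `z ↦ e^c z`, the coupling function divided by `t` is the integral of
`z ^ (-y) w ^ (x + 1) q / p` over the torus of radii `exp (β γ t)` and `t`, where `p` and `q` are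
holomorphic for `z ≠ 0`, and `z = 1` is a simple root of `p (·, 0)` and the only one on the unit
circle (`SimpleTentacle`). By the implicit function theorem, for small `w` the only root of
`p (·, w)` close to the unit circle is `exp (L w)` with `L w = β w + o(w)`. On the torus,
`w = t exp (iφ)`, so a zero of `p` needs `cos φ ≈ γ`; as `|γ| < 1`, there `w` is far from the real
line, which makes the angular derivatives of `p` linearly independent over `ℝ`. Hence `1 / p` has
singularities of the type `1 / |x|` in the plane and is integrable (`eventually_integrableOn_inv`).

For the asymptotics, the circle of the variable `z` is moved outwards if `y ≥ 0` and inwards if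
`y ≤ 0`, to a radius that does not depend on `t` (`inner_integral_eq`). The integral over the new
torus tends to `0` (`tendsto_integral_farIntegrand`). The residue at `exp (L w)` is picked up for
those `φ` for which the root lies between the two circles; in the limit these form one of the two
arcs into which the line `Re w = γ` cuts the unit circle, and by dominated convergence the sum of
the residues tends to the integral of `exp (-(w - γ) ξ / √(1 - γ²)) w ^ x` over this arc
(`tendsto_torusIntegral`). Cauchy's theorem moves the arc to the chord, or to the two half-lines
that prolong the chord, and this gives the bead kernel (`beadKernel_eq_arc_right`,
`beadKernel_eq_arc_left`).

For the proportions, the asymptotics are applied with `x = y = 0`, where the kernel is `1 / π` for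
all edges. That the numbers `n(e) K_e ρ_e` add up to `1` is Jacobi's formula for the derivative of
the determinant with respect to `w` (`FrozenThread.hasDerivAt_det_kastThread`).
-/

noncomputable section

namespace BeadDimer

/-! ### The matrix `K(z, w)` in the gauge of a thread -/

/-- Polynomials in `w` whose coefficients are Laurent polynomials in `z`; these can be evaluated at
`w = 0` by a ring homomorphism. -/
abbrev SemiLaurent : Type := AddMonoidAlgebra ℝ (ℤ × ℕ)

/-- The inclusion of the polynomials in `z, z⁻¹, w` into the Laurent polynomials. -/
def SemiLaurent.toLaurent : SemiLaurent →+* Laurent :=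
  AddMonoidAlgebra.mapDomainRingHom ℝ
    ((AddMonoidHom.id ℤ).prodMap (Nat.castAddMonoidHom ℤ))

/-- Evaluation at `(z, w)`, `z ≠ 0`, as an algebra homomorphism. -/
def SemiLaurent.evalHom {𝕜 : Type*} [Field 𝕜] [Algebra ℝ 𝕜] (z w : 𝕜) (hz : z ≠ 0) :
    SemiLaurent →ₐ[ℝ] 𝕜 :=
  AddMonoidAlgebra.lift ℝ 𝕜 (ℤ × ℕ)
    { toFun := fun m => z ^ m.toAdd.1 * w ^ m.toAdd.2
      map_one' := by simp
      map_mul' := fun a b => by simp [zpow_add₀ hz, pow_add]; ring }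

lemma SemiLaurent.toLaurent_single (m : ℤ × ℕ) (a : ℝ) :
    toLaurent (AddMonoidAlgebra.single m a) = AddMonoidAlgebra.single (m.1, (m.2 : ℤ)) a := by
  simp [toLaurent]
  rfl

lemma SemiLaurent.evalHom_single {𝕜 : Type*} [Field 𝕜] [Algebra ℝ 𝕜] (z w : 𝕜) (hz : z ≠ 0)
    (m : ℤ × ℕ) (a : ℝ) :
    evalHom z w hz (AddMonoidAlgebra.single m a) = algebraMap ℝ 𝕜 a * z ^ m.1 * w ^ m.2 := by
  simp [evalHom, Algebra.smul_def, mul_assoc]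

lemma Laurent.eval_add {𝕜 : Type*} [Field 𝕜] [Algebra ℝ 𝕜] (p q : Laurent) (z w : 𝕜) :
    (p + q).eval z w = p.eval z w + q.eval z w := by
  simp only [Laurent.eval, AddMonoidAlgebra.coeff_add]
  rw [Finsupp.sum_add_index'] <;> intros <;> simp [add_mul]

lemma Laurent.eval_single {𝕜 : Type*} [Field 𝕜] [Algebra ℝ 𝕜] (m : ℤ × ℤ) (a : ℝ) (z w : 𝕜) :
    Laurent.eval (AddMonoidAlgebra.single m a) z w = algebraMap ℝ 𝕜 a * z ^ m.1 * w ^ m.2 := by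
  simp [Laurent.eval]

lemma Laurent.eval_sum {𝕜 ι : Type*} [Field 𝕜] [Algebra ℝ 𝕜] (s : Finset ι) (f : ι → Laurent)
    (z w : 𝕜) : Laurent.eval (∑ i ∈ s, f i) z w = ∑ i ∈ s, (f i).eval z w := by
  classical
  induction s using Finset.induction_on with
  | empty => simp [Laurent.eval]
  | insert a s ha ih => rw [Finset.sum_insert ha, Finset.sum_insert ha, Laurent.eval_add, ih]

lemma SemiLaurent.eval_toLaurent {𝕜 : Type*} [Field 𝕜] [Algebra ℝ 𝕜] (p : SemiLaurent) (z w : 𝕜)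
    (hz : z ≠ 0) : (toLaurent p).eval z w = evalHom z w hz p := by
  induction p using AddMonoidAlgebra.induction_linear with
  | zero => simp [Laurent.eval]
  | add p q hp hq => rw [map_add, Laurent.eval_add, hp, hq, map_add]
  | single m a =>
    rw [toLaurent_single, Laurent.eval_single, evalHom_single]
    simp

/-- The Laurent monomial `w ^ k`. -/
def wMonomial (k : ℤ) : Laurent := AddMonoidAlgebra.single (0, k) 1

lemma wMonomial_zero : wMonomial 0 = 1 := rfl

lemma wMonomial_add (k l : ℤ) : wMonomial (k + l) = wMonomial k * wMonomial l := by
  simp [wMonomial, AddMonoidAlgebra.single_mul_single]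

lemma wMonomial_sum {ι : Type*} (s : Finset ι) (f : ι → ℤ) :
    wMonomial (∑ i ∈ s, f i) = ∏ i ∈ s, wMonomial (f i) := by
  classical
  induction s using Finset.induction_on with
  | empty => simp [wMonomial_zero]
  | insert a s ha ih => rw [Finset.sum_insert ha, Finset.prod_insert ha, wMonomial_add, ih]

namespace PeriodicBipartiteGraph

variable {V E : Type*} {G : PeriodicBipartiteGraph V E} {δ : ℤ}

/-- `FrozenThread.crossing` as a natural number, for use as the exponent of a polynomial. -/
def FrozenThread.crossingNat (T : G.FrozenThread δ) (e : E) : ℕ := (T.crossing e).toNat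

lemma FrozenThread.crossing_nonneg (T : G.FrozenThread δ) (e : E) : 0 ≤ T.crossing e := by
  have := T.white_left e
  unfold FrozenThread.crossing
  linarith

lemma FrozenThread.coe_crossingNat (T : G.FrozenThread δ) (e : E) :
    (T.crossingNat e : ℤ) = T.crossing e :=
  Int.toNat_of_nonneg (T.crossing_nonneg e)

lemma IsDimerConfig.sum_white [Fintype V] {M : Finset E} (hM : G.IsDimerConfig M) (f : V → ℤ) :
    ∑ e ∈ M, f (G.white e) = ∑ v, f v := by
  refine Finset.sum_bij (fun e _ => G.white e) (fun _ _ => Finset.mem_univ _) ?_ ?_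
    (fun _ _ => rfl)
  · intro a ha b hb h
    exact (hM.1 (G.white b)).unique ⟨ha, h⟩ ⟨hb, rfl⟩
  · intro v _
    obtain ⟨e, he, -⟩ := hM.1 v
    exact ⟨e, he.1, he.2⟩

lemma IsDimerConfig.sum_black [Fintype V] {M : Finset E} (hM : G.IsDimerConfig M) (f : V → ℤ) :
    ∑ e ∈ M, f (G.black e) = ∑ v, f v := by
  refine Finset.sum_bij (fun e _ => G.black e) (fun _ _ => Finset.mem_univ _) ?_ ?_
    (fun _ _ => rfl)
  · intro a ha b hb h
    exact (hM.2 (G.black b)).unique ⟨ha, h⟩ ⟨hb, rfl⟩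
  · intro v _
    obtain ⟨e, he, -⟩ := hM.2 v
    exact ⟨e, he.1, he.2⟩

/-- Since the dimer configurations on the lower side do not cross the thread, the height of the
lower side is determined by the strips. -/
lemma FrozenThread.delta_eq [Fintype V] (T : G.FrozenThread δ) (hδ : G.IsLowerSide δ) :
    δ = ∑ v, T.whiteStrip v - ∑ v, T.blackStrip v := by
  obtain ⟨M, hM, hd⟩ := hδ.1
  have h := Finset.sum_congr rfl (T.frozen M hM hd)
  rw [Finset.sum_add_distrib, hM.sum_white T.whiteStrip, hM.sum_black T.blackStrip] at h
  change G.wDegree M = δ at hd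
  unfold wDegree at hd
  linarith

section

variable [Fintype V] [Fintype E] [DecidableEq V]

/-- The matrix `K(z, w)` in the gauge adapted to the thread: the exponent of `w` in the
contribution of an edge is the number of times that the edge crosses the thread. -/
def FrozenThread.kastSemi (T : G.FrozenThread δ) : Matrix V V SemiLaurent := fun i j =>
  ∑ e : E with G.white e = i ∧ G.black e = j,
    AddMonoidAlgebra.single (-(G.shift e).2, T.crossingNat e) (G.kast e)

/-- The values of `FrozenThread.kastSemi`. -/
def FrozenThread.kastThread {𝕜 : Type*} [Field 𝕜] [Algebra ℝ 𝕜] (T : G.FrozenThread δ)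
    (z w : 𝕜) : Matrix V V 𝕜 := fun i j =>
  ∑ e : E with G.white e = i ∧ G.black e = j,
    algebraMap ℝ 𝕜 (G.kast e) * z ^ (-(G.shift e).2) * w ^ T.crossingNat e

lemma FrozenThread.map_kastSemi {𝕜 : Type*} [Field 𝕜] [Algebra ℝ 𝕜] (T : G.FrozenThread δ)
    (z w : 𝕜) (hz : z ≠ 0) :
    (SemiLaurent.evalHom z w hz).mapMatrix T.kastSemi = T.kastThread z w := by
  ext i j
  simp [FrozenThread.kastSemi, FrozenThread.kastThread, SemiLaurent.evalHom_single]

/-- The change of gauge multiplies the rows and the columns of `K(z, w)` by powers of `w`. -/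
lemma FrozenThread.toLaurent_kastSemi (T : G.FrozenThread δ) :
    SemiLaurent.toLaurent.mapMatrix T.kastSemi =
      Matrix.diagonal (fun i => wMonomial (-T.whiteStrip i)) * G.kastFourier *
        Matrix.diagonal (fun j => wMonomial (T.blackStrip j)) := by
  ext1 i j
  rw [Matrix.mul_diagonal, Matrix.diagonal_mul]
  simp only [FrozenThread.kastSemi, kastFourier, RingHom.mapMatrix_apply, Matrix.map_apply,
    map_sum, SemiLaurent.toLaurent_single, Finset.mul_sum, Finset.sum_mul]
  refine Finset.sum_congr rfl fun e he => ?_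
  obtain ⟨rfl, rfl⟩ := (Finset.mem_filter.1 he).2
  rw [FrozenThread.coe_crossingNat]
  simp only [wMonomial, edgeMonomial, AddMonoidAlgebra.single_mul_single, FrozenThread.crossing]
  congr 1
  · ext <;> simp; ring
  · ring

lemma FrozenThread.normP_eq (T : G.FrozenThread δ) (hδ : G.IsLowerSide δ) :
    G.normP δ = SemiLaurent.toLaurent T.kastSemi.det := by
  rw [RingHom.map_det, T.toLaurent_kastSemi, Matrix.det_mul, Matrix.det_mul, Matrix.det_diagonal,
    Matrix.det_diagonal, ← wMonomial_sum, ← wMonomial_sum, mul_right_comm, ← wMonomial_add]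
  unfold normP charPoly
  have h : -δ = ∑ i, -T.whiteStrip i + ∑ i, T.blackStrip i := by
    have := T.delta_eq hδ
    rw [Finset.sum_neg_distrib]; linarith
  rw [h]; rfl

lemma FrozenThread.normQ_eq (T : G.FrozenThread δ) (hδ : G.IsLowerSide δ) (e : E) :
    G.normQ δ e = SemiLaurent.toLaurent
      (AddMonoidAlgebra.single (-(G.shift e).2, T.crossingNat e) 1 *
        T.kastSemi.adjugate (G.black e) (G.white e)) := by
  have hadj : SemiLaurent.toLaurent (T.kastSemi.adjugate (G.black e) (G.white e)) =
      (SemiLaurent.toLaurent.mapMatrix T.kastSemi).adjugate (G.black e) (G.white e) := by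
    rw [← RingHom.map_adjugate]; rfl
  rw [map_mul, hadj, T.toLaurent_kastSemi, Matrix.adjugate_mul_distrib,
    Matrix.adjugate_mul_distrib, Matrix.adjugate_diagonal, Matrix.adjugate_diagonal,
    Matrix.diagonal_mul, Matrix.mul_diagonal, ← wMonomial_sum, ← wMonomial_sum,
    SemiLaurent.toLaurent_single, FrozenThread.coe_crossingNat]
  have h1 : ∑ i ∈ Finset.univ.erase (G.black e), T.blackStrip i =
      ∑ i, T.blackStrip i - T.blackStrip (G.black e) := by
    rw [← Finset.sum_erase_add _ _ (Finset.mem_univ (G.black e))]; ring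
  have h2 : ∑ i ∈ Finset.univ.erase (G.white e), -T.whiteStrip i =
      - ∑ i, T.whiteStrip i + T.whiteStrip (G.white e) := by
    rw [← Finset.sum_erase_add Finset.univ _ (Finset.mem_univ (G.white e)),
      Finset.sum_neg_distrib]
    ring
  rw [h1, h2]
  have h3 : (AddMonoidAlgebra.single (-(G.shift e).2, T.crossing e) 1 : Laurent) =
      G.edgeMonomial e * wMonomial (T.blackStrip (G.black e) - T.whiteStrip (G.white e)) := by
    simp only [wMonomial, edgeMonomial, AddMonoidAlgebra.single_mul_single, FrozenThread.crossing]
    congr 1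
    · ext <;> simp; ring
    · ring
  have h4 : -δ = (T.blackStrip (G.black e) - T.whiteStrip (G.white e)) +
      ((∑ i, T.blackStrip i - T.blackStrip (G.black e)) +
        (- ∑ i, T.whiteStrip i + T.whiteStrip (G.white e))) := by
    have := T.delta_eq hδ
    linarith
  unfold normQ cofactor
  change wMonomial (-δ) * _ = _
  rw [h3, h4, wMonomial_add, wMonomial_add]
  ring

lemma FrozenThread.normP_eval {𝕜 : Type*} [Field 𝕜] [Algebra ℝ 𝕜] (T : G.FrozenThread δ)
    (hδ : G.IsLowerSide δ) {z : 𝕜} (hz : z ≠ 0) (w : 𝕜) :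
    (G.normP δ).eval z w = (T.kastThread z w).det := by
  rw [T.normP_eq hδ, SemiLaurent.eval_toLaurent _ _ _ hz, AlgHom.map_det, T.map_kastSemi]

lemma FrozenThread.normQ_eval {𝕜 : Type*} [Field 𝕜] [Algebra ℝ 𝕜] (T : G.FrozenThread δ)
    (hδ : G.IsLowerSide δ) (e : E) {z : 𝕜} (hz : z ≠ 0) (w : 𝕜) :
    (G.normQ δ e).eval z w = z ^ (-(G.shift e).2) * w ^ T.crossingNat e *
      (T.kastThread z w).adjugate (G.black e) (G.white e) := by
  rw [T.normQ_eq hδ, SemiLaurent.eval_toLaurent _ _ _ hz, map_mul, SemiLaurent.evalHom_single,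
    ← T.map_kastSemi z w hz, ← AlgHom.map_adjugate]
  simp

omit [Fintype V] in
lemma kastMatrix_apply (z w : ℂ) (i j : V) : G.kastMatrix z w i j =
    ∑ e : E with G.white e = i ∧ G.black e = j,
      (G.kast e : ℂ) * z ^ (-(G.shift e).2) * w ^ (G.shift e).1 := by
  simp only [kastMatrix, kastFourier, Matrix.map_apply, Laurent.eval_sum, edgeMonomial,
    AddMonoidAlgebra.single_mul_single, Laurent.eval_single]
  simp

lemma FrozenThread.kastThread_eq (T : G.FrozenThread δ) (z w : ℂ) (hw : w ≠ 0) :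
    T.kastThread z w = Matrix.diagonal (fun i => w ^ (-T.whiteStrip i)) * G.kastMatrix z w *
      Matrix.diagonal (fun j => w ^ (T.blackStrip j)) := by
  ext i j
  rw [Matrix.mul_diagonal, Matrix.diagonal_mul, kastMatrix_apply]
  simp only [FrozenThread.kastThread, Finset.mul_sum, Finset.sum_mul]
  refine Finset.sum_congr rfl fun e he => ?_
  obtain ⟨rfl, rfl⟩ := (Finset.mem_filter.1 he).2
  rw [← zpow_natCast w, T.coe_crossingNat, FrozenThread.crossing, add_sub_assoc, sub_eq_add_neg,
    zpow_add₀ hw, zpow_add₀ hw]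
  simp
  ring

/-- The gauge transformation does not change `m_e K⁻¹` at `(b, w)`, the quotient `Q_e / P`. -/
lemma FrozenThread.edge_mul_inv (T : G.FrozenThread δ) (e : E) (z w : ℂ) (hw : w ≠ 0) :
    z ^ (-(G.shift e).2) * w ^ (G.shift e).1 *
        (G.kastMatrix z w)⁻¹ (G.black e) (G.white e) =
      z ^ (-(G.shift e).2) * w ^ T.crossingNat e *
        (T.kastThread z w).adjugate (G.black e) (G.white e) / (T.kastThread z w).det := by
  have key : (T.kastThread z w)⁻¹ (G.black e) (G.white e) =
      w ^ (-T.blackStrip (G.black e)) * (G.kastMatrix z w)⁻¹ (G.black e) (G.white e) *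
        w ^ T.whiteStrip (G.white e) := by
    rw [T.kastThread_eq z w hw, Matrix.mul_inv_rev, Matrix.mul_inv_rev]
    have hd : ∀ f : V → ℤ, (Matrix.diagonal fun i => w ^ f i)⁻¹ =
        Matrix.diagonal fun i => w ^ (-f i) := by
      intro f
      apply Matrix.inv_eq_left_inv
      rw [Matrix.diagonal_mul_diagonal, ← Matrix.diagonal_one]
      congr 1; ext i
      rw [← zpow_add₀ hw]; simp
    rw [hd, hd, ← mul_assoc, Matrix.mul_diagonal, Matrix.diagonal_mul]
    simp
  rw [Matrix.inv_def, Matrix.smul_apply, Ring.inverse_eq_inv, smul_eq_mul] at key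
  rw [mul_div_assoc, div_eq_inv_mul, key, ← zpow_natCast w, T.coe_crossingNat,
    FrozenThread.crossing, add_sub_assoc, sub_eq_add_neg, zpow_add₀ hw, zpow_add₀ hw]
  have h1 : w ^ T.blackStrip (G.black e) ≠ 0 := zpow_ne_zero _ hw
  have h2 : w ^ T.whiteStrip (G.white e) ≠ 0 := zpow_ne_zero _ hw
  simp only [zpow_neg]
  field_simp

/-- The quotient of `w ^ (-δ) Q_e` by `w`, for an edge `e` that crosses the thread. (If `e` does not
cross the thread, the exponent of `w` is truncated, and the value has no meaning.) -/
def FrozenThread.cofactorQuot {𝕜 : Type*} [Field 𝕜] [Algebra ℝ 𝕜] (T : G.FrozenThread δ)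
    (e : E) (z w : 𝕜) : 𝕜 :=
  z ^ (-(G.shift e).2) * w ^ (T.crossingNat e - 1) *
    (T.kastThread z w).adjugate (G.black e) (G.white e)

lemma FrozenThread.kastThread_ofReal (T : G.FrozenThread δ) (x y : ℝ) :
    T.kastThread (x : ℂ) (y : ℂ) = (algebraMap ℝ ℂ).mapMatrix (T.kastThread x y) := by
  ext i j
  simp [FrozenThread.kastThread]

lemma FrozenThread.det_kastThread_ofReal (T : G.FrozenThread δ) (x y : ℝ) :
    (T.kastThread (x : ℂ) (y : ℂ)).det = ((T.kastThread x y).det : ℝ) := by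
  rw [T.kastThread_ofReal, ← RingHom.map_det]; rfl

lemma FrozenThread.cofactorQuot_ofReal (T : G.FrozenThread δ) (e : E) (x y : ℝ) :
    T.cofactorQuot e (x : ℂ) (y : ℂ) = (T.cofactorQuot e x y : ℝ) := by
  unfold FrozenThread.cofactorQuot
  rw [T.kastThread_ofReal, ← RingHom.map_adjugate]
  simp

omit [Fintype V] in
lemma FrozenThread.contDiffAt_kastThread (T : G.FrozenThread δ) (i j : V) (x : ℂ × ℂ)
    (hx : x.1 ≠ 0) : ContDiffAt ℂ 1 (fun x : ℂ × ℂ => T.kastThread x.1 x.2 i j) x := by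
  unfold FrozenThread.kastThread
  refine ContDiffAt.sum fun e _ => ?_
  refine (contDiffAt_const.mul ?_).mul (contDiffAt_snd.pow _)
  exact ((analyticAt_id.zpow hx).contDiffAt (n := 1)).comp x contDiffAt_fst

end

end PeriodicBipartiteGraph

lemma contDiffAt_det {V : Type*} [Fintype V] [DecidableEq V] {M : ℂ × ℂ → Matrix V V ℂ}
    {x : ℂ × ℂ} (h : ∀ i j, ContDiffAt ℂ 1 (fun x => M x i j) x) :
    ContDiffAt ℂ 1 (fun x => (M x).det) x := by
  simp only [Matrix.det_apply']
  exact ContDiffAt.sum fun σ _ => contDiffAt_const.mul (contDiffAt_prod fun i _ => h _ _)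

lemma contDiffAt_adjugate {V : Type*} [Fintype V] [DecidableEq V] {M : ℂ × ℂ → Matrix V V ℂ}
    {x : ℂ × ℂ} (h : ∀ i j, ContDiffAt ℂ 1 (fun x => M x i j) x) (i j : V) :
    ContDiffAt ℂ 1 (fun x => (M x).adjugate i j) x := by
  simp only [Matrix.adjugate_apply]
  refine contDiffAt_det fun k l => ?_
  by_cases hk : k = j
  · subst hk; simpa using contDiffAt_const
  · simpa [Matrix.updateRow_ne hk] using h k l

/-- Jacobi's formula for the derivative of a determinant. -/
lemma hasDerivAt_det {V : Type*} [Fintype V] [DecidableEq V] {M : ℝ → Matrix V V ℝ}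
    {M' : Matrix V V ℝ} {x : ℝ} (h : ∀ i j, HasDerivAt (fun s => M s i j) (M' i j) x) :
    HasDerivAt (fun s => (M s).det) (∑ j, ∑ i, (M x).adjugate j i * M' i j) x := by
  have key : ∀ j, ∑ i, (M x).adjugate j i * M' i j =
      ∑ σ : Equiv.Perm V, ((σ.sign : ℤ) : ℝ) *
        ((∏ i ∈ Finset.univ.erase j, M x (σ i) i) * M' (σ j) j) := by
    intro j
    have h1 := congrFun ((M x).cramer_eq_adjugate_mulVec (fun i => M' i j)) j
    -- the right-hand side is the expansion of the determinant with the column `j` replaced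
    rw [Matrix.cramer_apply, Matrix.det_apply'] at h1
    refine h1.symm.trans ?_
    refine Finset.sum_congr rfl fun σ _ => ?_
    rw [← Finset.prod_erase_mul _ _ (Finset.mem_univ j)]
    congr 2
    · refine Finset.prod_congr rfl fun i hi => ?_
      rw [Matrix.updateCol_ne (Finset.ne_of_mem_erase hi)]
    · simp
  simp only [key]
  rw [Finset.sum_comm]
  simp only [Matrix.det_apply', ← Finset.mul_sum]
  refine HasDerivAt.fun_sum fun σ _ => HasDerivAt.const_mul _ ?_
  simpa using HasDerivAt.fun_finsetProd (u := Finset.univ) (fun i _ => h (σ i) i)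

namespace PeriodicBipartiteGraph

variable {V E : Type*} {G : PeriodicBipartiteGraph V E} {δ : ℤ}
variable [Fintype V] [Fintype E] [DecidableEq V]

lemma FrozenThread.contDiffAt_det_kastThread (T : G.FrozenThread δ) (x : ℂ × ℂ)
    (hx : x.1 ≠ 0) : ContDiffAt ℂ 1 (fun x : ℂ × ℂ => (T.kastThread x.1 x.2).det) x :=
  contDiffAt_det fun i j => T.contDiffAt_kastThread i j x hx

lemma FrozenThread.contDiffAt_cofactorQuot (T : G.FrozenThread δ) (e : E) (x : ℂ × ℂ)
    (hx : x.1 ≠ 0) : ContDiffAt ℂ 1 (fun x : ℂ × ℂ => T.cofactorQuot e x.1 x.2) x := by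
  unfold FrozenThread.cofactorQuot
  refine ContDiffAt.mul (ContDiffAt.mul ?_ (contDiffAt_snd.pow _))
    (contDiffAt_adjugate (fun i j => T.contDiffAt_kastThread i j x hx) _ _)
  exact ((analyticAt_id.zpow hx).contDiffAt (n := 1)).comp x contDiffAt_fst

/-- The derivative of `P` in `w` counts the edges with their crossing numbers. -/
lemma FrozenThread.hasDerivAt_det_kastThread (T : G.FrozenThread δ) (x y : ℝ) :
    HasDerivAt (fun s : ℝ => (T.kastThread x s).det)
      (∑ e, (T.crossing e : ℝ) * G.kast e * T.cofactorQuot e x y) y := by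
  have h : ∀ i j, HasDerivAt (fun s : ℝ => T.kastThread x s i j)
      (∑ e : E with G.white e = i ∧ G.black e = j,
        G.kast e * x ^ (-(G.shift e).2) *
          ((T.crossingNat e : ℝ) * y ^ (T.crossingNat e - 1))) y := by
    intro i j
    exact HasDerivAt.fun_sum fun e _ => (hasDerivAt_pow _ _).const_mul _
  convert hasDerivAt_det h using 1
  simp only [Finset.mul_sum, Finset.sum_filter]
  rw [Finset.sum_congr rfl fun j _ => Finset.sum_comm, Finset.sum_comm]
  refine Finset.sum_congr rfl fun e _ => ?_
  simp only [ite_and, mul_ite, mul_zero, Finset.sum_ite_eq, Finset.mem_univ, if_true]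
  rw [← T.coe_crossingNat]
  simp only [FrozenThread.cofactorQuot]
  push_cast
  ring

end PeriodicBipartiteGraph

/-! ### The bead kernel as an integral over an arc of the unit circle -/

/-- The integrand `exp (-a W) W ^ x` of the contour integrals that represent the bead kernel. -/
def contourIntegrand (a : ℝ) (x : ℤ) (W : ℂ) : ℂ := Complex.exp (-a * W) * W ^ x

lemma contourIntegrand_neg (a : ℝ) (x : ℤ) (W : ℂ) :
    contourIntegrand a x W = (-1) ^ x * contourIntegrand (-a) x (-W) := by
  unfold contourIntegrand
  have h : (W : ℂ) ^ x = (-1) ^ x * (-W) ^ x := by rw [← mul_zpow]; simp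
  rw [h]
  push_cast
  rw [show -(-(a : ℂ)) * -W = -a * W by ring]
  ring

lemma norm_add_ofReal_ge {W : ℂ} (u : ℝ) : |W.im| ≤ ‖W + u‖ := by
  simpa using Complex.abs_im_le_norm (W + u)

lemma zpow_le_zpow_left_of_neg {x : ℤ} (hx : x < 0) {m r : ℝ} (hm : 0 < m) (h : m ≤ r) :
    r ^ x ≤ m ^ x := by
  obtain ⟨n, rfl⟩ : ∃ n : ℕ, x = -n := ⟨x.natAbs, by omega⟩
  rw [zpow_neg, zpow_neg, zpow_natCast, zpow_natCast]
  exact inv_anti₀ (by positivity) (by gcongr)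

/-- The exponential decay of the integrand along a horizontal ray, for negative powers. -/
lemma norm_contourIntegrand_add_le {a : ℝ} {x : ℤ} (hx : x < 0) {W : ℂ} {m : ℝ}
    (hm : 0 < m) {u : ℝ} (h : m ≤ ‖W + u‖) :
    ‖contourIntegrand a x (W + u)‖ ≤ Real.exp (-a * W.re) * m ^ x * Real.exp (-a * u) := by
  unfold contourIntegrand
  rw [norm_mul, norm_zpow, Complex.norm_exp]
  have h1 := zpow_le_zpow_left_of_neg hx hm h
  have h2 : ((-(a : ℂ)) * (W + u)).re = -a * W.re + -a * u := by simp; ring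
  rw [h2, Real.exp_add, mul_right_comm]
  gcongr

lemma hasDerivAt_contourIntegrand (a : ℝ) (x : ℤ) {W : ℂ} (hW : W ≠ 0) :
    HasDerivAt (contourIntegrand a x)
      (-a * contourIntegrand a x W + x * contourIntegrand a (x - 1) W) W := by
  unfold contourIntegrand
  have h := (((hasDerivAt_id W).const_mul (-(a : ℂ))).cexp).mul
    (hasDerivAt_zpow x W (Or.inl hW))
  refine h.congr_deriv ?_
  simp only [id]
  ring

/-- On the slit plane, `- ∫₀^∞ F (W + u) du` is a primitive of `F W = exp (-a W) W ^ x`. -/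
lemma hasDerivAt_ray_integral {a : ℝ} (ha : 0 < a) {x : ℤ} (hx : x < 0) {W : ℂ}
    (hW : W ∈ Complex.slitPlane) :
    HasDerivAt (fun W : ℂ => -∫ u in Set.Ioi (0 : ℝ), contourIntegrand a x (W + u))
      (contourIntegrand a x W) W := by
  obtain ⟨r, hr, hball⟩ := Metric.isOpen_iff.1 Complex.isOpen_slitPlane W hW
  -- the rays that start in the ball of radius `m` around `W` keep the distance `m` from `0`
  set m := min (r / 2) 1 with hm
  have hm0 : 0 < m := by positivity
  have far : ∀ W' ∈ Metric.ball W m, ∀ u : ℝ, 0 ≤ u → m ≤ ‖W' + u‖ := by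
    intro W' hW' u hu
    by_contra hlt
    push Not at hlt
    have h1 : (-(u : ℂ)) ∈ Metric.ball W r := by
      rw [Metric.mem_ball, dist_eq_norm] at hW' ⊢
      have h2 : -(u : ℂ) - W = (W' - W) - (W' + u) := by ring
      rw [h2]
      calc _ ≤ ‖W' - W‖ + ‖W' + u‖ := norm_sub_le _ _
        _ < m + m := add_lt_add hW' hlt
        _ ≤ r := by have := min_le_left (r / 2) 1; linarith
    have h3 := Complex.neg_ofReal_mem_slitPlane.1 (hball h1)
    linarith
  have hne : ∀ W' ∈ Metric.ball W m, ∀ u : ℝ, 0 ≤ u → W' + u ≠ 0 := by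
    intro W' hW' u hu h
    have := far W' hW' u hu
    rw [h, norm_zero] at this
    linarith
  have hint : ∀ C : ℝ, IntegrableOn (fun u : ℝ => C * Real.exp (-a * u)) (Set.Ioi 0) :=
    fun C => (integrableOn_exp_mul_Ioi (by linarith) 0).const_mul C
  have hcont : ∀ y : ℤ, ∀ W' ∈ Metric.ball W m,
      ContinuousOn (fun u : ℝ => contourIntegrand a y (W' + u)) (Set.Ioi 0) := by
    intro y W' hW' u hu
    have h1 := (hasDerivAt_contourIntegrand a y (hne W' hW' u hu.out.le)).continuousAt
    have h2 : ContinuousAt (fun u : ℝ => W' + (u : ℂ)) u := by fun_prop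
    exact (ContinuousAt.comp (f := fun u : ℝ => W' + (u : ℂ)) h1 h2).continuousWithinAt
  have hmeas : ∀ y : ℤ, ∀ W' ∈ Metric.ball W m, AEStronglyMeasurable
      (fun u : ℝ => contourIntegrand a y (W' + u)) (volume.restrict (Set.Ioi 0)) :=
    fun y W' hW' => (hcont y W' hW').aestronglyMeasurable measurableSet_Ioi
  have hWm : W ∈ Metric.ball W m := Metric.mem_ball_self hm0
  have hintF : IntegrableOn (fun u : ℝ => contourIntegrand a x (W + u)) (Set.Ioi 0) := by
    refine Integrable.mono' (hint (Real.exp (-a * W.re) * m ^ x)) (hmeas x W hWm) ?_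
    filter_upwards [ae_restrict_mem measurableSet_Ioi] with u hu
    exact norm_contourIntegrand_add_le hx hm0 (far W hWm u hu.out.le)
  set B := Real.exp (a * (|W.re| + m))
  have hexp : ∀ W' ∈ Metric.ball W m, Real.exp (-a * W'.re) ≤ B := by
    intro W' hW'
    apply Real.exp_le_exp.2
    rw [Metric.mem_ball, dist_eq_norm] at hW'
    have h1 := Complex.abs_re_le_norm (W' - W)
    rw [Complex.sub_re] at h1
    have h2 := abs_le.1 (h1.trans hW'.le)
    have h3 := neg_abs_le W.re
    nlinarith
  have main := hasDerivAt_integral_of_dominated_loc_of_deriv_le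
    (μ := volume.restrict (Set.Ioi (0 : ℝ)))
    (F := fun (W : ℂ) (u : ℝ) => contourIntegrand a x (W + u))
    (F' := fun (W : ℂ) (u : ℝ) =>
      -a * contourIntegrand a x (W + u) + x * contourIntegrand a (x - 1) (W + u))
    (bound := fun u => (a * (B * m ^ x) + |(x : ℝ)| * (B * m ^ (x - 1))) * Real.exp (-a * u))
    (x₀ := W) (Metric.ball_mem_nhds W hm0)
    (by filter_upwards [Metric.ball_mem_nhds W hm0] with W' hW' using hmeas x W' hW')
    hintF
    (((hmeas x W hWm).const_mul _).add ((hmeas (x - 1) W hWm).const_mul _))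
    (by
      filter_upwards [ae_restrict_mem measurableSet_Ioi] with u hu W' hW'
      refine (norm_add_le _ _).trans ?_
      rw [norm_mul, norm_mul, norm_neg, Complex.norm_real, Complex.norm_intCast, Real.norm_eq_abs,
        abs_of_pos ha, add_mul, mul_assoc a, mul_assoc |(x : ℝ)|]
      have hf := far W' hW' u hu.out.le
      have h1 := norm_contourIntegrand_add_le (a := a) hx hm0 hf
      have h2 := norm_contourIntegrand_add_le (a := a) (show x - 1 < 0 by omega) hm0 hf
      have h3 := hexp W' hW'
      have h4 : ∀ y : ℤ, Real.exp (-a * W'.re) * m ^ y * Real.exp (-a * u) ≤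
          B * m ^ y * Real.exp (-a * u) := fun y => by gcongr
      gcongr
      · exact h1.trans (h4 x)
      · exact h2.trans (h4 (x - 1)))
    (hint _)
    (by
      filter_upwards [ae_restrict_mem measurableSet_Ioi] with u hu W' hW'
      exact HasDerivAt.comp_add_const W' (u : ℂ)
        (hasDerivAt_contourIntegrand a x (hne W' hW' u hu.out.le)))
  -- the derivative of the integrand in `W` is also its derivative in `u`
  have hftc := integral_Ioi_of_hasDerivAt_of_tendsto' (a := 0) (m := 0)
    (f := fun u : ℝ => contourIntegrand a x (W + u))
    (f' := fun u : ℝ =>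
      -a * contourIntegrand a x (W + u) + x * contourIntegrand a (x - 1) (W + u))
    (fun u hu => by
      have h := HasDerivAt.comp_const_add W (u : ℂ)
        (hasDerivAt_contourIntegrand a x (hne W hWm u hu.out))
      exact h.comp_ofReal)
    main.1
    (by
      apply squeeze_zero_norm' (a := fun u : ℝ =>
        Real.exp (-a * W.re) * m ^ x * Real.exp (-a * u))
      · filter_upwards [eventually_ge_atTop 0] with u hu
        exact norm_contourIntegrand_add_le hx hm0 (far W hWm u hu)
      · rw [show (0 : ℝ) = Real.exp (-a * W.re) * m ^ x * 0 by ring]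
        refine (Real.tendsto_exp_atBot.comp ?_).const_mul _
        exact tendsto_id.const_mul_atTop_of_neg (by linarith))
  have := main.2.neg
  rw [hftc] at this
  simp only [zero_sub, neg_neg, Complex.ofReal_zero, add_zero] at this
  exact this

lemma norm_ray_integral_le {a : ℝ} (ha : 0 < a) {x : ℤ} (hx : x < 0) {W : ℂ} (hW : W.im ≠ 0) :
    ‖-∫ u in Set.Ioi (0 : ℝ), contourIntegrand a x (W + u)‖ ≤
      Real.exp (-a * W.re) * |W.im| ^ x * (1 / a) := by
  rw [norm_neg]
  have hint : IntegrableOn (fun u : ℝ => Real.exp (-a * W.re) * |W.im| ^ x * Real.exp (-a * u))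
      (Set.Ioi 0) := (integrableOn_exp_mul_Ioi (by linarith) 0).const_mul _
  refine (norm_integral_le_of_norm_le hint ?_).trans ?_
  · filter_upwards [ae_restrict_mem measurableSet_Ioi] with u hu
    exact norm_contourIntegrand_add_le hx (abs_pos.2 hW) (norm_add_ofReal_ge u)
  · rw [integral_const_mul, integral_exp_mul_Ioi (by linarith)]
    simp [neg_div_neg_eq]

lemma tendsto_abs_zpow_cocompact {κ : ℝ} (hκ : 0 < κ) {x : ℤ} (hx : x < 0) :
    Tendsto (fun v : ℝ => |κ * v| ^ x) (cocompact ℝ) (𝓝 0) := by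
  refine (tendsto_zpow_atTop_zero hx).comp ?_
  simp only [abs_mul]
  exact (tendsto_norm_cocompact_atTop (E := ℝ)).const_mul_atTop (by positivity)

/-- The integrand, in the angle `φ` of `w = exp (iφ)`, of the arc integrals
`(2πi)⁻¹ ∫ exp (-(w - γ) ξ / √(1 - γ²)) w ^ x dw`. -/
def arcIntegrand (γ : ℝ) (x : ℤ) (ξ φ : ℝ) : ℂ :=
  Complex.exp (-(ξ / Real.sqrt (1 - γ ^ 2) : ℝ) * (Complex.exp (Complex.I * φ) - γ)) *
    Complex.exp (Complex.I * φ) ^ (x + 1) / (2 * Real.pi)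

section

variable {γ : ℝ} (hγ : γ ∈ Set.Ioo (-1 : ℝ) 1)
include hγ

lemma sqrt_one_sub_sq_pos : 0 < Real.sqrt (1 - γ ^ 2) :=
  Real.sqrt_pos.2 (by nlinarith [hγ.1, hγ.2])

lemma exp_arccos : Complex.exp (Complex.I * (Real.arccos γ : ℝ)) =
    γ + Complex.I * Real.sqrt (1 - γ ^ 2) := by
  rw [mul_comm, Complex.exp_mul_I, ← Complex.ofReal_cos, ← Complex.ofReal_sin,
    Real.cos_arccos hγ.1.le hγ.2.le, Real.sin_arccos]
  ring

lemma exp_neg_arccos : Complex.exp (Complex.I * (-Real.arccos γ : ℝ)) =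
    γ - Complex.I * Real.sqrt (1 - γ ^ 2) := by
  rw [mul_comm, Complex.exp_mul_I, ← Complex.ofReal_cos, ← Complex.ofReal_sin, Real.cos_neg,
    Real.sin_neg, Real.cos_arccos hγ.1.le hγ.2.le, Real.sin_arccos]
  push_cast
  ring

omit hγ in
lemma integral_arcIntegrand {x : ℤ} {ξ : ℝ} {Φ : ℂ → ℂ} {u v : ℝ}
    (hΦ : ∀ φ ∈ Set.uIcc u v, HasDerivAt Φ
      (contourIntegrand (ξ / Real.sqrt (1 - γ ^ 2)) x (Complex.exp (Complex.I * φ)))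
      (Complex.exp (Complex.I * φ))) :
    ∫ φ in u..v, arcIntegrand γ x ξ φ =
      Complex.exp ((ξ / Real.sqrt (1 - γ ^ 2) : ℝ) * γ) / (2 * Real.pi * Complex.I) *
        (Φ (Complex.exp (Complex.I * v)) - Φ (Complex.exp (Complex.I * u))) := by
  rw [mul_sub]
  refine intervalIntegral.integral_eq_sub_of_hasDerivAt (f := fun φ : ℝ =>
    Complex.exp ((ξ / Real.sqrt (1 - γ ^ 2) : ℝ) * γ) / (2 * Real.pi * Complex.I) *
      Φ (Complex.exp (Complex.I * φ))) (fun φ hφ => ?_) ?_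
  · have h1 : HasDerivAt (fun φ : ℝ => Complex.exp (Complex.I * φ))
        (Complex.exp (Complex.I * φ) * Complex.I) φ := by
      have := ((hasDerivAt_id (φ : ℂ)).const_mul Complex.I).cexp.comp_ofReal
      simpa using this
    refine (((hΦ φ hφ).comp φ h1).const_mul _).congr_deriv ?_
    unfold contourIntegrand arcIntegrand
    rw [mul_sub, Complex.exp_sub, zpow_add_one₀ (Complex.exp_ne_zero _), neg_mul _ (γ : ℂ),
      Complex.exp_neg (_ * (γ : ℂ))]
    have hpi : (Real.pi : ℂ) ≠ 0 := by exact_mod_cast Real.pi_ne_zero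
    field_simp
  · apply ContinuousOn.intervalIntegrable
    unfold arcIntegrand
    refine ContinuousOn.div_const (ContinuousOn.mul (by fun_prop) ?_) _
    exact ContinuousOn.zpow₀ (by fun_prop) _ fun φ _ => Or.inl (Complex.exp_ne_zero _)

lemma integral_beadIntegrand {x : ℤ} {ξ : ℝ} {Φ : ℂ → ℂ} {u v : ℝ}
    (h0 : x < 0 → ∀ φ ∈ Set.uIcc u v, φ ≠ 0)
    (hΦ : ∀ φ ∈ Set.uIcc u v, HasDerivAt Φ
      (contourIntegrand (ξ / Real.sqrt (1 - γ ^ 2)) x (γ + Complex.I * φ * Real.sqrt (1 - γ ^ 2)))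
      (γ + Complex.I * φ * Real.sqrt (1 - γ ^ 2))) :
    ∫ φ in u..v, beadIntegrand γ x ξ φ =
      Complex.exp ((ξ / Real.sqrt (1 - γ ^ 2) : ℝ) * γ) / (2 * Real.pi * Complex.I) /
        Real.sqrt (1 - γ ^ 2) *
        (Φ (γ + Complex.I * v * Real.sqrt (1 - γ ^ 2)) -
          Φ (γ + Complex.I * u * Real.sqrt (1 - γ ^ 2))) := by
  have hκ := sqrt_one_sub_sq_pos hγ
  set κ := Real.sqrt (1 - γ ^ 2)
  rw [mul_sub]
  refine intervalIntegral.integral_eq_sub_of_hasDerivAt (f := fun φ : ℝ =>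
    Complex.exp ((ξ / κ : ℝ) * γ) / (2 * Real.pi * Complex.I) / κ *
      Φ (γ + Complex.I * φ * κ)) (fun φ hφ => ?_) ?_
  · have h1 : HasDerivAt (fun φ : ℝ => (γ : ℂ) + Complex.I * φ * κ) (Complex.I * κ) φ := by
      have := ((((hasDerivAt_id (φ : ℂ)).const_mul Complex.I).mul_const (κ : ℂ)).const_add
        (γ : ℂ)).comp_ofReal
      simpa using this
    refine (((hΦ φ hφ).comp φ h1).const_mul _).congr_deriv ?_
    unfold contourIntegrand beadIntegrand
    have hκ' : (κ : ℂ) ≠ 0 := by exact_mod_cast hκ.ne'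
    have h2 : -Complex.I * ξ * φ =
        (ξ / κ : ℝ) * γ + -(ξ / κ : ℝ) * (γ + Complex.I * φ * κ) := by
      push_cast; field_simp; ring
    rw [h2, Complex.exp_add]
    have hpi : (Real.pi : ℂ) ≠ 0 := by exact_mod_cast Real.pi_ne_zero
    rw [show Real.sqrt (1 - γ ^ 2) = κ from rfl]
    field_simp
  · apply ContinuousOn.intervalIntegrable
    unfold beadIntegrand
    refine ContinuousOn.div_const (ContinuousOn.mul (by fun_prop) ?_) _
    refine ContinuousOn.zpow₀ (by fun_prop) _ fun φ hφ => ?_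
    rcases lt_or_ge x 0 with hx | hx
    · left
      intro h
      have := congrArg Complex.im h
      simp at this
      exact this.elim (h0 hx φ hφ) hκ.ne'
    · exact Or.inr hx

/-- A primitive `Φ` of the contour integrand on the part of the line `Re W = γ` over which the bead
kernel is integrated computes the kernel, provided that, for `x < 0`, it vanishes at both ends of
the line. The values of `Φ` at the two points of the line on the unit circle remain. -/
lemma bead_of_primitive {x : ℤ} {ξ : ℝ} {Φ : ℂ → ℂ}
    (hΦ : ∀ φ : ℝ, (0 ≤ x → |φ| ≤ 1) → (x < 0 → 1 ≤ |φ|) → HasDerivAt Φ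
      (contourIntegrand (ξ / Real.sqrt (1 - γ ^ 2)) x (γ + Complex.I * φ * Real.sqrt (1 - γ ^ 2)))
      (γ + Complex.I * φ * Real.sqrt (1 - γ ^ 2)))
    (hlim : x < 0 → Tendsto (fun v : ℝ => Φ (γ + Complex.I * v * Real.sqrt (1 - γ ^ 2)))
      (cocompact ℝ) (𝓝 0)) :
    (x < 0 → Tendsto (beadTail γ x ξ) (atTop ×ˢ atTop) (𝓝 (-beadKernel γ x ξ))) ∧
    Complex.exp ((ξ / Real.sqrt (1 - γ ^ 2) : ℝ) * γ) / (2 * Real.pi * Complex.I) *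
      (Φ (Complex.exp (Complex.I * (Real.arccos γ : ℝ))) -
        Φ (Complex.exp (Complex.I * (-Real.arccos γ : ℝ)))) =
      Real.sqrt (1 - γ ^ 2) * beadKernel γ x ξ := by
  have hκ := sqrt_one_sub_sq_pos hγ
  have hκ' : (Real.sqrt (1 - γ ^ 2) : ℂ) ≠ 0 := by exact_mod_cast hκ.ne'
  -- the two ends of the arc are the points of the line with parameters `φ = 1` and `φ = -1`
  rw [exp_arccos hγ, exp_neg_arccos hγ]
  set κ := Real.sqrt (1 - γ ^ 2) with hκdef
  set C := Complex.exp ((ξ / κ : ℝ) * γ) / (2 * Real.pi * Complex.I) with hC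
  rcases lt_or_ge x 0 with hx | hx
  · have key : Tendsto (beadTail γ x ξ) (atTop ×ˢ atTop)
        (𝓝 (C / κ * (Φ (γ - Complex.I * κ) - 0) + C / κ * (0 - Φ (γ + Complex.I * κ)))) := by
      have hl := hlim hx
      have hl1 : Tendsto (fun p : ℝ × ℝ => Φ (γ + Complex.I * (-p.1 : ℝ) * κ)) (atTop ×ˢ atTop)
          (𝓝 0) :=
        (hl.mono_left atBot_le_cocompact).comp (tendsto_neg_atTop_atBot.comp tendsto_fst)
      have hl2 : Tendsto (fun p : ℝ × ℝ => Φ (γ + Complex.I * p.2 * κ)) (atTop ×ˢ atTop)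
          (𝓝 0) := (hl.mono_left atTop_le_cocompact).comp tendsto_snd
      have h3 := ((hl1.const_sub (Φ (γ - Complex.I * κ))).const_mul (C / κ)).add
        ((hl2.sub_const (Φ (γ + Complex.I * κ))).const_mul (C / κ))
      refine h3.congr' ?_
      filter_upwards [prod_mem_prod (Ici_mem_atTop (1 : ℝ)) (Ici_mem_atTop (1 : ℝ))] with p hp
      have hp1 : (1 : ℝ) ≤ p.1 := hp.1
      have hp2 : (1 : ℝ) ≤ p.2 := hp.2
      unfold beadTail
      have habs1 : ∀ φ ∈ Set.uIcc (-p.1) (-1), 1 ≤ |φ| := by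
        intro φ hφ
        rw [Set.uIcc_of_le (by linarith)] at hφ
        exact le_abs.2 (Or.inr (by linarith [hφ.2]))
      have habs2 : ∀ φ ∈ Set.uIcc 1 p.2, 1 ≤ |φ| := by
        intro φ hφ
        rw [Set.uIcc_of_le (by linarith)] at hφ
        exact le_abs.2 (Or.inl (by linarith [hφ.1]))
      have hne : ∀ φ : ℝ, 1 ≤ |φ| → φ ≠ 0 := by
        rintro φ h rfl
        norm_num at h
      rw [integral_beadIntegrand hγ (Φ := Φ) (fun _ φ hφ => hne φ (habs1 φ hφ))
          (fun φ hφ => hΦ φ (fun h => absurd hx (not_lt.2 h)) fun _ => habs1 φ hφ),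
        integral_beadIntegrand hγ (Φ := Φ) (fun _ φ hφ => hne φ (habs2 φ hφ))
          (fun φ hφ => hΦ φ (fun h => absurd hx (not_lt.2 h)) fun _ => habs2 φ hφ)]
      have e1 : (γ : ℂ) + Complex.I * ((-1 : ℝ) : ℂ) * κ = γ - Complex.I * κ := by
        push_cast; ring
      have e2 : (γ : ℂ) + Complex.I * ((1 : ℝ) : ℂ) * κ = γ + Complex.I * κ := by
        push_cast; ring
      rw [e1, e2]
    have hJ : beadKernel γ x ξ =
        C / κ * (Φ (γ + Complex.I * κ) - Φ (γ - Complex.I * κ)) := by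
      rw [beadKernel, if_neg (not_le.2 hx), key.limUnder_eq]
      ring
    refine ⟨fun _ => ?_, ?_⟩
    · convert key using 2
      rw [hJ]; ring
    · rw [hJ]; field_simp
  · refine ⟨fun h => absurd h (not_lt.2 hx), ?_⟩
    rw [beadKernel, if_pos hx, integral_beadIntegrand hγ (Φ := Φ)
      (fun h => absurd h (not_lt.2 hx))]
    · rw [← hκdef, ← hC]
      push_cast
      field_simp
      congr 2
    · intro φ hφ
      rw [Set.uIcc_of_le (by norm_num)] at hφ
      exact hΦ φ (fun _ => abs_le.2 hφ) (fun h => absurd h (not_lt.2 hx))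

end

/-- A primitive of the contour integrand on a disc that contains the unit circle if `x ≥ 0`, and on
the plane cut along the negative half-axis if `x < 0`. In the second case it is chosen to vanish at
the ends of the vertical lines, which for `a = 0` is possible only if `x ≠ -1`. -/
lemma exists_primitive_right {a : ℝ} (ha : 0 ≤ a) {x : ℤ} (hx : 0 ≤ x ∨ a ≠ 0 ∨ x ≠ -1)
    {κ : ℝ} (hκ : 0 < κ) : ∃ Φ : ℂ → ℂ,
      (∀ W : ℂ, (0 ≤ x → ‖W‖ < 2) → (x < 0 → W ∈ Complex.slitPlane) →
        HasDerivAt Φ (contourIntegrand a x W) W) ∧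
      (x < 0 → ∀ g : ℝ, Tendsto (fun v : ℝ => Φ (g + Complex.I * v * κ)) (cocompact ℝ) (𝓝 0)) := by
  rcases lt_or_ge x 0 with hx0 | hx0
  · rcases ha.eq_or_lt with rfl | ha
    · have hx1 : x + 1 < 0 := by
        rcases hx with h | h | h
        · omega
        · exact absurd rfl h
        · omega
      have hx1' : ((x : ℂ) + 1) ≠ 0 := by exact_mod_cast hx1.ne
      refine ⟨fun W => W ^ (x + 1) / (x + 1), fun W _ hW => ?_, fun _ g => ?_⟩
      · have hW0 : W ≠ 0 := Complex.slitPlane_ne_zero (hW hx0)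
        refine ((hasDerivAt_zpow (x + 1) W (Or.inl hW0)).div_const _).congr_deriv ?_
        simp [contourIntegrand]
        field_simp
      · rw [← zero_div ((x : ℂ) + 1)]
        refine Tendsto.div_const ?_ _
        refine squeeze_zero_norm' ?_ (tendsto_abs_zpow_cocompact hκ hx1)
        filter_upwards [(Set.finite_singleton (0 : ℝ)).isCompact.compl_mem_cocompact] with v hv
        have hv0 : v ≠ 0 := hv
        rw [norm_zpow]
        apply zpow_le_zpow_left_of_neg hx1 (by positivity)
        have := Complex.abs_im_le_norm (g + Complex.I * v * κ)
        simpa [mul_comm] using this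
    · refine ⟨fun W => -∫ u in Set.Ioi (0 : ℝ), contourIntegrand a x (W + u),
        fun W _ hW => hasDerivAt_ray_integral ha hx0 (hW hx0), fun _ g => ?_⟩
      have h1 := ((tendsto_abs_zpow_cocompact hκ hx0).const_mul (Real.exp (-a * g))).mul_const
        (1 / a)
      rw [mul_zero, zero_mul] at h1
      refine squeeze_zero_norm' ?_ h1
      filter_upwards [(Set.finite_singleton (0 : ℝ)).isCompact.compl_mem_cocompact] with v hv
      have hv0 : v ≠ 0 := hv
      have h2 := norm_ray_integral_le ha hx0 (W := g + Complex.I * v * κ)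
        (by simpa using ⟨hv0, hκ.ne'⟩)
      simpa [mul_comm κ] using h2
  · have hd : DifferentiableOn ℂ (contourIntegrand a x) (Metric.ball 0 2) := by
      obtain ⟨n, rfl⟩ := Int.eq_ofNat_of_zero_le hx0
      unfold contourIntegrand
      simp only [zpow_natCast]
      fun_prop
    obtain ⟨Φ, hΦ⟩ := hd.isExactOn_ball
    exact ⟨Φ, fun W hW _ => hΦ W (by simpa using hW hx0), fun h => absurd h (not_lt.2 hx0)⟩

/-- The reflection `W ↦ -W` of `exists_primitive_right`, for `a ≤ 0`. -/
lemma exists_primitive_left {a : ℝ} (ha : a ≤ 0) {x : ℤ} (hx : 0 ≤ x ∨ a ≠ 0 ∨ x ≠ -1)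
    {κ : ℝ} (hκ : 0 < κ) : ∃ Φ : ℂ → ℂ,
      (∀ W : ℂ, (0 ≤ x → ‖W‖ < 2) → (x < 0 → -W ∈ Complex.slitPlane) →
        HasDerivAt Φ (contourIntegrand a x W) W) ∧
      (x < 0 → ∀ g : ℝ, Tendsto (fun v : ℝ => Φ (g + Complex.I * v * κ)) (cocompact ℝ) (𝓝 0)) := by
  obtain ⟨Φ, h1, h2⟩ := exists_primitive_right (a := -a) (by linarith) (x := x)
    (by simpa using hx) hκ
  refine ⟨fun W => -(-1) ^ x * Φ (-W), fun W hW hW' => ?_, fun hx0 g => ?_⟩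
  · have h3 := (h1 (-W) (by simpa using hW) hW').comp W (hasDerivAt_neg W)
    refine (h3.const_mul (-(-1) ^ x)).congr_deriv ?_
    rw [contourIntegrand_neg a x W]
    ring
  · rw [← mul_zero (-(-1 : ℂ) ^ x)]
    refine Tendsto.const_mul _ ?_
    have h3 := (h2 hx0 (-g)).comp (Homeomorph.neg ℝ).isClosedEmbedding.tendsto_cocompact
    refine h3.congr fun v => ?_
    simp only [Function.comp_apply, Homeomorph.coe_neg]
    congr 1
    push_cast
    ring

lemma exp_mem_slitPlane {φ : ℝ} (h : |φ| < Real.pi) :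
    Complex.exp (Complex.I * φ) ∈ Complex.slitPlane := by
  rw [mul_comm, Complex.exp_mul_I, ← Complex.ofReal_cos, ← Complex.ofReal_sin,
    Complex.mem_slitPlane_iff]
  obtain ⟨h1, h2⟩ := abs_lt.1 h
  have him : ((Real.cos φ : ℂ) + Real.sin φ * Complex.I).im = Real.sin φ := by
    rw [Complex.add_im, Complex.mul_I_im, Complex.ofReal_im, Complex.ofReal_re, zero_add]
  rcases lt_trichotomy φ 0 with h0 | rfl | h0
  · right; rw [him]; exact (Real.sin_neg_of_neg_of_neg_pi_lt h0 h1).ne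
  · left; simp
  · right; rw [him]; exact (Real.sin_pos_of_pos_of_lt_pi h0 h2).ne'

lemma neg_exp_mem_slitPlane {φ : ℝ} (h0 : 0 < |φ|) (h : |φ| ≤ Real.pi) :
    -Complex.exp (Complex.I * φ) ∈ Complex.slitPlane := by
  rcases le_or_gt φ 0 with hφ | hφ
  · have h1 : |φ + Real.pi| < Real.pi := by
      rw [abs_of_nonpos hφ] at h0 h
      rw [abs_lt]; constructor <;> linarith
    have := exp_mem_slitPlane h1
    push_cast at this
    rw [mul_add, Complex.exp_add, mul_comm _ (Real.pi : ℂ), Complex.exp_pi_mul_I] at this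
    simpa using this
  · have h1 : |φ - Real.pi| < Real.pi := by
      rw [abs_of_pos hφ] at h0 h
      rw [abs_lt]; constructor <;> linarith
    have := exp_mem_slitPlane h1
    push_cast at this
    rw [mul_sub, Complex.exp_sub, mul_comm _ (Real.pi : ℂ), Complex.exp_pi_mul_I] at this
    simpa [div_neg] using this

section

variable {γ : ℝ} (hγ : γ ∈ Set.Ioo (-1 : ℝ) 1)
include hγ

lemma arccos_mem_Ioo : Real.arccos γ ∈ Set.Ioo 0 Real.pi :=
  ⟨Real.arccos_pos.2 hγ.2, by
    rw [Real.arccos]; linarith [Real.neg_pi_div_two_lt_arcsin.2 hγ.1]⟩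

lemma line_mem_slitPlane {φ : ℝ} (h : 1 ≤ |φ|) :
    (γ + Complex.I * φ * Real.sqrt (1 - γ ^ 2) : ℂ) ∈ Complex.slitPlane ∧
      -(γ + Complex.I * φ * Real.sqrt (1 - γ ^ 2) : ℂ) ∈ Complex.slitPlane := by
  have h1 : φ ≠ 0 := by rintro rfl; norm_num at h
  have h2 := (sqrt_one_sub_sq_pos hγ).ne'
  constructor <;> rw [Complex.mem_slitPlane_iff] <;> right <;> simp [h1, h2]

lemma norm_line_lt {φ : ℝ} (h : |φ| ≤ 1) :
    ‖(γ + Complex.I * φ * Real.sqrt (1 - γ ^ 2) : ℂ)‖ < 2 := by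
  have h1 : ‖(γ + Complex.I * φ * Real.sqrt (1 - γ ^ 2) : ℂ)‖ ^ 2 ≤ 1 := by
    rw [← Complex.normSq_eq_norm_sq, Complex.normSq_apply]
    simp only [Complex.add_re, Complex.ofReal_re, Complex.mul_re, Complex.I_re, Complex.I_im,
      Complex.ofReal_im, Complex.add_im, Complex.mul_im]
    have h2 : Real.sqrt (1 - γ ^ 2) ^ 2 = 1 - γ ^ 2 :=
      Real.sq_sqrt (by nlinarith [hγ.1, hγ.2])
    have h3 : φ ^ 2 ≤ 1 := by rw [← sq_abs]; nlinarith [abs_nonneg φ]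
    nlinarith [hγ.1, hγ.2]
  nlinarith [norm_nonneg (γ + Complex.I * φ * Real.sqrt (1 - γ ^ 2) : ℂ)]

/-- The bead kernel as an integral over the arc of the unit circle to the right of `γ`. For `x < 0`,
the integrand decays to the right, away from its pole, if `ξ ≥ 0`. -/
lemma beadKernel_eq_arc_right {x : ℤ} {ξ : ℝ} (hxξ : x ≠ -1 ∨ ξ ≠ 0) (h : 0 ≤ x ∨ 0 ≤ ξ) :
    (x < 0 → Tendsto (beadTail γ x ξ) (atTop ×ˢ atTop) (𝓝 (-beadKernel γ x ξ))) ∧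
    ∫ φ in (-Real.arccos γ)..Real.arccos γ, arcIntegrand γ x ξ φ =
      Real.sqrt (1 - γ ^ 2) * beadKernel γ x ξ := by
  have hκ := sqrt_one_sub_sq_pos hγ
  have hα := arccos_mem_Ioo hγ
  obtain ⟨Φ, h1, h2⟩ : ∃ Φ : ℂ → ℂ,
      (∀ W : ℂ, (0 ≤ x → ‖W‖ < 2) → (x < 0 → W ∈ Complex.slitPlane) →
        HasDerivAt Φ (contourIntegrand (ξ / Real.sqrt (1 - γ ^ 2)) x W) W) ∧
      (x < 0 → ∀ g : ℝ, Tendsto (fun v : ℝ => Φ (g + Complex.I * v * Real.sqrt (1 - γ ^ 2)))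
        (cocompact ℝ) (𝓝 0)) := by
    rcases le_or_gt 0 ξ with hξ | hξ
    · refine exists_primitive_right (by positivity) (Or.inr ?_) hκ
      rcases hxξ with h | h
      · exact Or.inr h
      · exact Or.inl (by positivity)
    · have hx : 0 ≤ x := h.resolve_right (not_le.2 hξ)
      obtain ⟨Φ, h1, -⟩ := exists_primitive_left (a := ξ / Real.sqrt (1 - γ ^ 2))
        (div_nonpos_of_nonpos_of_nonneg hξ.le hκ.le) (Or.inl hx) hκ
      exact ⟨Φ, fun W hW _ => h1 W hW fun h => absurd h (not_lt.2 hx),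
        fun h => absurd h (not_lt.2 hx)⟩
  obtain ⟨h3, h4⟩ := bead_of_primitive hγ (x := x) (ξ := ξ) (Φ := Φ)
    (fun φ hφ hφ' => h1 _ (fun h => norm_line_lt hγ (hφ h))
      fun h => (line_mem_slitPlane hγ (hφ' h)).1) fun hx => h2 hx γ
  refine ⟨h3, ?_⟩
  rw [← h4]
  refine integral_arcIntegrand fun φ hφ => h1 _ (fun _ => ?_) fun _ => ?_
  · simp
  · rw [Set.uIcc_of_le (by linarith [hα.1])] at hφ
    exact exp_mem_slitPlane ((abs_le.2 hφ).trans_lt hα.2)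

/-- The bead kernel as an integral over the arc of the unit circle to the left of `γ`, which the
angles `±π` cut into two pieces. -/
lemma beadKernel_eq_arc_left {x : ℤ} {ξ : ℝ} (hxξ : x ≠ -1 ∨ ξ ≠ 0) (h : 0 ≤ x ∨ ξ ≤ 0) :
    (x < 0 → Tendsto (beadTail γ x ξ) (atTop ×ˢ atTop) (𝓝 (-beadKernel γ x ξ))) ∧
    -((∫ φ in (-Real.pi)..(-Real.arccos γ), arcIntegrand γ x ξ φ) +
      ∫ φ in (Real.arccos γ)..Real.pi, arcIntegrand γ x ξ φ) =
      Real.sqrt (1 - γ ^ 2) * beadKernel γ x ξ := by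
  have hκ := sqrt_one_sub_sq_pos hγ
  have hα := arccos_mem_Ioo hγ
  obtain ⟨Φ, h1, h2⟩ : ∃ Φ : ℂ → ℂ,
      (∀ W : ℂ, (0 ≤ x → ‖W‖ < 2) → (x < 0 → -W ∈ Complex.slitPlane) →
        HasDerivAt Φ (contourIntegrand (ξ / Real.sqrt (1 - γ ^ 2)) x W) W) ∧
      (x < 0 → ∀ g : ℝ, Tendsto (fun v : ℝ => Φ (g + Complex.I * v * Real.sqrt (1 - γ ^ 2)))
        (cocompact ℝ) (𝓝 0)) := by
    rcases le_or_gt ξ 0 with hξ | hξ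
    · refine exists_primitive_left (div_nonpos_of_nonpos_of_nonneg hξ hκ.le) (Or.inr ?_) hκ
      rcases hxξ with h | h
      · exact Or.inr h
      · exact Or.inl (by positivity)
    · have hx : 0 ≤ x := h.resolve_right (not_le.2 hξ)
      obtain ⟨Φ, h1, -⟩ := exists_primitive_right (a := ξ / Real.sqrt (1 - γ ^ 2))
        (by positivity) (Or.inl hx) hκ
      exact ⟨Φ, fun W hW _ => h1 W hW fun h => absurd h (not_lt.2 hx),
        fun h => absurd h (not_lt.2 hx)⟩
  obtain ⟨h3, h4⟩ := bead_of_primitive hγ (x := x) (ξ := ξ) (Φ := Φ)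
    (fun φ hφ hφ' => h1 _ (fun h => norm_line_lt hγ (hφ h))
      fun h => (line_mem_slitPlane hγ (hφ' h)).2) fun hx => h2 hx γ
  refine ⟨h3, ?_⟩
  have hexp : ∀ φ : ℝ, ‖Complex.exp (Complex.I * φ)‖ < 2 := by
    intro φ
    simp
  rw [← h4, integral_arcIntegrand (Φ := Φ), integral_arcIntegrand (Φ := Φ)]
  · have e : Complex.exp (Complex.I * (-Real.pi : ℝ)) =
        Complex.exp (Complex.I * (Real.pi : ℝ)) := by
      rw [Complex.exp_eq_exp_iff_exists_int]
      exact ⟨-1, by push_cast; ring⟩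
    rw [e]
    push_cast
    ring
  · intro φ hφ
    rw [Set.uIcc_of_le hα.2.le] at hφ
    refine h1 _ (fun _ => hexp φ) fun _ => neg_exp_mem_slitPlane ?_ ?_
    · rw [abs_pos]; linarith [hφ.1, hα.1]
    · rw [abs_le]; constructor <;> linarith [hφ.1, hφ.2, hα.1]
  · intro φ hφ
    rw [Set.uIcc_of_le (by linarith [hα.2])] at hφ
    refine h1 _ (fun _ => hexp φ) fun _ => neg_exp_mem_slitPlane ?_ ?_
    · rw [abs_pos]; linarith [hφ.2, hα.1]
    · rw [abs_le]; constructor <;> linarith [hφ.1, hφ.2, hα.1]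

end

/-! ### Simple roots of a function of two complex variables -/

/-- A function `p (z, w)`, holomorphic for `z ≠ 0`, whose restriction to `w = 0` has the simple
root `z = 1` and no other root on the unit circle; near `(1, 0)` the zero set is the curve
`z = 1 + β w + …` with `β` real. -/
structure SimpleTentacle (p : ℂ × ℂ → ℂ) (a : ℂ) (β : ℝ) : Prop where
  contDiffAt : ∀ x : ℂ × ℂ, x.1 ≠ 0 → ContDiffAt ℂ 1 p x
  root : p (1, 0) = 0
  a_ne_zero : a ≠ 0
  beta_ne_zero : β ≠ 0
  fderiv_eq : ∀ h k : ℂ, fderiv ℂ p (1, 0) (h, k) = a * (h - β * k)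
  unique : ∀ z : ℂ, ‖z‖ = 1 → p (z, 0) = 0 → z = 1

namespace SimpleTentacle

variable {p : ℂ × ℂ → ℂ} {a : ℂ} {β : ℝ}

lemma hasStrictFDerivAt (hp : SimpleTentacle p a β) {x : ℂ × ℂ} (hx : x.1 ≠ 0) :
    HasStrictFDerivAt p (fderiv ℂ p x) x :=
  (hp.contDiffAt x hx).hasStrictFDerivAt (by norm_num)

lemma continuousAt (hp : SimpleTentacle p a β) {x : ℂ × ℂ} (hx : x.1 ≠ 0) : ContinuousAt p x :=
  (hp.contDiffAt x hx).continuousAt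

lemma hasDerivAt_fst (hp : SimpleTentacle p a β) {z w : ℂ} (hz : z ≠ 0) :
    HasDerivAt (fun z => p (z, w)) (fderiv ℂ p (z, w) (1, 0)) z :=
  (hp.hasStrictFDerivAt (x := (z, w)) hz).hasFDerivAt.comp_hasDerivAt z
    ((hasDerivAt_id z).prodMk (hasDerivAt_const z w))

/-- For `ω` near `0`, the function `p (·, ω)` has exactly one root `g ω` near the unit circle: near
`z = 1` by the implicit function theorem, and elsewhere by the compactness of the circle. -/
lemma exists_root (hp : SimpleTentacle p a β) : ∃ g : ℂ → ℂ, g 0 = 1 ∧ HasDerivAt g β 0 ∧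
    (∀ᶠ ω in 𝓝 (0 : ℂ), ContinuousAt g ω) ∧
    ∀ᶠ x in 𝓝 ((0 : ℝ), (0 : ℂ)), ∀ u ∈ Metric.sphere (0 : ℂ) 1,
      (p (Real.exp x.1 * u, x.2) = 0 ↔ Real.exp x.1 * u = g x.2) := by
  set f : ℂ × ℂ → ℂ := fun v => p (v.2, v.1) with hf
  set L := (fderiv ℂ p (1, 0)).comp
    ((ContinuousLinearMap.snd ℂ ℂ ℂ).prod (ContinuousLinearMap.fst ℂ ℂ ℂ)) with hL
  have dfu : HasStrictFDerivAt f L (0, 1) := by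
    have h1 := hp.hasStrictFDerivAt (x := (1, 0)) one_ne_zero
    exact HasStrictFDerivAt.comp (x := ((0 : ℂ), (1 : ℂ))) h1
      (hasStrictFDerivAt_snd.prodMk hasStrictFDerivAt_fst)
  have hinv : (L ∘L .inr ℂ ℂ ℂ).IsInvertible := by
    refine ⟨ContinuousLinearEquiv.unitsEquivAut ℂ (Units.mk0 a hp.a_ne_zero), ?_⟩
    ext
    simp [hL, hp.fderiv_eq]
  have hiff := dfu.eventually_apply_eq_iff_implicitFunctionOfProdDomain hinv
  have hstrict := dfu.hasStrictFDerivAt_implicitFunctionOfProdDomain hinv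
  have hev := dfu.eventually_apply_implicitFunctionOfProdDomain hinv
  set g := dfu.implicitFunctionOfProdDomain hinv with hg
  have hf0 : f (0, 1) = 0 := hp.root
  have hg0 : g 0 = 1 := hiff.self_of_nhds.1 rfl
  have hgd : HasDerivAt g (deriv g 0) 0 := hstrict.hasFDerivAt.differentiableAt.hasDerivAt
  have hβ : deriv g 0 = β := by
    have h1 : HasDerivAt (fun ω => p (g ω, ω)) (fderiv ℂ p (1, 0) (deriv g 0, 1)) 0 := by
      have h2 : HasFDerivAt p (fderiv ℂ p (1, 0)) ((fun ω : ℂ => (g ω, ω)) 0) := by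
        simp only [hg0]
        exact (hp.hasStrictFDerivAt (x := (1, 0)) one_ne_zero).hasFDerivAt
      exact HasFDerivAt.comp_hasDerivAt (f := fun ω : ℂ => (g ω, ω)) (0 : ℂ) h2
        (hgd.prodMk (hasDerivAt_id (0 : ℂ)))
    have h2 : HasDerivAt (fun ω => p (g ω, ω)) 0 0 := by
      refine (hasDerivAt_const (0 : ℂ) (0 : ℂ)).congr_of_eventuallyEq ?_
      filter_upwards [hev] with ω hω
      rw [← hf0]; exact hω
    have h3 := h1.unique h2
    rw [hp.fderiv_eq, mul_one, mul_eq_zero] at h3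
    exact sub_eq_zero.1 (h3.resolve_left hp.a_ne_zero)
  -- strict differentiability at `0` gives a Lipschitz bound, hence continuity, near `0`
  have hcont : ∀ᶠ ω in 𝓝 (0 : ℂ), ContinuousAt g ω := by
    obtain ⟨K, s, hs, hK⟩ := hstrict.exists_lipschitzOnWith
    filter_upwards [eventually_mem_nhds_iff.2 hs] with ω hω
    exact hK.continuousOn.continuousAt hω
  refine ⟨g, hg0, hβ ▸ hgd, hcont, ?_⟩
  refine (isCompact_sphere (0 : ℂ) 1).eventually_forall_of_forall_eventually
    (P := fun (x : ℝ × ℂ) u => p (Real.exp x.1 * u, x.2) = 0 ↔ Real.exp x.1 * u = g x.2)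
    fun u hu => ?_
  have hu1 : ‖u‖ = 1 := by simpa using hu
  have hu0 : u ≠ 0 := by rintro rfl; simp at hu1
  have hc : ContinuousAt (fun x : (ℝ × ℂ) × ℂ => ((Real.exp x.1.1 * x.2 : ℂ), x.1.2))
      ((0, 0), u) := by fun_prop
  by_cases h1 : u = 1
  · subst h1
    have h2 : Tendsto (fun x : (ℝ × ℂ) × ℂ => (x.1.2, (Real.exp x.1.1 * x.2 : ℂ)))
        (𝓝 ((0, 0), 1)) (𝓝 (0, 1)) := by
      have : ContinuousAt (fun x : (ℝ × ℂ) × ℂ => (x.1.2, (Real.exp x.1.1 * x.2 : ℂ)))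
        ((0, 0), 1) := by fun_prop
      simpa [ContinuousAt] using this
    filter_upwards [h2.eventually hiff] with x hx
    rw [hf0] at hx
    exact hx.trans eq_comm
  · have h2 : p (u, 0) ≠ 0 := fun h => h1 (hp.unique u hu1 h)
    have h3 : ∀ᶠ x : (ℝ × ℂ) × ℂ in 𝓝 ((0, 0), u), p (Real.exp x.1.1 * x.2, x.1.2) ≠ 0 := by
      have : ContinuousAt (fun x : (ℝ × ℂ) × ℂ => p (Real.exp x.1.1 * x.2, x.1.2))
          ((0, 0), u) := by
        refine ContinuousAt.comp (g := p) ?_ hc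
        have := hp.continuousAt (x := (u, 0)) hu0
        simpa using this
      apply this.eventually_ne
      simpa using h2
    have h4 : ∀ᶠ x : (ℝ × ℂ) × ℂ in 𝓝 ((0, 0), u), Real.exp x.1.1 * x.2 - g x.1.2 ≠ 0 := by
      have : ContinuousAt (fun x : (ℝ × ℂ) × ℂ => Real.exp x.1.1 * x.2 - g x.1.2)
          ((0, 0), u) := by
        refine ContinuousAt.sub (by fun_prop) ?_
        refine ContinuousAt.comp (g := g) (f := fun x : (ℝ × ℂ) × ℂ => x.1.2) ?_ (by fun_prop)
        exact hgd.continuousAt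
      apply this.eventually_ne
      simpa [hg0, sub_eq_zero] using h1
    filter_upwards [h3, h4] with x hx3 hx4
    exact ⟨fun h => absurd h hx3, fun h => absurd (sub_eq_zero.2 h) hx4⟩

end SimpleTentacle

/-- A map to `ℂ` of two real variables whose partial derivatives are linearly independent over
`ℝ` at a zero grows linearly away from this zero. -/
lemma eventually_norm_sub_le_of_hasFDerivAt {Φ : ℝ × ℝ → ℂ} {A B : ℂ} {x₀ : ℝ × ℝ}
    (hΦ : HasFDerivAt Φ ((ContinuousLinearMap.fst ℝ ℝ ℝ).smulRight A +
      (ContinuousLinearMap.snd ℝ ℝ ℝ).smulRight B) x₀)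
    (hAB : (starRingEnd ℂ A * B).im ≠ 0) (h0 : Φ x₀ = 0) :
    ∃ C > 0, ∀ᶠ x in 𝓝 x₀, ‖x - x₀‖ ≤ C * ‖Φ x‖ := by
  set L := (ContinuousLinearMap.fst ℝ ℝ ℝ).smulRight A +
      (ContinuousLinearMap.snd ℝ ℝ ℝ).smulRight B with hL
  have hker : LinearMap.ker (L : ℝ × ℝ →ₗ[ℝ] ℂ) = ⊥ := by
    rw [LinearMap.ker_eq_bot']
    rintro ⟨h, k⟩ hhk
    have h1 : (h : ℂ) * A + k * B = 0 := by simpa [hL] using hhk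
    have hre := congrArg Complex.re h1
    have him := congrArg Complex.im h1
    simp at hre him hAB
    have hk : k * (A.re * B.im - A.im * B.re) = 0 := by linear_combination A.re * him - A.im * hre
    have hh : h * (A.re * B.im - A.im * B.re) = 0 := by linear_combination B.im * hre - B.re * him
    have hne : A.re * B.im - A.im * B.re ≠ 0 := fun h => hAB (by linarith)
    ext
    · exact (mul_eq_zero.1 hh).resolve_right hne
    · exact (mul_eq_zero.1 hk).resolve_right hne
  obtain ⟨K, hK0, hK⟩ := LinearMap.exists_antilipschitzWith (L : ℝ × ℝ →ₗ[ℝ] ℂ) hker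
  have hK0' : (0 : ℝ) < K := hK0
  refine ⟨2 * K, by positivity, ?_⟩
  have ho := hΦ.isLittleO.def (show (0 : ℝ) < 1 / (2 * K) by positivity)
  filter_upwards [ho] with x hx
  have h1 : ‖x - x₀‖ ≤ K * ‖L (x - x₀)‖ := by
    have := hK.le_mul_dist (x - x₀) 0
    simpa using this
  rw [h0, sub_zero] at hx
  have h2 : ‖L (x - x₀)‖ ≤ ‖Φ x‖ + 1 / (2 * K) * ‖x - x₀‖ := by
    calc ‖L (x - x₀)‖ = ‖Φ x - (Φ x - L (x - x₀))‖ := by congr 1; abel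
      _ ≤ ‖Φ x‖ + ‖Φ x - L (x - x₀)‖ := norm_sub_le _ _
      _ ≤ _ := by gcongr
  have h3 : (K : ℝ) * ‖L (x - x₀)‖ ≤ K * ‖Φ x‖ + 1 / 2 * ‖x - x₀‖ := by
    calc _ ≤ (K : ℝ) * (‖Φ x‖ + 1 / (2 * K) * ‖x - x₀‖) := by gcongr
      _ = _ := by field_simp
  linarith

lemma locallyIntegrable_inv_norm_sub (x₀ : ℝ × ℝ) :
    LocallyIntegrable (fun x : ℝ × ℝ => ‖x - x₀‖⁻¹) := by
  have h : LocallyIntegrable (fun x : ℝ × ℝ => ‖x‖⁻¹) := by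
    refine locallyIntegrable_of_norm_le_rpow (C := 1) (α := 1) ?_ ?_ ?_ ?_
    · simp
    · simp
    · refine Eventually.of_forall fun x => ?_
      rw [Real.rpow_neg_one]
      simp
    · exact (measurable_norm.inv).aestronglyMeasurable
  intro x
  obtain ⟨s, hs, hi⟩ := h (x - x₀)
  refine ⟨(fun y => y - x₀) ⁻¹' s, ?_, ?_⟩
  · exact (show ContinuousAt (fun y : ℝ × ℝ => y - x₀) x by fun_prop).preimage_mem_nhds hs
  · have := (measurePreserving_sub_right (volume : Measure (ℝ × ℝ)) x₀).integrableOn_comp_preimage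
      (Homeomorph.subRight x₀).measurableEmbedding (f := fun x => ‖x‖⁻¹) (s := s)
    exact this.2 hi

/-- If at each zero of `Φ` the partial derivatives are linearly independent over `ℝ`, then
`1 / Φ` is integrable on compact sets, and the zeros in a compact set are finite in number. -/
lemma integrableOn_inv_of_nondegenerate {Φ : ℝ × ℝ → ℂ} (hc : Continuous Φ) {A B : ℝ × ℝ → ℂ}
    (hΦ : ∀ x, HasFDerivAt Φ ((ContinuousLinearMap.fst ℝ ℝ ℝ).smulRight (A x) +
      (ContinuousLinearMap.snd ℝ ℝ ℝ).smulRight (B x)) x)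
    (hAB : ∀ x, Φ x = 0 → (starRingEnd ℂ (A x) * B x).im ≠ 0) {K : Set (ℝ × ℝ)}
    (hK : IsCompact K) :
    IntegrableOn (fun x => (Φ x)⁻¹) K ∧ (K ∩ {x | Φ x = 0}).Finite := by
  constructor
  · refine LocallyIntegrableOn.integrableOn_isCompact (fun x _ => ?_) hK
    refine IntegrableAtFilter.filter_mono nhdsWithin_le_nhds ?_
    by_cases hx : Φ x = 0
    · obtain ⟨C, hC, hev⟩ := eventually_norm_sub_le_of_hasFDerivAt (hΦ x) (hAB x hx) hx
      obtain ⟨s, hs, hi⟩ := locallyIntegrable_inv_norm_sub x x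
      obtain ⟨t, ht, hto, hxt⟩ := mem_nhds_iff.1 (inter_mem hs hev)
      refine ⟨t, hto.mem_nhds hxt, ?_⟩
      refine Integrable.mono' ((hi.mono_set fun y hy => (ht hy).1).const_mul C)
        (hc.measurable.inv.aestronglyMeasurable) ?_
      filter_upwards [ae_restrict_mem hto.measurableSet] with y hy
      rw [norm_inv]
      have h1 := (ht hy).2
      by_cases hy0 : ‖Φ y‖ = 0
      · rw [hy0, inv_zero]; positivity
      have hpos : 0 < ‖Φ y‖ := lt_of_le_of_ne (norm_nonneg _) (Ne.symm hy0)
      rcases (norm_nonneg (y - x)).eq_or_lt with h2 | h2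
      · have : y = x := sub_eq_zero.1 (norm_eq_zero.1 h2.symm)
        rw [this, hx] at hy0
        simp at hy0
      · rw [← div_eq_mul_inv, inv_eq_one_div, div_le_div_iff₀ hpos h2, one_mul]
        exact h1
    · exact (volume.finiteAt_nhds x).integrableAtFilter_of_tendsto
        (hc.measurable.inv.aestronglyMeasurable.stronglyMeasurableAtFilter)
        (hc.continuousAt.inv₀ hx)
  · refine hK.induction_on (p := fun s => (s ∩ {x | Φ x = 0}).Finite) (by simp)
      (fun s t hst ht => ht.subset (Set.inter_subset_inter_left _ hst))
      (fun s t hs ht => by rw [Set.union_inter_distrib_right]; exact hs.union ht) fun x _ => ?_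
    by_cases hx : Φ x = 0
    · obtain ⟨C, hC, hev⟩ := eventually_norm_sub_le_of_hasFDerivAt (hΦ x) (hAB x hx) hx
      refine ⟨_, mem_nhdsWithin_of_mem_nhds hev, (Set.finite_singleton x).subset ?_⟩
      rintro y ⟨hy, hy0⟩
      have hy0' : Φ y = 0 := hy0
      have : ‖y - x‖ ≤ C * ‖Φ y‖ := hy
      rw [hy0', norm_zero, mul_zero] at this
      exact sub_eq_zero.1 (norm_le_zero_iff.1 this)
    · refine ⟨_, mem_nhdsWithin_of_mem_nhds (hc.continuousAt.eventually_ne hx), ?_⟩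
      convert Set.finite_empty
      ext y
      simp

/-! ### The logarithm of the root and integrability on the torus -/

lemma eventually_forall_circle {P : ℂ → Prop} (h : ∀ᶠ ω in 𝓝 (0 : ℂ), P ω) :
    ∀ᶠ t : ℝ in 𝓝[>] 0, ∀ φ : ℝ, P (t * Complex.exp (Complex.I * φ)) := by
  obtain ⟨ε, hε, hP⟩ := Metric.eventually_nhds_iff.1 h
  filter_upwards [Ioo_mem_nhdsGT hε] with t ht φ
  apply hP
  simp [abs_of_pos ht.1, ht.2]

namespace SimpleTentacle

variable {p : ℂ × ℂ → ℂ} {a : ℂ} {β : ℝ}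

/-- The root of `p (·, ω)` near `1`, in the form `exp (L ω)`; it is the only root in a thin
annulus around the unit circle. -/
lemma exists_log_root (hp : SimpleTentacle p a β) : ∃ L : ℂ → ℂ, L 0 = 0 ∧ HasDerivAt L β 0 ∧
    (∀ᶠ ω in 𝓝 (0 : ℂ), ContinuousAt L ω) ∧
    ∃ δ > 0, ∀ᶠ ω in 𝓝 (0 : ℂ), ∀ z : ℂ, z ≠ 0 → |Real.log ‖z‖| ≤ δ →
      (p (z, ω) = 0 ↔ z = Complex.exp (L ω)) := by
  obtain ⟨g, hg0, hgd, hgc, hroot⟩ := hp.exists_root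
  have hslit : ∀ᶠ ω in 𝓝 (0 : ℂ), g ω ∈ Complex.slitPlane := by
    refine hgd.continuousAt.eventually_mem (Complex.isOpen_slitPlane.mem_nhds ?_)
    rw [hg0]; exact Complex.one_mem_slitPlane
  have hL0 : Complex.log (g 0) = 0 := by rw [hg0, Complex.log_one]
  have hLd : HasDerivAt (fun ω => Complex.log (g ω)) β 0 := by
    have := hgd.clog hslit.self_of_nhds
    simpa [hg0] using this
  refine ⟨fun ω => Complex.log (g ω), hL0, hLd, ?_, ?_⟩
  · filter_upwards [hgc, hslit] with ω h1 h2
    exact h1.clog h2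
  · have hev : ∀ᶠ x in 𝓝 ((0 : ℝ), (0 : ℂ)), ∀ u ∈ Metric.sphere (0 : ℂ) 1,
        (p (Real.exp x.1 * u, x.2) = 0 ↔ Real.exp x.1 * u = Complex.exp (Complex.log (g x.2))) := by
      have h2 : ∀ᶠ x in 𝓝 ((0 : ℝ), (0 : ℂ)), g x.2 ∈ Complex.slitPlane :=
        (continuous_snd.tendsto ((0 : ℝ), (0 : ℂ))).eventually hslit
      filter_upwards [hroot, h2] with x hx hx2 u hu
      rw [Complex.exp_log (Complex.slitPlane_ne_zero hx2)]
      exact hx u hu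
    obtain ⟨δ, hδ, hball⟩ := Metric.eventually_nhds_iff.1 hev
    refine ⟨δ / 2, by positivity, ?_⟩
    filter_upwards [Metric.ball_mem_nhds (0 : ℂ) hδ] with ω hω z hz hlog
    have hz' : (‖z‖ : ℂ) ≠ 0 := by exact_mod_cast norm_ne_zero_iff.2 hz
    have h1 : ((Real.exp (Real.log ‖z‖) : ℝ) : ℂ) * (z / ‖z‖) = z := by
      rw [Real.exp_log (norm_pos_iff.2 hz)]
      field_simp
    have h2 := hball (y := (Real.log ‖z‖, ω)) (by
      rw [Prod.dist_eq, max_lt_iff]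
      refine ⟨?_, by simpa using hω⟩
      rw [Real.dist_eq, sub_zero]
      linarith) (z / ‖z‖) (by simp [hz])
    rw [h1] at h2
    exact h2

lemma continuousAt_fderiv (hp : SimpleTentacle p a β) (v : ℂ × ℂ) {x : ℂ × ℂ} (hx : x.1 ≠ 0) :
    ContinuousAt (fun x => fderiv ℂ p x v) x :=
  ((hp.contDiffAt x hx).continuousAt_fderiv (by norm_num)).clm_apply continuousAt_const

/-- The torus of radii `ρ` and `t`, parametrised by angles. -/
def torusMap (ρ t : ℝ) (x : ℝ × ℝ) : ℂ × ℂ :=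
  (ρ * Complex.exp (Complex.I * x.1), t * Complex.exp (Complex.I * x.2))

lemma hasFDerivAt_comp_torusMap (hp : SimpleTentacle p a β) {ρ t : ℝ} (hρ : ρ ≠ 0) (x : ℝ × ℝ) :
    HasFDerivAt (fun x => p (torusMap ρ t x))
      ((ContinuousLinearMap.fst ℝ ℝ ℝ).smulRight
          (fderiv ℂ p (torusMap ρ t x) (1, 0) * (torusMap ρ t x).1 * Complex.I) +
        (ContinuousLinearMap.snd ℝ ℝ ℝ).smulRight
          (fderiv ℂ p (torusMap ρ t x) (0, 1) * (torusMap ρ t x).2 * Complex.I)) x := by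
  have he : ∀ (r s : ℝ), HasDerivAt (fun s : ℝ => (r : ℂ) * Complex.exp (Complex.I * s))
      (r * Complex.exp (Complex.I * s) * Complex.I) s := by
    intro r s
    have := (((hasDerivAt_id (s : ℂ)).const_mul Complex.I).cexp.const_mul (r : ℂ)).comp_ofReal
    simpa [mul_assoc] using this
  have h1 : HasFDerivAt (fun x : ℝ × ℝ => (ρ : ℂ) * Complex.exp (Complex.I * x.1)) _ x :=
    (he ρ x.1).hasFDerivAt.comp x hasFDerivAt_fst
  have h2 : HasFDerivAt (fun x : ℝ × ℝ => (t : ℂ) * Complex.exp (Complex.I * x.2)) _ x :=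
    (he t x.2).hasFDerivAt.comp x hasFDerivAt_snd
  have h3 := (hp.hasStrictFDerivAt (x := torusMap ρ t x)
    (by simpa [torusMap] using hρ)).hasFDerivAt.restrictScalars ℝ
  refine (HasFDerivAt.comp (f := torusMap ρ t) x h3 (h1.prodMk h2)).congr_fderiv ?_
  refine ContinuousLinearMap.ext fun v => ?_
  have hlin : ∀ (y : ℂ × ℂ) (b c : ℂ), fderiv ℂ p y (b, c) =
      b * fderiv ℂ p y (1, 0) + c * fderiv ℂ p y (0, 1) := by
    intro y b c
    rw [← smul_eq_mul, ← smul_eq_mul, ← map_smul, ← map_smul, ← map_add]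
    simp
  refine Eq.trans ?_ ((hlin (torusMap ρ t x) (v.1 * ((torusMap ρ t x).1 * Complex.I))
    (v.2 * ((torusMap ρ t x).2 * Complex.I))).trans ?_)
  · simp [torusMap]
  · simp
    ring

/-- At the zeros of `p` on the torus with radii `exp (β γ t)` and `t`, where `w ≈ γ ± i √(1 - γ²)`
is not real, the angular derivatives of `p` are linearly independent over `ℝ`. -/
lemma eventually_nondegenerate (hp : SimpleTentacle p a β) {γ : ℝ} (hγ : γ ∈ Set.Ioo (-1 : ℝ) 1) :
    ∀ᶠ t : ℝ in 𝓝[>] 0, ∀ x : ℝ × ℝ, p (torusMap (Real.exp (β * γ * t)) t x) = 0 →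
      (starRingEnd ℂ (fderiv ℂ p (torusMap (Real.exp (β * γ * t)) t x) (1, 0) *
          (torusMap (Real.exp (β * γ * t)) t x).1 * Complex.I) *
        (fderiv ℂ p (torusMap (Real.exp (β * γ * t)) t x) (0, 1) *
          (torusMap (Real.exp (β * γ * t)) t x).2 * Complex.I)).im ≠ 0 := by
  obtain ⟨L, hL0, hLd, -, δ, hδ, hroot⟩ := hp.exists_log_root
  have hβ := abs_pos.2 hp.beta_ne_zero
  have hγ1 : |γ| < 1 := abs_lt.2 hγ
  -- at the zeros `|Re w| ≤ m < 1`, hence `|Im w| ≥ κ > 0`, where `w` is the point of the unit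
  -- circle with the second angle
  set m := (1 + |γ|) / 2 with hm
  have hm1 : m < 1 := by rw [hm]; linarith
  have hm0 : 0 < m := by rw [hm]; positivity
  set κ := Real.sqrt (1 - m ^ 2) with hκ
  have hκ0 : 0 < κ := Real.sqrt_pos.2 (by nlinarith)
  have hlin : ∀ᶠ ω in 𝓝 (0 : ℂ), ‖L ω - β * ω‖ ≤ |β| * (1 - |γ|) / 2 * ‖ω‖ := by
    have := hLd.hasFDerivAt.isLittleO.def (show 0 < |β| * (1 - |γ|) / 2 by
      have : 0 < 1 - |γ| := by linarith
      positivity)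
    filter_upwards [this] with ω hω
    simpa [hL0, mul_comm] using hω
  set D : ℂ → ℂ := fun ω => fderiv ℂ p (Complex.exp (L ω), ω) (1, 0) * Complex.exp (L ω) with hD
  set E : ℂ → ℂ := fun ω => fderiv ℂ p (Complex.exp (L ω), ω) (0, 1) with hE
  have hcurve : ContinuousAt (fun ω => (Complex.exp (L ω), ω)) 0 :=
    (hLd.continuousAt.cexp).prodMk continuousAt_id
  have hDc : ContinuousAt D 0 := by
    refine ContinuousAt.mul ?_ hLd.continuousAt.cexp
    exact ContinuousAt.comp (f := fun ω => (Complex.exp (L ω), ω))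
      (g := fun x => fderiv ℂ p x (1, 0)) (hp.continuousAt_fderiv _ (Complex.exp_ne_zero _)) hcurve
  have hEc : ContinuousAt E 0 :=
    ContinuousAt.comp (f := fun ω => (Complex.exp (L ω), ω))
      (g := fun x => fderiv ℂ p x (0, 1)) (hp.continuousAt_fderiv _ (Complex.exp_ne_zero _)) hcurve
  have hD0 : D 0 = a := by simp [hD, hL0, hp.fderiv_eq]
  have hE0 : E 0 = -a * β := by simp [hE, hL0, hp.fderiv_eq]
  have hDne : ∀ᶠ ω in 𝓝 (0 : ℂ), D ω ≠ 0 := hDc.eventually_ne (by rw [hD0]; exact hp.a_ne_zero)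
  -- the quotient of the partial derivatives along the zero curve is close to `-β`, which is real
  have hquot : ∀ᶠ ω in 𝓝 (0 : ℂ), ‖E ω / D ω + β‖ < |β| * κ := by
    have h1 : ContinuousAt (fun ω => ‖E ω / D ω + β‖) 0 :=
      ((hEc.div hDc (by rw [hD0]; exact hp.a_ne_zero)).add continuousAt_const).norm
    apply h1.eventually_lt continuousAt_const
    have ha := hp.a_ne_zero
    have : E 0 / D 0 + β = 0 := by rw [hD0, hE0]; field_simp; ring
    rw [this, norm_zero]; positivity
  have hsmall : ∀ᶠ t : ℝ in 𝓝[>] 0, |β * γ * t| < δ := by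
    have : ContinuousAt (fun t : ℝ => |β * γ * t|) 0 := by fun_prop
    exact nhdsWithin_le_nhds (this.eventually_lt continuousAt_const (by simpa using hδ))
  filter_upwards [eventually_forall_circle hroot, eventually_forall_circle hlin,
    eventually_forall_circle hDne, eventually_forall_circle hquot, hsmall, self_mem_nhdsWithin]
    with t h1 h2 h3 h4 h5 ht x hx
  have ht0 : (0 : ℝ) < t := ht
  specialize h1 x.2
  specialize h2 x.2
  specialize h3 x.2
  specialize h4 x.2
  have hzn : ‖(Real.exp (β * γ * t) : ℂ) * Complex.exp (Complex.I * x.1)‖ =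
      Real.exp (β * γ * t) := by
    rw [norm_mul, Complex.norm_real, mul_comm Complex.I, Complex.norm_exp_ofReal_mul_I]
    simp
  set w := Complex.exp (Complex.I * x.2) with hw
  have hwn : ‖w‖ = 1 := by rw [hw, mul_comm]; exact Complex.norm_exp_ofReal_mul_I _
  have hz := (h1 ((Real.exp (β * γ * t) : ℂ) * Complex.exp (Complex.I * x.1))
    (by simp) (by rw [hzn, Real.log_exp]; exact h5.le)).1 hx
  unfold torusMap
  simp only [hz]
  set ω : ℂ := t * w with hω
  have hωn : ‖ω‖ = t := by rw [hω, norm_mul, hwn, Complex.norm_real]; simp [abs_of_pos ht0]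
  -- a zero on the torus has the modulus `exp (β γ t)`
  have hre : (L ω).re = β * γ * t := by
    have := congrArg norm hz
    rw [hzn, Complex.norm_exp] at this
    exact (Real.exp_injective this).symm
  have hwre : |w.re| ≤ m := by
    have h6 := (Complex.abs_re_le_norm (L ω - β * ω)).trans h2
    rw [hωn, Complex.sub_re, hre, hω] at h6
    have h7 : β * γ * t - ((β : ℂ) * (t * w)).re = (β * t) * (γ - w.re) := by
      simp; ring
    rw [h7, abs_mul, abs_mul, abs_of_pos ht0] at h6
    have h8 : |γ - w.re| ≤ (1 - |γ|) / 2 := by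
      have : (|β| * t) * |γ - w.re| ≤ (|β| * t) * ((1 - |γ|) / 2) := by linarith
      exact le_of_mul_le_mul_left this (by positivity)
    have h9 : |w.re| ≤ |γ| + |γ - w.re| := by
      calc |w.re| = |γ - (γ - w.re)| := by ring_nf
        _ ≤ _ := abs_sub _ _
    rw [hm]; linarith
  have hwim : κ ≤ |w.im| := by
    rw [hκ]
    apply Real.sqrt_le_iff.2
    refine ⟨abs_nonneg _, ?_⟩
    have h6 : w.re * w.re + w.im * w.im = 1 := by
      rw [← Complex.normSq_apply, Complex.normSq_eq_norm_sq, hwn]; norm_num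
    have h7 : |w.re| ^ 2 ≤ m ^ 2 := by gcongr
    rw [sq_abs] at h7 ⊢
    nlinarith
  have hkey : (E ω / D ω * w).im ≠ 0 := by
    intro h0
    have h6 : (E ω / D ω * w).im = ((E ω / D ω + β) * w).im - β * w.im := by
      have : E ω / D ω * w = (E ω / D ω + β) * w - β * w := by ring
      rw [this, Complex.sub_im]; simp
    have h7 := Complex.abs_im_le_norm ((E ω / D ω + β) * w)
    rw [norm_mul, hwn, mul_one] at h7
    have h8 : ((E ω / D ω + β) * w).im = β * w.im := by linarith
    rw [h8, abs_mul] at h7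
    have : |β| * κ ≤ |β| * |w.im| := by gcongr
    linarith
  have hfin : starRingEnd ℂ (D ω * Complex.I) * (E ω * ω * Complex.I) =
      ((Complex.normSq (D ω) * t : ℝ) : ℂ) * (E ω / D ω * w) := by
    have hEω : E ω = D ω * (E ω / D ω) := by field_simp
    have hI : starRingEnd ℂ Complex.I * Complex.I = 1 := by simp
    rw [map_mul]
    calc _ = starRingEnd ℂ (D ω) * E ω * ω * (starRingEnd ℂ Complex.I * Complex.I) := by ring
      _ = starRingEnd ℂ (D ω) * (D ω * (E ω / D ω)) * ω := by rw [hI, mul_one, ← hEω]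
      _ = _ := by
        rw [hω]; push_cast
        rw [← Complex.mul_conj]
        ring
  have hgoal : (starRingEnd ℂ (D ω * Complex.I) * (E ω * ω * Complex.I)).im ≠ 0 := by
    rw [hfin, Complex.im_ofReal_mul]
    exact mul_ne_zero (mul_ne_zero (Complex.normSq_pos.2 h3).ne' ht0.ne') hkey
  exact hgoal

/-- For small `t`, the function `1 / p` is integrable on the torus, on which `p` has finitely many
zeros. -/
lemma eventually_integrableOn_inv (hp : SimpleTentacle p a β) {γ : ℝ}
    (hγ : γ ∈ Set.Ioo (-1 : ℝ) 1) {K : Set (ℝ × ℝ)} (hK : IsCompact K) :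
    ∀ᶠ t : ℝ in 𝓝[>] 0,
      IntegrableOn (fun x => (p (torusMap (Real.exp (β * γ * t)) t x))⁻¹) K ∧
      (K ∩ {x | p (torusMap (Real.exp (β * γ * t)) t x) = 0}).Finite := by
  filter_upwards [hp.eventually_nondegenerate hγ] with t ht
  have hd := fun x => hp.hasFDerivAt_comp_torusMap (t := t) (Real.exp_ne_zero (β * γ * t)) x
  exact integrableOn_inv_of_nondegenerate
    (continuous_iff_continuousAt.2 fun x => (hd x).continuousAt) hd ht hK

end SimpleTentacle

/-! ### Residues in the integral over a circle -/

/-- The dependence on the radius `R` of the integral of a function with one simple pole `z₀` in an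
annulus: apart from a constant, it is the residue if the pole lies inside the circle. -/
lemma exists_circleIntegral_div_eq {P h : ℂ → ℂ} {r₁ r₂ : ℝ} {z₀ : ℂ} (hr : 0 < r₁)
    (hP : ∀ z, z ≠ 0 → DifferentiableAt ℂ P z) (hh : ∀ z, z ≠ 0 → DifferentiableAt ℂ h z)
    (hz₀ : z₀ ≠ 0) (hroot : P z₀ = 0) (hd : deriv P z₀ ≠ 0)
    (huniq : ∀ z, r₁ ≤ ‖z‖ → ‖z‖ ≤ r₂ → P z = 0 → z = z₀) :
    ∃ c, ∀ R, r₁ ≤ R → R ≤ r₂ → ‖z₀‖ ≠ R → ∮ z in C(0, R), h z / P z =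
      c + 2 * Real.pi * Complex.I * (h z₀ / deriv P z₀) * (if ‖z₀‖ < R then 1 else 0) := by
  have hopen : IsOpen {z : ℂ | z ≠ 0} := isOpen_ne
  set q := dslope P z₀ with hq
  have hqz : ∀ z, P z = (z - z₀) * q z := by
    intro z
    have := sub_smul_dslope P z₀ z
    rw [hroot, sub_zero, smul_eq_mul] at this
    exact this.symm
  have hqd : ∀ z, z ≠ 0 → DifferentiableAt ℂ q z := by
    have : DifferentiableOn ℂ q {z : ℂ | z ≠ 0} :=
      (Complex.differentiableOn_dslope (hopen.mem_nhds hz₀)).2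
        fun z hz => (hP z hz).differentiableWithinAt
    exact fun z hz => this.differentiableAt (hopen.mem_nhds hz)
  have hq0 : q z₀ = deriv P z₀ := dslope_same P z₀
  have hqne : ∀ z, r₁ ≤ ‖z‖ → ‖z‖ ≤ r₂ → q z ≠ 0 := by
    intro z h1 h2 h0
    have : z = z₀ := huniq z h1 h2 (by rw [hqz, h0, mul_zero])
    rw [this, hq0] at h0
    exact hd h0
  set H := fun z => h z / q z with hH
  have hHd : ∀ z, z ≠ 0 → q z ≠ 0 → DifferentiableAt ℂ H z :=
    fun z hz hz' => (hh z hz).div (hqd z hz) hz'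
  have hH0 : H z₀ = h z₀ / deriv P z₀ := by rw [hH, ← hq0]
  -- `h / P = D + H z₀ / (z - z₀)`, where `D` has no pole in the annulus
  set D := dslope H z₀ with hD
  have hDd : ∀ z, r₁ ≤ ‖z‖ → ‖z‖ ≤ r₂ → z ≠ z₀ → DifferentiableAt ℂ D z := by
    intro z h1 h2 hz
    have hz0 : z ≠ 0 := norm_pos_iff.1 (hr.trans_le h1)
    exact (differentiableAt_dslope_of_ne hz).2 (hHd z hz0 (hqne z h1 h2))
  have hDc : ∀ z, r₁ ≤ ‖z‖ → ‖z‖ ≤ r₂ → ContinuousAt D z := by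
    intro z h1 h2
    by_cases hz : z = z₀
    · rw [hz]
      exact continuousAt_dslope_same.2 (hHd z₀ hz₀ (by rw [hq0]; exact hd))
    · exact (hDd z h1 h2 hz).continuousAt
  refine ⟨∮ z in C(0, r₁), D z, fun R h1 h2 hR => ?_⟩
  have hR0 : 0 < R := hr.trans_le h1
  have hD' : ∮ z in C(0, R), D z = ∮ z in C(0, r₁), D z := by
    refine Complex.circleIntegral_eq_of_differentiable_on_annulus_off_countable hr h1
      (Set.countable_singleton z₀) ?_ ?_
    · rintro z ⟨hz1, hz2⟩
      simp at hz1 hz2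
      exact (hDc z hz2 (hz1.trans h2)).continuousWithinAt
    · rintro z ⟨⟨hz1, hz2⟩, hz3⟩
      simp at hz1 hz2 hz3
      exact hDd z hz2.le (hz1.le.trans h2) hz3
  have hne : ∀ z ∈ Metric.sphere (0 : ℂ) R, z ≠ z₀ := by
    rintro z hz rfl
    exact hR (by simpa using hz)
  have hinv : ∮ z in C(0, R), (z - z₀)⁻¹ =
      2 * Real.pi * Complex.I * (if ‖z₀‖ < R then 1 else 0) := by
    split_ifs with hlt
    · rw [circleIntegral.integral_sub_inv_of_mem_ball (by simpa using hlt), mul_one]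
    · rw [mul_zero]
      apply DiffContOnCl.circleIntegral_eq_zero hR0.le
      apply DifferentiableOn.diffContOnCl
      intro z hz
      rw [closure_ball _ hR0.ne'] at hz
      refine DifferentiableAt.differentiableWithinAt (DifferentiableAt.inv (by fun_prop) ?_)
      rw [sub_ne_zero]
      rintro rfl
      exact hR (le_antisymm (by simpa using hz) (not_lt.1 hlt))
  have hcongr : ∮ z in C(0, R), h z / P z =
      ∮ z in C(0, R), (D z + H z₀ * (z - z₀)⁻¹) := by
    refine circleIntegral.integral_congr hR0.le fun z hz => ?_
    have hzz := hne z hz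
    have hzz' : z - z₀ ≠ 0 := sub_ne_zero.2 hzz
    have hzn : ‖z‖ = R := by simpa using hz
    have hq' := hqne z (by rw [hzn]; exact h1) (by rw [hzn]; exact h2)
    simp only [hD, dslope_of_ne H hzz, slope_def_field, hqz z]
    rw [show H z = h z / q z from rfl]
    field_simp
    ring
  rw [hcongr, circleIntegral.integral_add, circleIntegral.integral_const_mul, hD', hinv, hH0]
  · ring
  · apply ContinuousOn.circleIntegrable hR0.le
    intro z hz
    have hzn : ‖z‖ = R := by simpa using hz
    exact (hDc z (by rw [hzn]; exact h1) (by rw [hzn]; exact h2)).continuousWithinAt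
  · apply ContinuousOn.circleIntegrable hR0.le
    refine continuousOn_const.mul (ContinuousOn.inv₀ (by fun_prop) fun z hz => ?_)
    exact sub_ne_zero.2 (hne z hz)

lemma integral_angle_eq_circleIntegral (f : ℂ → ℂ) {R : ℝ} (hR : 0 < R) :
    ∫ θ in (-Real.pi)..Real.pi, f (R * Complex.exp (Complex.I * θ)) =
      -Complex.I * ∮ z in C(0, R), f z / z := by
  have hper : Function.Periodic (fun θ : ℝ => f (R * Complex.exp (Complex.I * θ)))
      (2 * Real.pi) := by
    intro θ
    simp only
    congr 2
    push_cast
    rw [mul_add, Complex.exp_add,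
      show Complex.I * (2 * Real.pi) = 2 * Real.pi * Complex.I by ring, Complex.exp_two_pi_mul_I,
      mul_one]
  have h1 := hper.intervalIntegral_add_eq (-Real.pi) 0
  rw [show -Real.pi + 2 * Real.pi = Real.pi by ring, zero_add] at h1
  rw [h1, circleIntegral, ← intervalIntegral.integral_const_mul]
  congr 1
  ext θ
  rw [deriv_circleMap]
  have h2 : circleMap 0 R θ = R * Complex.exp (Complex.I * θ) := by
    simp [circleMap, mul_comm]
  have h3 : (R : ℂ) * Complex.exp (Complex.I * θ) ≠ 0 :=
    mul_ne_zero (by exact_mod_cast hR.ne') (Complex.exp_ne_zero _)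
  have h4 : (R : ℂ) ≠ 0 := by exact_mod_cast hR.ne'
  rw [h2, smul_eq_mul]
  field_simp
  simp

namespace SimpleTentacle

variable {p q : ℂ × ℂ → ℂ} {a : ℂ} {β : ℝ}

/-- Moving the circle of integration from the radius `exp b` to the radius `exp (s δ)`, `s = ± 1`,
changes the integral by the residue at the root if this root lies between the two circles. -/
lemma inner_integral_eq (hp : SimpleTentacle p a β)
    (hq : ∀ x : ℂ × ℂ, x.1 ≠ 0 → ContDiffAt ℂ 1 q x) {ω l : ℂ} {δ b : ℝ}
    (hroot : ∀ z : ℂ, z ≠ 0 → |Real.log ‖z‖| ≤ δ → (p (z, ω) = 0 ↔ z = Complex.exp l))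
    (hl : |l.re| < δ) (hd : fderiv ℂ p (Complex.exp l, ω) (1, 0) ≠ 0) (hb : |b| < δ)
    (hlb : l.re ≠ b) {s : ℝ} (hs : s = 1 ∨ s = -1) (y : ℤ) :
    ∫ θ in (-Real.pi)..Real.pi, Complex.exp (Complex.I * θ) ^ (-y) *
        (q (Real.exp b * Complex.exp (Complex.I * θ), ω) /
          p (Real.exp b * Complex.exp (Complex.I * θ), ω)) =
      (∫ θ in (-Real.pi)..Real.pi, Complex.exp (Complex.I * θ) ^ (-y) *
        (Complex.exp (-y * (s * δ - b)) *
          (q (Real.exp (s * δ) * Complex.exp (Complex.I * θ), ω) /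
            p (Real.exp (s * δ) * Complex.exp (Complex.I * θ), ω)))) +
      2 * Real.pi * (Complex.exp (-y * (l - b)) *
        (q (Complex.exp l, ω) / (Complex.exp l * fderiv ℂ p (Complex.exp l, ω) (1, 0)))) *
          ((if l.re < b then 1 else 0) - (if s = 1 then 1 else 0)) := by
  have hδ : 0 < δ := (abs_nonneg _).trans_lt hl
  have hb' := abs_lt.1 hb
  have hl' := abs_lt.1 hl
  -- the factor `1 / z` comes from `dθ = dz / (i z)`
  set h : ℂ → ℂ := fun z => (z / Real.exp b) ^ (-y) * q (z, ω) / z with hh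
  have hhd : ∀ z, z ≠ 0 → DifferentiableAt ℂ h z := by
    intro z hz
    have h1 : DifferentiableAt ℂ (fun z : ℂ => (z / Real.exp b) ^ (-y)) z := by
      refine DifferentiableAt.zpow (by fun_prop) (Or.inl ?_)
      exact div_ne_zero hz (by exact_mod_cast Real.exp_ne_zero b)
    have h2 : DifferentiableAt ℂ (fun z : ℂ => q (z, ω)) z :=
      ((hq (z, ω) hz).differentiableAt (by norm_num)).comp z (by fun_prop)
    exact (h1.mul h2).div differentiableAt_id hz
  have hder : deriv (fun z => p (z, ω)) (Complex.exp l) =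
      fderiv ℂ p (Complex.exp l, ω) (1, 0) := (hp.hasDerivAt_fst (Complex.exp_ne_zero l)).deriv
  have hlog : Real.log ‖Complex.exp l‖ = l.re := by rw [Complex.norm_exp, Real.log_exp]
  obtain ⟨c, hc⟩ := exists_circleIntegral_div_eq (P := fun z => p (z, ω)) (h := h)
    (r₁ := Real.exp (-δ)) (r₂ := Real.exp δ) (z₀ := Complex.exp l) (Real.exp_pos _)
    (fun z hz => (hp.hasDerivAt_fst hz).differentiableAt) hhd (Complex.exp_ne_zero _)
    ((hroot _ (Complex.exp_ne_zero _) (by rw [hlog]; exact hl.le)).2 rfl)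
    (by rw [hder]; exact hd)
    (fun z h1 h2 h3 => by
      have hz : 0 < ‖z‖ := (Real.exp_pos _).trans_le h1
      refine (hroot z (norm_pos_iff.1 hz) (abs_le.2 ⟨?_, ?_⟩)).1 h3
      · exact (Real.le_log_iff_exp_le hz).2 h1
      · exact (Real.log_le_iff_le_exp hz).2 h2)
  -- both circles are instances of one formula, with `b' = b` and `b' = s δ`
  have hform : ∀ b' : ℝ, -δ ≤ b' → b' ≤ δ → l.re ≠ b' →
      ∫ θ in (-Real.pi)..Real.pi, Complex.exp (Complex.I * θ) ^ (-y) *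
        (Complex.exp (-y * (b' - b)) *
          (q (Real.exp b' * Complex.exp (Complex.I * θ), ω) /
            p (Real.exp b' * Complex.exp (Complex.I * θ), ω))) =
      -Complex.I * (c + 2 * Real.pi * Complex.I *
        (h (Complex.exp l) / fderiv ℂ p (Complex.exp l, ω) (1, 0)) *
          (if l.re < b' then 1 else 0)) := by
    intro b' h1 h2 h3
    have h4 := hc (Real.exp b') (Real.exp_le_exp.2 h1) (Real.exp_le_exp.2 h2)
      (by rw [Complex.norm_exp]; exact fun h => h3 (Real.exp_injective h))
    rw [hder, Complex.norm_exp] at h4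
    simp only [Real.exp_lt_exp] at h4
    rw [← h4]
    have h5 := integral_angle_eq_circleIntegral
      (fun z => (z / Real.exp b) ^ (-y) * (q (z, ω) / p (z, ω))) (Real.exp_pos b')
    convert h5 using 1
    · congr 1
      ext θ
      have h6 : (Real.exp b' * Complex.exp (Complex.I * θ) / Real.exp b : ℂ) =
          Complex.exp (b' - b) * Complex.exp (Complex.I * θ) := by
        rw [Complex.exp_sub]; push_cast; ring
      rw [h6, mul_zpow, ← Complex.exp_int_mul (b' - b : ℂ)]
      push_cast
      ring
    · congr 2
      ext z
      rw [hh]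
      ring
  have e1 := hform b hb'.1.le hb'.2.le hlb
  have hsδ : -δ ≤ s * δ ∧ s * δ ≤ δ ∧ l.re ≠ s * δ ∧ (l.re < s * δ ↔ s = 1) := by
    rcases hs with rfl | rfl
    · refine ⟨by linarith, by linarith, by linarith, by simp [hl'.2]⟩
    · refine ⟨by linarith, by linarith, by linarith, ?_⟩
      constructor
      · intro h; linarith
      · intro h; norm_num at h
  have e2 := hform (s * δ) hsδ.1 hsδ.2.1 hsδ.2.2.1
  simp only [hsδ.2.2.2] at e2
  have hhl : h (Complex.exp l) = Complex.exp (-y * (l - b)) * q (Complex.exp l, ω) /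
      Complex.exp l := by
    rw [hh]
    simp only
    rw [Complex.ofReal_exp, ← Complex.exp_sub, ← Complex.exp_int_mul]
    push_cast
    rfl
  rw [hhl] at e1 e2
  simp only [sub_self, mul_zero, Complex.exp_zero, one_mul] at e1
  push_cast at e1 e2 ⊢
  rw [e1, e2]
  have hI : Complex.I * Complex.I = -1 := Complex.I_mul_I
  generalize (if l.re < b then (1 : ℂ) else 0) = u
  generalize (if s = 1 then (1 : ℂ) else 0) = v
  generalize Complex.exp (-y * (l - b)) = E
  have hel := Complex.exp_ne_zero l
  field_simp
  linear_combination (2 * Real.pi * E * q (Complex.exp l, ω) * (v - u)) * hI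

end SimpleTentacle

/-! ### The residue term -/

lemma norm_exp_I_mul (φ : ℝ) : ‖Complex.exp (Complex.I * φ)‖ = 1 := by
  rw [mul_comm]; exact Complex.norm_exp_ofReal_mul_I φ

lemma exp_I_mul_re (φ : ℝ) : (Complex.exp (Complex.I * φ)).re = Real.cos φ := by
  rw [mul_comm]; exact Complex.exp_ofReal_mul_I_re φ

lemma continuous_exp_zpow (n : ℤ) : Continuous fun φ : ℝ => Complex.exp (Complex.I * φ) ^ n :=
  Continuous.zpow₀ (by fun_prop) n fun _ => Or.inl (Complex.exp_ne_zero _)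

lemma continuous_arcIntegrand (γ : ℝ) (x : ℤ) (ξ : ℝ) : Continuous (arcIntegrand γ x ξ) := by
  unfold arcIntegrand
  exact (Continuous.mul (by fun_prop) (continuous_exp_zpow _)).div_const _

/-- For an angle `φ ∈ (-π, π]`, `cos φ > γ` if and only if `|φ| < arccos γ`. -/
lemma lt_cos_iff {γ φ : ℝ} (hγ : γ ∈ Set.Ioo (-1 : ℝ) 1) (hφ : φ ∈ Set.Ioc (-Real.pi) Real.pi) :
    γ < Real.cos φ ↔ |φ| < Real.arccos γ := by
  exact ⟨fun h => by
    by_contra h2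
    have h3 := Real.strictAntiOn_cos.antitoneOn ⟨Real.arccos_nonneg γ, Real.arccos_le_pi γ⟩
      ⟨abs_nonneg φ, abs_le.2 ⟨hφ.1.le, hφ.2⟩⟩ (not_lt.1 h2)
    rw [Real.cos_arccos hγ.1.le hγ.2.le, Real.cos_abs] at h3
    linarith, fun h => by
    have h3 := Real.strictAntiOn_cos ⟨abs_nonneg φ, abs_le.2 ⟨hφ.1.le, hφ.2⟩⟩
      ⟨Real.arccos_nonneg γ, Real.arccos_le_pi γ⟩ h
    rwa [Real.cos_arccos hγ.1.le hγ.2.le, Real.cos_abs] at h3⟩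

lemma ae_cos_ne (γ : ℝ) :
    ∀ᵐ φ : ℝ, φ ∈ Set.Ioc (-Real.pi) Real.pi → Real.cos φ ≠ γ := by
  have h : ({Real.arccos γ, -Real.arccos γ} : Set ℝ).Finite := by simp
  filter_upwards [h.measure_zero volume |> fun h => compl_mem_ae_iff.2 h] with φ hφ hφ' hcos
  apply hφ
  rw [← hcos]
  have h1 : Real.arccos (Real.cos φ) = |φ| := by
    rw [← Real.cos_abs]
    exact Real.arccos_cos (abs_nonneg _) (abs_le.2 ⟨hφ'.1.le, hφ'.2⟩)
  rw [h1]
  rcases abs_cases φ with ⟨h, -⟩ | ⟨h, -⟩ <;> rw [h] <;> simp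

lemma integral_arc_indicator {γ : ℝ} (hγ : γ ∈ Set.Ioo (-1 : ℝ) 1) {f : ℝ → ℂ} :
    ∫ φ in (-Real.pi)..Real.pi, f φ * (if γ < Real.cos φ then 1 else 0) =
      ∫ φ in (-Real.arccos γ)..Real.arccos γ, f φ := by
  have hα := arccos_mem_Ioo hγ
  rw [intervalIntegral.integral_of_le (by linarith [Real.pi_pos]),
    intervalIntegral.integral_of_le (by linarith [hα.1]),
    integral_Ioc_eq_integral_Ioo (x := -Real.arccos γ)]
  have h1 : ∀ φ ∈ Set.Ioc (-Real.pi) Real.pi, f φ * (if γ < Real.cos φ then 1 else 0) =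
      (Set.Ioo (-Real.arccos γ) (Real.arccos γ)).indicator f φ := by
    intro φ hφ
    rw [Set.indicator_apply]
    simp only [lt_cos_iff hγ hφ, Set.mem_Ioo, ← abs_lt]
    split_ifs <;> simp
  rw [setIntegral_congr_fun measurableSet_Ioc h1, setIntegral_indicator measurableSet_Ioo]
  congr 2
  apply Set.inter_eq_right.2
  intro φ hφ
  exact ⟨by linarith [hφ.1, hα.2], by linarith [hφ.2, hα.2]⟩

/-- The arc integrals that arise from the two possible directions of the contour shift: `s = 1`
for a shift to a larger circle, `s = -1` for a shift to a smaller one. -/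
lemma integral_arc_eq_beadKernel {γ β : ℝ} (hγ : γ ∈ Set.Ioo (-1 : ℝ) 1) (hβ : β ≠ 0) {x : ℤ}
    {ξ s : ℝ} (hs : s = 1 ∨ s = -1) (hxξ : x ≠ -1 ∨ ξ ≠ 0) (h : 0 ≤ x ∨ 0 ≤ s * β * ξ) :
    ∫ φ in (-Real.pi)..Real.pi, arcIntegrand γ x ξ φ *
        ((if β * (Real.cos φ - γ) < 0 then 1 else 0) - (if s = 1 then 1 else 0)) =
      -(|β| / β : ℝ) * (Real.sqrt (1 - γ ^ 2) * beadKernel γ x ξ) := by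
  have hα := arccos_mem_Ioo hγ
  have hint : ∀ u v : ℝ, IntervalIntegrable (arcIntegrand γ x ξ) volume u v :=
    fun u v => (continuous_arcIntegrand γ x ξ).intervalIntegrable u v
  have hint2 : IntervalIntegrable
      (fun φ => arcIntegrand γ x ξ φ * (if γ < Real.cos φ then 1 else 0)) volume
      (-Real.pi) Real.pi := by
    refine (hint (-Real.pi) Real.pi).mono_fun (Measurable.aestronglyMeasurable ?_) ?_
    · refine (continuous_arcIntegrand γ x ξ).measurable.mul (Measurable.ite ?_ ?_ ?_)
      · exact measurableSet_lt measurable_const Real.measurable_cos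
      · exact measurable_const
      · exact measurable_const
    · refine Eventually.of_forall fun φ => ?_
      by_cases h : γ < Real.cos φ <;> simp [h]
  have hcomb : ∀ u v : ℂ, ∫ φ in (-Real.pi)..Real.pi, (u * arcIntegrand γ x ξ φ +
      v * (arcIntegrand γ x ξ φ * (if γ < Real.cos φ then 1 else 0))) =
      u * ((∫ φ in (-Real.pi)..(-Real.arccos γ), arcIntegrand γ x ξ φ) +
        (∫ φ in (Real.arccos γ)..Real.pi, arcIntegrand γ x ξ φ)) +
      (u + v) * ∫ φ in (-Real.arccos γ)..Real.arccos γ, arcIntegrand γ x ξ φ := by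
    intro u v
    rw [intervalIntegral.integral_add ((hint _ _).const_mul u) (hint2.const_mul v),
      intervalIntegral.integral_const_mul, intervalIntegral.integral_const_mul,
      integral_arc_indicator hγ,
      ← intervalIntegral.integral_add_adjacent_intervals (hint (-Real.pi) (-Real.arccos γ))
        (hint _ Real.pi),
      ← intervalIntegral.integral_add_adjacent_intervals (hint (-Real.arccos γ) (Real.arccos γ))
        (hint _ Real.pi)]
    ring
  -- on the circle, the difference of indicators is constant on each of the two arcs
  have hcongr : ∀ u v : ℂ, (∀ φ : ℝ, Real.cos φ ≠ γ →
      ((if β * (Real.cos φ - γ) < 0 then 1 else 0) - (if s = 1 then 1 else 0) : ℂ) =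
        u + v * (if γ < Real.cos φ then 1 else 0)) →
      ∫ φ in (-Real.pi)..Real.pi, arcIntegrand γ x ξ φ *
        ((if β * (Real.cos φ - γ) < 0 then 1 else 0) - (if s = 1 then 1 else 0)) =
      u * ((∫ φ in (-Real.pi)..(-Real.arccos γ), arcIntegrand γ x ξ φ) +
        (∫ φ in (Real.arccos γ)..Real.pi, arcIntegrand γ x ξ φ)) +
      (u + v) * ∫ φ in (-Real.arccos γ)..Real.arccos γ, arcIntegrand γ x ξ φ := by
    intro u v huv
    rw [← hcomb]
    apply intervalIntegral.integral_congr_ae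
    filter_upwards [ae_cos_ne γ] with φ hφ hφ'
    rw [Set.uIoc_of_le (by linarith [Real.pi_pos])] at hφ'
    rw [huv φ (hφ hφ')]
    ring
  rcases lt_or_gt_of_ne hβ with hβ | hβ
  · have hB : ∀ φ : ℝ, (β * (Real.cos φ - γ) < 0 ↔ γ < Real.cos φ) := fun φ =>
      ⟨fun h => by nlinarith, fun h => by nlinarith⟩
    have e : |β| / β = -1 := by rw [abs_of_neg hβ, neg_div, div_self hβ.ne]
    rw [e]
    rcases hs with rfl | rfl
    · rw [hcongr (-1) 1 fun φ _ => by simp only [hB]; simp; ring,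
        ← (beadKernel_eq_arc_left hγ hxξ (h.imp_right fun h => by nlinarith)).2]
      push_cast
      ring
    · rw [hcongr 0 1 fun φ _ => by simp only [hB]; norm_num,
        ← (beadKernel_eq_arc_right hγ hxξ (h.imp_right fun h => by nlinarith)).2]
      push_cast
      ring
  · have hB : ∀ φ : ℝ, Real.cos φ ≠ γ → (β * (Real.cos φ - γ) < 0 ↔ ¬ γ < Real.cos φ) :=
      fun φ hφ => ⟨fun h => by nlinarith,
        fun h => by
          have := lt_of_le_of_ne (not_lt.1 h) hφ
          nlinarith⟩
    have e : |β| / β = 1 := by rw [abs_of_pos hβ, div_self hβ.ne']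
    rw [e]
    rcases hs with rfl | rfl
    · rw [hcongr 0 (-1) fun φ hφ => by simp only [hB φ hφ]; split_ifs <;> simp,
        ← (beadKernel_eq_arc_right hγ hxξ (h.imp_right fun h => by nlinarith)).2]
      push_cast
      ring
    · rw [hcongr 1 (-1) fun φ hφ => by
          simp only [hB φ hφ]; by_cases h' : γ < Real.cos φ <;> norm_num [h'],
        ← (beadKernel_eq_arc_left hγ hxξ (h.imp_right fun h => by nlinarith)).2]
      push_cast
      ring

/-- Before the limit `t → 0`, the contribution to the inverse Kasteleyn operator of the residue at
the root `exp l`, for the second angle `φ`, if the circle of radius `exp b` is moved outwards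
(`s = 1`) or inwards (`s = -1`); the last factor is `0` if the root is not crossed. -/
def residueTerm (b : ℝ) (s : ℝ) (x y : ℤ) (l m : ℂ) (φ : ℝ) : ℂ :=
  Complex.exp (Complex.I * φ) ^ (x + 1) / (2 * Real.pi) *
    (Complex.exp (-y * (l - b)) * m) * ((if l.re < b then 1 else 0) - (if s = 1 then 1 else 0))

/-- If `y` has the sign `s`, the exponential is at most `1` whenever the last factor is not `0`. -/
lemma norm_residueTerm_le {b s : ℝ} (hs : s = 1 ∨ s = -1) {x y : ℤ} (hy : 0 ≤ s * y) (l m : ℂ)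
    (φ : ℝ) : ‖residueTerm b s x y l m φ‖ ≤ ‖m‖ := by
  have h0 : ‖Complex.exp (Complex.I * φ) ^ (x + 1) / (2 * Real.pi)‖ ≤ 1 := by
    rw [norm_div, norm_zpow, norm_exp_I_mul, one_zpow]
    have h1 : ‖(2 * Real.pi : ℂ)‖ = 2 * Real.pi := by
      simp [abs_of_pos Real.pi_pos]
    rw [h1, div_le_one (by positivity)]
    linarith [Real.pi_gt_three]
  have hexp : ‖Complex.exp (-y * (l - b))‖ = Real.exp (-y * (l.re - b)) := by
    rw [Complex.norm_exp]; simp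
  have key : ‖Complex.exp (-y * (l - b))‖ *
      ‖((if l.re < b then 1 else 0) - (if s = 1 then 1 else 0) : ℂ)‖ ≤ 1 := by
    rw [hexp]
    rcases hs with rfl | rfl
    · by_cases hl : l.re < b
      · simp [hl]
      · have : (-y : ℝ) * (l.re - b) ≤ 0 := by
          have : (0 : ℝ) ≤ y := by linarith
          nlinarith [not_lt.1 hl]
        simpa [hl] using this
    · by_cases hl : l.re < b
      · have : (-y : ℝ) * (l.re - b) ≤ 0 := by
          have : (y : ℝ) ≤ 0 := by linarith
          nlinarith
        have h1 : (-1 : ℝ) ≠ 1 := by norm_num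
        simpa [hl, h1] using this
      · have h1 : (-1 : ℝ) ≠ 1 := by norm_num
        simp [hl, h1]
  unfold residueTerm
  rw [norm_mul, norm_mul, norm_mul]
  calc _ ≤ 1 * (‖Complex.exp (-y * (l - b))‖ * ‖m‖) * _ := by gcongr
    _ = (‖Complex.exp (-y * (l - b))‖ *
      ‖((if l.re < b then 1 else 0) - (if s = 1 then 1 else 0) : ℂ)‖) * ‖m‖ := by ring
    _ ≤ 1 * ‖m‖ := by gcongr
    _ = ‖m‖ := one_mul _

namespace SimpleTentacle

variable {p q : ℂ × ℂ → ℂ} {a : ℂ} {β : ℝ}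

lemma tendsto_slope_root {L : ℂ → ℂ} (hL0 : L 0 = 0) (hLd : HasDerivAt L β 0) (w : ℂ) :
    Tendsto (fun t : ℝ => L (t * w) / t) (𝓝[>] 0) (𝓝 (β * w)) := by
  have h1 : HasDerivAt (fun z : ℂ => L (z * w)) (β * w) ((0 : ℝ) : ℂ) := by
    have h2 : HasDerivAt (fun z : ℂ => z * w) w ((0 : ℝ) : ℂ) := by
      simpa using (hasDerivAt_id ((0 : ℝ) : ℂ)).mul_const w
    have h3 : HasDerivAt L β ((fun z : ℂ => z * w) ((0 : ℝ) : ℂ)) := by simpa using hLd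
    exact HasDerivAt.comp (h := fun z : ℂ => z * w) _ h3 h2
  have h2 := h1.comp_ofReal.tendsto_slope_zero_right
  refine h2.congr fun t => ?_
  simp [hL0, div_eq_inv_mul]

/-- The pointwise limit of the residue term, away from the two angles with `cos φ = γ`. -/
lemma tendsto_residueTerm (hβ : β ≠ 0) {γ : ℝ} (hγ : γ ∈ Set.Ioo (-1 : ℝ) 1) {L m : ℂ → ℂ}
    (hL0 : L 0 = 0) (hLd : HasDerivAt L β 0) (hm : ContinuousAt m 0) {ξ s : ℝ} {x : ℤ}
    {φ : ℝ} (hφ : Real.cos φ ≠ γ) :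
    Tendsto (fun n : ℝ × ℤ => residueTerm (β * γ * n.1) s x n.2
        (L (n.1 * Complex.exp (Complex.I * φ))) (m (n.1 * Complex.exp (Complex.I * φ))) φ)
      (scalingLimit β γ ξ)
      (𝓝 (m 0 * (arcIntegrand γ x ξ φ *
        ((if β * (Real.cos φ - γ) < 0 then 1 else 0) - (if s = 1 then 1 else 0))))) := by
  have hκ := sqrt_one_sub_sq_pos hγ
  set w := Complex.exp (Complex.I * φ) with hw
  have ht : Tendsto (fun n : ℝ × ℤ => n.1) (scalingLimit β γ ξ) (𝓝[>] 0) :=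
    tendsto_comap.mono_left inf_le_left
  have hty : Tendsto (fun n : ℝ × ℤ => n.1 * β * n.2 * Real.sqrt (1 - γ ^ 2))
      (scalingLimit β γ ξ) (𝓝 ξ) := tendsto_comap.mono_left inf_le_right
  have htpos : ∀ᶠ n : ℝ × ℤ in scalingLimit β γ ξ, 0 < n.1 := ht.eventually self_mem_nhdsWithin
  have hslope := (tendsto_slope_root hL0 hLd w).comp ht
  have hmlim : Tendsto (fun n : ℝ × ℤ => m (n.1 * w)) (scalingLimit β γ ξ) (𝓝 (m 0)) := by
    refine hm.tendsto.comp ?_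
    have : Tendsto (fun t : ℝ => (t : ℂ) * w) (𝓝 0) (𝓝 0) := by
      have : ContinuousAt (fun t : ℝ => (t : ℂ) * w) 0 := by fun_prop
      simpa [ContinuousAt] using this
    exact this.comp (ht.mono_right nhdsWithin_le_nhds)
  have hexp : Tendsto (fun n : ℝ × ℤ =>
      Complex.exp (-n.2 * (L (n.1 * w) - (β * γ * n.1 : ℝ)))) (scalingLimit β γ ξ)
      (𝓝 (Complex.exp (-(ξ / Real.sqrt (1 - γ ^ 2) : ℝ) * (w - γ)))) := by
    have h1 : Tendsto (fun n : ℝ × ℤ =>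
        -((n.1 * β * n.2 * Real.sqrt (1 - γ ^ 2) : ℝ) : ℂ) / (β * Real.sqrt (1 - γ ^ 2)) *
          (L (n.1 * w) / n.1 - β * γ)) (scalingLimit β γ ξ)
        (𝓝 (-(ξ : ℂ) / (β * Real.sqrt (1 - γ ^ 2)) * (β * w - β * γ))) :=
      (((Complex.continuous_ofReal.tendsto ξ).comp hty).neg.div_const _).mul
        (hslope.sub_const _)
    have hβ' : (β : ℂ) ≠ 0 := by exact_mod_cast hβ
    have hκ' : (Real.sqrt (1 - γ ^ 2) : ℂ) ≠ 0 := by exact_mod_cast hκ.ne'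
    have h2 := (Complex.continuous_exp.tendsto _).comp h1
    have e1 : -(ξ : ℂ) / (β * Real.sqrt (1 - γ ^ 2)) * (β * w - β * γ) =
        -(ξ / Real.sqrt (1 - γ ^ 2) : ℝ) * (w - γ) := by
      push_cast; field_simp
    rw [e1] at h2
    refine h2.congr' ?_
    filter_upwards [htpos] with n hn
    have hn' : (n.1 : ℂ) ≠ 0 := by exact_mod_cast hn.ne'
    simp only [Function.comp_apply]
    congr 1
    push_cast
    field_simp
  have hchi : Tendsto (fun n : ℝ × ℤ =>
      (if (L (n.1 * w)).re < β * γ * n.1 then (1 : ℂ) else 0)) (scalingLimit β γ ξ)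
      (𝓝 (if β * (Real.cos φ - γ) < 0 then 1 else 0)) := by
    have h1 : Tendsto (fun n : ℝ × ℤ => (L (n.1 * w) / n.1).re - β * γ) (scalingLimit β γ ξ)
        (𝓝 (β * (Real.cos φ - γ))) := by
      have h2 := ((Complex.continuous_re.tendsto _).comp hslope).sub_const (β * γ)
      have h3 : ((β : ℂ) * w).re - β * γ = β * (Real.cos φ - γ) := by
        rw [Complex.re_ofReal_mul, hw, exp_I_mul_re]; ring
      rw [h3] at h2
      exact h2
    have hsign : ∀ᶠ n : ℝ × ℤ in scalingLimit β γ ξ,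
        ((L (n.1 * w)).re < β * γ * n.1 ↔ (L (n.1 * w) / n.1).re - β * γ < 0) := by
      filter_upwards [htpos] with n hn
      rw [Complex.div_ofReal_re, sub_neg, div_lt_iff₀ hn]
    have hne : β * (Real.cos φ - γ) ≠ 0 := mul_ne_zero hβ (sub_ne_zero.2 hφ)
    refine tendsto_const_nhds.congr' ?_
    rcases lt_or_gt_of_ne hne with h | h
    · filter_upwards [hsign, h1.eventually_lt_const h] with n hn hn'
      rw [if_pos h, if_pos (hn.2 hn')]
    · filter_upwards [hsign, h1.eventually_const_lt h] with n hn hn'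
      rw [if_neg h.not_gt, if_neg fun h' => hn'.not_gt (hn.1 h')]
  have := ((hexp.mul hmlim).const_mul (w ^ (x + 1) / (2 * Real.pi))).mul
    (hchi.sub_const (if s = 1 then 1 else 0))
  unfold residueTerm
  convert this using 2
  unfold arcIntegrand
  rw [← hw]
  ring

end SimpleTentacle

/-! ### The integral over the shifted circle -/

lemma norm_integral_circle_le {f : ℝ → ℂ} {C : ℝ} (h : ∀ φ, ‖f φ‖ ≤ C) :
    ‖∫ φ in (-Real.pi)..Real.pi, f φ‖ ≤ C * (2 * Real.pi) := by
  have := intervalIntegral.norm_integral_le_of_norm_le_const (a := -Real.pi) (b := Real.pi)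
    (f := f) (C := C) fun φ _ => h φ
  rwa [show |Real.pi - -Real.pi| = 2 * Real.pi by
    rw [sub_neg_eq_add, ← two_mul]; exact abs_of_pos Real.two_pi_pos] at this

lemma integral_exp_zpow {n : ℤ} (hn : n ≠ 0) :
    ∫ φ in (-Real.pi)..Real.pi, Complex.exp (Complex.I * φ) ^ n = 0 := by
  have h := integral_exp_mul_complex (a := -Real.pi) (b := Real.pi) (c := n * Complex.I)
    (mul_ne_zero (by exact_mod_cast hn) Complex.I_ne_zero)
  have h1 : ∀ φ : ℝ, Complex.exp (Complex.I * φ) ^ n = Complex.exp (n * Complex.I * φ) := by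
    intro φ
    rw [← Complex.exp_int_mul]
    ring_nf
  simp only [h1, h]
  have h2 : Complex.exp (n * Complex.I * (Real.pi : ℝ)) =
      Complex.exp (n * Complex.I * (-Real.pi : ℝ)) := by
    rw [Complex.exp_eq_exp_iff_exists_int]
    exact ⟨n, by push_cast; ring⟩
  rw [h2, sub_self, zero_div]

namespace SimpleTentacle

variable {p q : ℂ × ℂ → ℂ} {a : ℂ} {β : ℝ}

/-- On a circle `‖z‖ = r` without zeros of `p (·, 0)`, `q / p` is close to its value at `w = 0`. -/
lemma eventually_norm_div_sub_lt (hp : SimpleTentacle p a β)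
    (hq : ∀ x : ℂ × ℂ, x.1 ≠ 0 → ContDiffAt ℂ 1 q x) {r : ℝ} (hr : 0 < r)
    (hne : ∀ z : ℂ, ‖z‖ = r → p (z, 0) ≠ 0) {ε : ℝ} (hε : 0 < ε) :
    ∀ᶠ ω in 𝓝 (0 : ℂ), ∀ z ∈ Metric.sphere (0 : ℂ) r, p (z, ω) ≠ 0 ∧
      ‖q (z, ω) / p (z, ω) - q (z, 0) / p (z, 0)‖ < ε := by
  refine (isCompact_sphere (0 : ℂ) r).eventually_forall_of_forall_eventually
    (P := fun ω z => p (z, ω) ≠ 0 ∧ ‖q (z, ω) / p (z, ω) - q (z, 0) / p (z, 0)‖ < ε) fun z hz => ?_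
  have hzn : ‖z‖ = r := by simpa using hz
  have hz0 : z ≠ 0 := norm_pos_iff.1 (hzn ▸ hr)
  have hcomp : ∀ (f : ℂ × ℂ → ℂ) (g : ℂ × ℂ → ℂ × ℂ), Continuous g → g (0, z) = (z, 0) →
      ContinuousAt f (z, 0) → ContinuousAt (fun x => f (g x)) (0, z) := by
    intro f g hg hgz hf
    exact ContinuousAt.comp (by rw [hgz]; exact hf) hg.continuousAt
  have hpc := hp.continuousAt (x := (z, 0)) hz0
  have hqc := (hq (z, 0) hz0).continuousAt
  have h1 := hcomp p (fun x => (x.2, x.1)) (by fun_prop) rfl hpc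
  have h2 := hcomp q (fun x => (x.2, x.1)) (by fun_prop) rfl hqc
  have h3 := hcomp p (fun x => (x.2, 0)) (by fun_prop) rfl hpc
  have h4 := hcomp q (fun x => (x.2, 0)) (by fun_prop) rfl hqc
  have h5 : ContinuousAt (fun x : ℂ × ℂ =>
      ‖q (x.2, x.1) / p (x.2, x.1) - q (x.2, 0) / p (x.2, 0)‖) (0, z) :=
    ((h2.div h1 (hne z hzn)).sub (h4.div h3 (hne z hzn))).norm
  have h6 := h5.eventually_lt (continuousAt_const (y := ε)) (by simpa using hε)
  filter_upwards [h1.eventually_ne (hne z hzn), h6] with x hx1 hx2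
  exact ⟨hx1, hx2⟩

/-- The integrand in the second angle of the integral over the torus of radii `exp (s δ)`, `t`. -/
def farIntegrand (p q : ℂ × ℂ → ℂ) (s δ b t : ℝ) (x y : ℤ) (φ : ℝ) : ℂ :=
  Complex.exp (Complex.I * φ) ^ (x + 1) * ∫ θ in (-Real.pi)..Real.pi,
    Complex.exp (Complex.I * θ) ^ (-y) * (Complex.exp (-y * (s * δ - b)) *
      (q (Real.exp (s * δ) * Complex.exp (Complex.I * θ), t * Complex.exp (Complex.I * φ)) /
        p (Real.exp (s * δ) * Complex.exp (Complex.I * θ), t * Complex.exp (Complex.I * φ))))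

lemma mem_sphere_exp (u θ : ℝ) :
    (Real.exp u * Complex.exp (Complex.I * θ) : ℂ) ∈ Metric.sphere (0 : ℂ) (Real.exp u) := by
  rw [mem_sphere_zero_iff_norm, norm_mul, norm_exp_I_mul, mul_one, Complex.norm_real,
    Real.norm_eq_abs, abs_of_pos (Real.exp_pos _)]

lemma continuous_farKernel (hp : SimpleTentacle p a β)
    (hq : ∀ x : ℂ × ℂ, x.1 ≠ 0 → ContDiffAt ℂ 1 q x) {s δ b t : ℝ} {y : ℤ}
    (hne : ∀ φ : ℝ, ∀ z ∈ Metric.sphere (0 : ℂ) (Real.exp (s * δ)),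
      p (z, t * Complex.exp (Complex.I * φ)) ≠ 0) :
    Continuous fun v : ℝ × ℝ => Complex.exp (Complex.I * v.2) ^ (-y) *
      (Complex.exp (-y * (s * δ - b)) *
        (q (Real.exp (s * δ) * Complex.exp (Complex.I * v.2), t * Complex.exp (Complex.I * v.1)) /
          p (Real.exp (s * δ) * Complex.exp (Complex.I * v.2),
            t * Complex.exp (Complex.I * v.1)))) := by
  have hg : Continuous fun v : ℝ × ℝ =>
      ((Real.exp (s * δ) * Complex.exp (Complex.I * v.2) : ℂ),
        (t * Complex.exp (Complex.I * v.1) : ℂ)) := by fun_prop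
  have hz : ∀ v : ℝ, (Real.exp (s * δ) * Complex.exp (Complex.I * v) : ℂ) ≠ 0 := fun v =>
    mul_ne_zero (by exact_mod_cast Real.exp_ne_zero _) (Complex.exp_ne_zero _)
  have hcomp : ∀ f : ℂ × ℂ → ℂ, (∀ x : ℂ × ℂ, x.1 ≠ 0 → ContinuousAt f x) →
      Continuous fun v : ℝ × ℝ => f ((Real.exp (s * δ) * Complex.exp (Complex.I * v.2) : ℂ),
        (t * Complex.exp (Complex.I * v.1) : ℂ)) := by
    intro f hf
    refine continuous_iff_continuousAt.2 fun v => ?_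
    exact ContinuousAt.comp (hf _ (hz v.2)) hg.continuousAt
  have h1 := hcomp p fun x hx => hp.continuousAt hx
  have h2 := hcomp q fun x hx => (hq x hx).continuousAt
  have h3 : Continuous fun v : ℝ × ℝ => Complex.exp (Complex.I * v.2) ^ (-y) :=
    (continuous_exp_zpow (-y)).comp continuous_snd
  exact h3.mul (continuous_const.mul (h2.div h1 fun v => hne v.1 _ (mem_sphere_exp _ _)))

lemma continuous_farIntegrand (hp : SimpleTentacle p a β)
    (hq : ∀ x : ℂ × ℂ, x.1 ≠ 0 → ContDiffAt ℂ 1 q x) {s δ b t : ℝ} {x y : ℤ}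
    (hne : ∀ φ : ℝ, ∀ z ∈ Metric.sphere (0 : ℂ) (Real.exp (s * δ)),
      p (z, t * Complex.exp (Complex.I * φ)) ≠ 0) :
    Continuous (farIntegrand p q s δ b t x y) :=
  (continuous_exp_zpow _).mul
    (intervalIntegral.continuous_parametric_intervalIntegral_of_continuous'
      (f := fun _ _ => _) (hp.continuous_farKernel hq hne) _ _)

lemma norm_farIntegrand_le {s δ b t M : ℝ} {x y : ℤ} {φ : ℝ} (hM : ∀ z ∈ Metric.sphere (0 : ℂ)
      (Real.exp (s * δ)), ‖q (z, t * Complex.exp (Complex.I * φ)) /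
        p (z, t * Complex.exp (Complex.I * φ))‖ ≤ M) :
    ‖farIntegrand p q s δ b t x y φ‖ ≤ Real.exp (-y * (s * δ - b)) * M * (2 * Real.pi) := by
  unfold farIntegrand
  rw [norm_mul, norm_zpow, norm_exp_I_mul, one_zpow, one_mul]
  refine norm_integral_circle_le fun θ => ?_
  rw [norm_mul, norm_zpow, norm_exp_I_mul, one_zpow, one_mul, norm_mul, Complex.norm_exp]
  have h : (-(y : ℂ) * (s * δ - b)).re = -y * (s * δ - b) := by
    have : (-(y : ℂ) * (s * δ - b)) = ((-y * (s * δ - b) : ℝ) : ℂ) := by push_cast; ring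
    rw [this, Complex.ofReal_re]
  rw [h]
  gcongr
  exact hM _ (mem_sphere_exp _ _)

/-- The integral over the far torus vanishes in the scaling limit: for `x ≠ -1` because `q / p`
becomes independent of `w` and `∮ w ^ x dw = 0`, for `x = -1` because of the exponential decay
in `y`. -/
lemma tendsto_integral_farIntegrand (hp : SimpleTentacle p a β)
    (hq : ∀ x : ℂ × ℂ, x.1 ≠ 0 → ContDiffAt ℂ 1 q x) {γ : ℝ} (hγ : γ ∈ Set.Ioo (-1 : ℝ) 1)
    {s δ : ℝ} (hs : s = 1 ∨ s = -1) (hδ : 0 < δ)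
    (hne : ∀ z : ℂ, ‖z‖ = Real.exp (s * δ) → p (z, 0) ≠ 0) {x : ℤ} {ξ : ℝ}
    (hxξ : x ≠ -1 ∨ ξ ≠ 0) :
    Tendsto (fun n : ℝ × ℤ => ∫ φ in (-Real.pi)..Real.pi,
        farIntegrand p q s δ (β * γ * n.1) n.1 x n.2 φ)
      (scalingLimit β γ ξ ⊓ 𝓟 {n | 0 ≤ s * (n.2 : ℝ)}) (𝓝 0) := by
  have ht : Tendsto (fun n : ℝ × ℤ => n.1) (scalingLimit β γ ξ ⊓ 𝓟 {n | 0 ≤ s * (n.2 : ℝ)})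
      (𝓝[>] 0) := (tendsto_comap.mono_left inf_le_left).mono_left inf_le_left
  have hy : ∀ᶠ n : ℝ × ℤ in scalingLimit β γ ξ ⊓ 𝓟 {n | 0 ≤ s * (n.2 : ℝ)},
      0 ≤ s * (n.2 : ℝ) := mem_inf_of_right (mem_principal_self _)
  have hsmall : ∀ᶠ n : ℝ × ℤ in scalingLimit β γ ξ ⊓ 𝓟 {n | 0 ≤ s * (n.2 : ℝ)},
      |β * γ * n.1| < δ / 2 := by
    have : ContinuousAt (fun t : ℝ => |β * γ * t|) 0 := by fun_prop
    exact ht.eventually (nhdsWithin_le_nhds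
      (this.eventually_lt continuousAt_const (by simpa using hδ)))
  have hexp : ∀ᶠ n : ℝ × ℤ in scalingLimit β γ ξ ⊓ 𝓟 {n | 0 ≤ s * (n.2 : ℝ)},
      Real.exp (-n.2 * (s * δ - β * γ * n.1)) ≤ Real.exp (-(δ / 2 * |(n.2 : ℝ)|)) := by
    filter_upwards [hy, hsmall] with n h1 h2
    apply Real.exp_le_exp.2
    obtain ⟨h3, h4⟩ := abs_lt.1 h2
    rcases hs with rfl | rfl
    · have : (0 : ℝ) ≤ n.2 := by linarith
      rw [abs_of_nonneg this]
      nlinarith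
    · have : (n.2 : ℝ) ≤ 0 := by linarith
      rw [abs_of_nonpos this]
      nlinarith
  have hunif : ∀ ε > 0, ∀ᶠ n : ℝ × ℤ in scalingLimit β γ ξ ⊓ 𝓟 {n | 0 ≤ s * (n.2 : ℝ)},
      ∀ φ : ℝ, ∀ z ∈ Metric.sphere (0 : ℂ) (Real.exp (s * δ)),
        p (z, n.1 * Complex.exp (Complex.I * φ)) ≠ 0 ∧
        ‖q (z, n.1 * Complex.exp (Complex.I * φ)) / p (z, n.1 * Complex.exp (Complex.I * φ)) -
          q (z, 0) / p (z, 0)‖ < ε := fun ε hε =>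
    ht.eventually (eventually_forall_circle
      (hp.eventually_norm_div_sub_lt hq (Real.exp_pos _) hne hε))
  by_cases hx : x = -1
  · have hξ : ξ ≠ 0 := hxξ.resolve_left (not_not.2 hx)
    obtain ⟨M, hM⟩ : ∃ M, ∀ z ∈ Metric.sphere (0 : ℂ) (Real.exp (s * δ)),
        ‖q (z, 0) / p (z, 0)‖ ≤ M := by
      refine (isCompact_sphere (0 : ℂ) (Real.exp (s * δ))).exists_bound_of_continuousOn
        fun z hz => ?_
      have hzn : ‖z‖ = Real.exp (s * δ) := by simpa using hz
      have hz0 : z ≠ 0 := norm_pos_iff.1 (hzn ▸ Real.exp_pos _)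
      have hc : ContinuousAt (fun z : ℂ => (z, (0 : ℂ))) z := by fun_prop
      have h1 := ContinuousAt.comp (g := p) (f := fun z : ℂ => (z, (0 : ℂ)))
        (hp.continuousAt (x := (z, 0)) hz0) hc
      have h2 := ContinuousAt.comp (g := q) (f := fun z : ℂ => (z, (0 : ℂ)))
        (hq (z, 0) hz0).continuousAt hc
      exact (h2.div h1 (hne z hzn)).continuousWithinAt
    -- since `t β y` has a limit other than `0`, `|y|` is of order `1 / t`
    have hyinf : Tendsto (fun n : ℝ × ℤ => |(n.2 : ℝ)|)
        (scalingLimit β γ ξ ⊓ 𝓟 {n | 0 ≤ s * (n.2 : ℝ)}) atTop := by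
      have hκ := sqrt_one_sub_sq_pos hγ
      have h1 : Tendsto (fun n : ℝ × ℤ => |n.1 * β * n.2 * Real.sqrt (1 - γ ^ 2)| /
          (|β| * Real.sqrt (1 - γ ^ 2)))
          (scalingLimit β γ ξ ⊓ 𝓟 {n | 0 ≤ s * (n.2 : ℝ)})
          (𝓝 (|ξ| / (|β| * Real.sqrt (1 - γ ^ 2)))) :=
        (((tendsto_comap.mono_left inf_le_right).mono_left inf_le_left).abs).div_const _
      have hβ := abs_pos.2 hp.beta_ne_zero
      have h2 := (tendsto_inv_nhdsGT_zero.comp ht).atTop_mul_pos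
        (show 0 < |ξ| / (|β| * Real.sqrt (1 - γ ^ 2)) by positivity) h1
      refine h2.congr' ?_
      filter_upwards [ht.eventually self_mem_nhdsWithin] with n hn
      have hn' : 0 < n.1 := hn
      simp only [Function.comp_apply, abs_mul, abs_of_pos hn', abs_of_pos hκ]
      field_simp
    have hlim : Tendsto (fun n : ℝ × ℤ => Real.exp (-(δ / 2 * |(n.2 : ℝ)|)) * (M + 1) *
        (2 * Real.pi) * (2 * Real.pi)) (scalingLimit β γ ξ ⊓ 𝓟 {n | 0 ≤ s * (n.2 : ℝ)})
        (𝓝 0) := by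
      have h1 := (Real.tendsto_exp_neg_atTop_nhds_zero.comp
        (hyinf.const_mul_atTop (show 0 < δ / 2 by positivity)))
      have h2 := ((h1.mul_const (M + 1)).mul_const (2 * Real.pi)).mul_const (2 * Real.pi)
      simpa using h2
    refine squeeze_zero_norm' ?_ hlim
    filter_upwards [hexp, hunif 1 one_pos] with n h1 h2
    refine norm_integral_circle_le fun φ => ?_
    have h3 : ∀ z ∈ Metric.sphere (0 : ℂ) (Real.exp (s * δ)),
        ‖q (z, n.1 * Complex.exp (Complex.I * φ)) / p (z, n.1 * Complex.exp (Complex.I * φ))‖ ≤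
          M + 1 := by
      intro z hz
      have h4 := (h2 φ z hz).2.le
      have h5 := hM z hz
      have h6 := norm_sub_norm_le (q (z, n.1 * Complex.exp (Complex.I * φ)) /
        p (z, n.1 * Complex.exp (Complex.I * φ))) (q (z, 0) / p (z, 0))
      linarith
    have hM0 : 0 ≤ M + 1 := (norm_nonneg _).trans (h3 _ (mem_sphere_exp _ 0))
    refine (norm_farIntegrand_le h3).trans ?_
    gcongr
  · rw [Metric.tendsto_nhds]
    intro ε hε
    filter_upwards [hexp, hunif (ε / (2 * (2 * Real.pi) ^ 2)) (by positivity)] with n h1 h2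
    have hne0 : ∀ φ : ℝ, ∀ z ∈ Metric.sphere (0 : ℂ) (Real.exp (s * δ)),
        p (z, (0 : ℝ) * Complex.exp (Complex.I * φ)) ≠ 0 := by
      intro φ z hz
      rw [Complex.ofReal_zero, zero_mul]
      exact hne z (by simpa using hz)
    -- at `w = 0` the inner integral does not depend on `φ`, and `∫ exp (iφ) ^ (x + 1) dφ = 0`
    have hzero : ∫ φ in (-Real.pi)..Real.pi,
        farIntegrand p q s δ (β * γ * n.1) 0 x n.2 φ = 0 := by
      simp only [farIntegrand, Complex.ofReal_zero, zero_mul]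
      rw [intervalIntegral.integral_mul_const, integral_exp_zpow (by omega), zero_mul]
    rw [dist_zero_right, ← sub_zero (∫ φ in (-Real.pi)..Real.pi,
      farIntegrand p q s δ (β * γ * n.1) n.1 x n.2 φ), ← hzero,
      ← intervalIntegral.integral_sub
        ((hp.continuous_farIntegrand hq fun φ z hz => (h2 φ z hz).1).intervalIntegrable _ _)
        ((hp.continuous_farIntegrand hq hne0).intervalIntegrable _ _)]
    have hdiff : ∀ φ : ℝ, ‖farIntegrand p q s δ (β * γ * n.1) n.1 x n.2 φ -
        farIntegrand p q s δ (β * γ * n.1) 0 x n.2 φ‖ ≤ 1 * (ε / (2 * (2 * Real.pi) ^ 2)) *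
          (2 * Real.pi) := by
      intro φ
      have hc1 := (hp.continuous_farKernel hq (b := β * γ * n.1) (y := n.2)
        fun φ z hz => (h2 φ z hz).1).comp
        (show Continuous fun θ : ℝ => (φ, θ) by fun_prop)
      have hc2 := (hp.continuous_farKernel hq (b := β * γ * n.1) (y := n.2) hne0).comp
        (show Continuous fun θ : ℝ => (φ, θ) by fun_prop)
      have hE : Real.exp (-n.2 * (s * δ - β * γ * n.1)) ≤ 1 := by
        refine h1.trans (Real.exp_le_one_iff.2 ?_)
        have := abs_nonneg (n.2 : ℝ)
        nlinarith
      simp only [Function.comp_def] at hc1 hc2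
      have h3 : farIntegrand p q s δ (β * γ * n.1) n.1 x n.2 φ -
          farIntegrand p q s δ (β * γ * n.1) 0 x n.2 φ =
          farIntegrand (fun _ => 1) (fun v => q v / p v - q (v.1, 0) / p (v.1, 0)) s δ
            (β * γ * n.1) n.1 x n.2 φ := by
        unfold farIntegrand
        rw [← mul_sub, ← intervalIntegral.integral_sub (hc1.intervalIntegrable _ _)
          (hc2.intervalIntegrable _ _)]
        congr 2
        ext θ
        simp only [Complex.ofReal_zero, zero_mul, div_one]
        ring
      rw [h3]
      refine (norm_farIntegrand_le (M := ε / (2 * (2 * Real.pi) ^ 2)) fun z hz => ?_).trans ?_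
      · rw [div_one]
        exact (h2 φ z hz).2.le
      · gcongr
    refine (norm_integral_circle_le hdiff).trans_lt ?_
    have hpi := Real.pi_pos
    have : 1 * (ε / (2 * (2 * Real.pi) ^ 2)) * (2 * Real.pi) * (2 * Real.pi) = ε / 2 := by
      field_simp
    rw [this]
    linarith

end SimpleTentacle

/-! ### The scaling limit of the torus integral -/

instance (β γ ξ : ℝ) : (scalingLimit β γ ξ).IsCountablyGenerated := by
  unfold scalingLimit
  infer_instance

namespace SimpleTentacle

variable {p q : ℂ × ℂ → ℂ} {a : ℂ} {β : ℝ}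

/-- The integrand `z ^ (-y) w ^ k q / p` on the torus of radii `exp b` and `t`. -/
def torusIntegrand (p q : ℂ × ℂ → ℂ) (b t : ℝ) (k y : ℤ) (θ : ℝ × ℝ) : ℂ :=
  Complex.exp (Complex.I * θ.1) ^ (-y) * Complex.exp (Complex.I * θ.2) ^ k *
    (q (torusMap (Real.exp b) t θ) / p (torusMap (Real.exp b) t θ))

lemma eventually_integrableOn_torusIntegrand (hp : SimpleTentacle p a β)
    (hq : ∀ x : ℂ × ℂ, x.1 ≠ 0 → ContDiffAt ℂ 1 q x) {γ : ℝ} (hγ : γ ∈ Set.Ioo (-1 : ℝ) 1) :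
    ∀ᶠ t : ℝ in 𝓝[>] 0,
      (∀ k y : ℤ, IntegrableOn (torusIntegrand p q (β * γ * t) t k y)
        PeriodicBipartiteGraph.torus) ∧
      ∀ᵐ φ : ℝ, φ ∈ Set.Ioc (-Real.pi) Real.pi → ∀ θ ∈ Set.Ioc (-Real.pi) Real.pi,
        p (torusMap (Real.exp (β * γ * t)) t (θ, φ)) ≠ 0 := by
  set K := Set.Icc (-Real.pi) Real.pi ×ˢ Set.Icc (-Real.pi) Real.pi with hKdef
  have hK : IsCompact K := isCompact_Icc.prod isCompact_Icc
  filter_upwards [hp.eventually_integrableOn_inv hγ hK] with t ht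
  constructor
  · intro k y
    refine IntegrableOn.mono_set (t := K) ?_
      (Set.prod_mono Set.Ioc_subset_Icc_self Set.Ioc_subset_Icc_self)
    have hT : Continuous (torusMap (Real.exp (β * γ * t)) t) := by
      unfold torusMap
      fun_prop
    have hqT : Continuous fun θ => q (torusMap (Real.exp (β * γ * t)) t θ) :=
      continuous_iff_continuousAt.2 fun θ => ContinuousAt.comp
        (hq _ (by simp [torusMap])).continuousAt hT.continuousAt
    have hc : Continuous fun θ : ℝ × ℝ => Complex.exp (Complex.I * θ.1) ^ (-y) *
        Complex.exp (Complex.I * θ.2) ^ k * q (torusMap (Real.exp (β * γ * t)) t θ) :=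
      (((continuous_exp_zpow (-y)).comp continuous_fst).mul
        ((continuous_exp_zpow k).comp continuous_snd)).mul hqT
    refine (ht.1.continuousOn_mul hc.continuousOn hK).congr_fun (fun θ _ => ?_)
      hK.measurableSet
    simp only [torusIntegrand]
    ring
  · have hfin := (ht.2.image Prod.snd).measure_zero volume
    filter_upwards [compl_mem_ae_iff.2 hfin] with φ hφ hφ' θ hθ h0
    exact hφ ⟨(θ, φ), ⟨⟨Set.Ioc_subset_Icc_self hθ, Set.Ioc_subset_Icc_self hφ'⟩, h0⟩, rfl⟩

lemma setIntegral_torus {f : ℝ × ℝ → ℂ} (hf : IntegrableOn f PeriodicBipartiteGraph.torus) :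
    ∫ θ in PeriodicBipartiteGraph.torus, f θ =
      ∫ φ in (-Real.pi)..Real.pi, ∫ θ in (-Real.pi)..Real.pi, f (θ, φ) := by
  have hpi : -Real.pi ≤ Real.pi := by linarith [Real.pi_pos]
  simp only [intervalIntegral.integral_of_le hpi]
  unfold PeriodicBipartiteGraph.torus IntegrableOn at *
  rw [Measure.volume_eq_prod, ← Measure.prod_restrict] at *
  exact integral_prod_symm _ hf

/-- The scaling limit along those `(t, y)` for which `y` has the sign `s` (or is `0`), so that the
factor `z ^ (-y)` decays when the circle of `z` is moved in the direction given by `s`. -/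
lemma tendsto_torusIntegral_side (hp : SimpleTentacle p a β)
    (hq : ∀ x : ℂ × ℂ, x.1 ≠ 0 → ContDiffAt ℂ 1 q x) {γ : ℝ} (hγ : γ ∈ Set.Ioo (-1 : ℝ) 1)
    {s : ℝ} (hs : s = 1 ∨ s = -1) {x : ℤ} {ξ : ℝ} (hxξ : x ≠ -1 ∨ ξ ≠ 0)
    (h : 0 ≤ x ∨ 0 ≤ s * β * ξ) :
    Tendsto (fun n : ℝ × ℤ => 1 / (2 * (Real.pi : ℂ)) ^ 2 *
        ∫ θ in PeriodicBipartiteGraph.torus, torusIntegrand p q (β * γ * n.1) n.1 (x + 1) n.2 θ)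
      (scalingLimit β γ ξ ⊓ 𝓟 {n | 0 ≤ s * (n.2 : ℝ)})
      (𝓝 (q (1, 0) / a * (-(|β| / β : ℝ) * (Real.sqrt (1 - γ ^ 2) * beadKernel γ x ξ)))) := by
  obtain ⟨L, hL0, hLd, hLc, δ, hδ, hroot⟩ := hp.exists_log_root
  have ht : Tendsto (fun n : ℝ × ℤ => n.1) (scalingLimit β γ ξ ⊓ 𝓟 {n | 0 ≤ s * (n.2 : ℝ)})
      (𝓝[>] 0) := (tendsto_comap.mono_left inf_le_left).mono_left inf_le_left
  have hy : ∀ᶠ n : ℝ × ℤ in scalingLimit β γ ξ ⊓ 𝓟 {n | 0 ≤ s * (n.2 : ℝ)},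
      0 ≤ s * (n.2 : ℝ) := mem_inf_of_right (mem_principal_self _)
  -- `m ω` is the residue of `q / (z p)` at the root `exp (L ω)`
  set D : ℂ → ℂ := fun ω => fderiv ℂ p (Complex.exp (L ω), ω) (1, 0) with hD
  set m : ℂ → ℂ := fun ω => q (Complex.exp (L ω), ω) / (Complex.exp (L ω) * D ω) with hm
  have hDc : ∀ ω, ContinuousAt L ω → ContinuousAt D ω := fun ω hω =>
    ContinuousAt.comp (f := fun ω => (Complex.exp (L ω), ω)) (g := fun x => fderiv ℂ p x (1, 0))
      (hp.continuousAt_fderiv _ (Complex.exp_ne_zero _)) (hω.cexp.prodMk continuousAt_id)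
  have hD0 : D 0 = a := by simp [hD, hL0, hp.fderiv_eq]
  have hDne : ∀ᶠ ω in 𝓝 (0 : ℂ), D ω ≠ 0 :=
    (hDc 0 hLd.continuousAt).eventually_ne (by rw [hD0]; exact hp.a_ne_zero)
  have hmc : ∀ ω, ContinuousAt L ω → D ω ≠ 0 → ContinuousAt m ω := by
    intro ω hω hne
    refine ContinuousAt.div ?_ (hω.cexp.mul (hDc ω hω)) (mul_ne_zero (Complex.exp_ne_zero _) hne)
    exact ContinuousAt.comp (f := fun ω => (Complex.exp (L ω), ω)) (g := q)
      (hq _ (Complex.exp_ne_zero _)).continuousAt (hω.cexp.prodMk continuousAt_id)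
  have hm0 : m 0 = q (1, 0) / a := by simp [hm, hL0, hD0]
  have hmc0 := hmc 0 hLd.continuousAt hDne.self_of_nhds
  have hLre : ∀ᶠ ω in 𝓝 (0 : ℂ), |(L ω).re| < δ := by
    have h1 : ContinuousAt (fun ω => |(L ω).re|) 0 :=
      (Complex.continuous_re.continuousAt.comp hLd.continuousAt).abs
    apply h1.eventually_lt continuousAt_const
    rw [hL0]; simpa using hδ
  have hmb : ∀ᶠ ω in 𝓝 (0 : ℂ), ‖m ω‖ ≤ ‖m 0‖ + 1 := by
    have := hmc0.norm.eventually_lt (continuousAt_const (y := ‖m 0‖ + 1)) (by linarith)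
    exact this.mono fun _ h => h.le
  have hsmall : ∀ᶠ t : ℝ in 𝓝[>] 0, |β * γ * t| < δ := by
    have : ContinuousAt (fun t : ℝ => |β * γ * t|) 0 := by fun_prop
    exact nhdsWithin_le_nhds (this.eventually_lt continuousAt_const (by simpa using hδ))
  have hsδ : |s * δ| = δ := by rcases hs with rfl | rfl <;> simp [abs_of_pos hδ]
  have hfarne : ∀ ω : ℂ, (∀ z : ℂ, z ≠ 0 → |Real.log ‖z‖| ≤ δ →
      (p (z, ω) = 0 ↔ z = Complex.exp (L ω))) → |(L ω).re| < δ →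
      ∀ z ∈ Metric.sphere (0 : ℂ) (Real.exp (s * δ)), p (z, ω) ≠ 0 := by
    intro ω h1 h2 z hz h0
    have hzn : ‖z‖ = Real.exp (s * δ) := by simpa using hz
    have hz0 : z ≠ 0 := norm_pos_iff.1 (hzn ▸ Real.exp_pos _)
    have hlog : Real.log ‖z‖ = s * δ := by rw [hzn, Real.log_exp]
    have h3 := (h1 z hz0 (by rw [hlog, hsδ])).1 h0
    rw [h3, Complex.norm_exp, Real.log_exp] at hlog
    rw [hlog, hsδ] at h2
    exact lt_irrefl _ h2
  have hne0 : ∀ z : ℂ, ‖z‖ = Real.exp (s * δ) → p (z, 0) ≠ 0 := fun z hz =>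
    hfarne 0 hroot.self_of_nhds hLre.self_of_nhds z (by simpa using hz)
  have hfar := hp.tendsto_integral_farIntegrand hq hγ hs hδ hne0 hxξ
  have hmeas : ∀ᶠ t : ℝ in 𝓝[>] 0, ∀ y : ℤ, Measurable fun φ : ℝ =>
      residueTerm (β * γ * t) s x y (L (t * Complex.exp (Complex.I * φ)))
        (m (t * Complex.exp (Complex.I * φ))) φ := by
    filter_upwards [eventually_forall_circle hLc, eventually_forall_circle hDne] with t h1 h2 y
    have hg : Continuous fun φ : ℝ => (t : ℂ) * Complex.exp (Complex.I * φ) := by fun_prop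
    have hLcont : Continuous fun φ : ℝ => L (t * Complex.exp (Complex.I * φ)) :=
      continuous_iff_continuousAt.2 fun φ => ContinuousAt.comp (h1 φ) hg.continuousAt
    have hmcont : Continuous fun φ : ℝ => m (t * Complex.exp (Complex.I * φ)) :=
      continuous_iff_continuousAt.2 fun φ =>
        ContinuousAt.comp (f := fun φ : ℝ => (t : ℂ) * Complex.exp (Complex.I * φ)) (g := m)
          (hmc _ (h1 φ) (h2 φ)) hg.continuousAt
    unfold residueTerm
    refine Measurable.mul (Continuous.measurable ?_) (Measurable.sub_const (Measurable.ite ?_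
      measurable_const measurable_const) _)
    · refine ((continuous_exp_zpow _).div_const _).mul (Continuous.mul ?_ hmcont)
      exact (continuous_const.mul (hLcont.sub continuous_const)).cexp
    · exact measurableSet_lt (Complex.continuous_re.comp hLcont).measurable measurable_const
  have hbound : ∀ᶠ n : ℝ × ℤ in scalingLimit β γ ξ ⊓ 𝓟 {n | 0 ≤ s * (n.2 : ℝ)}, ∀ φ : ℝ,
      ‖residueTerm (β * γ * n.1) s x n.2 (L (n.1 * Complex.exp (Complex.I * φ)))
        (m (n.1 * Complex.exp (Complex.I * φ))) φ‖ ≤ ‖m 0‖ + 1 := by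
    filter_upwards [hy, ht.eventually (eventually_forall_circle hmb)] with n h1 h2 φ
    exact (norm_residueTerm_le hs h1 _ _ φ).trans (h2 φ)
  have hres : Tendsto (fun n : ℝ × ℤ => ∫ φ in (-Real.pi)..Real.pi,
      residueTerm (β * γ * n.1) s x n.2 (L (n.1 * Complex.exp (Complex.I * φ)))
        (m (n.1 * Complex.exp (Complex.I * φ))) φ)
      (scalingLimit β γ ξ ⊓ 𝓟 {n | 0 ≤ s * (n.2 : ℝ)})
      (𝓝 (∫ φ in (-Real.pi)..Real.pi, m 0 * (arcIntegrand γ x ξ φ *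
        ((if β * (Real.cos φ - γ) < 0 then 1 else 0) - (if s = 1 then 1 else 0))))) := by
    refine intervalIntegral.tendsto_integral_filter_of_dominated_convergence
      (fun _ => ‖m 0‖ + 1) ?_ ?_ intervalIntegrable_const ?_
    · filter_upwards [ht.eventually hmeas] with n hn
      exact (hn n.2).aestronglyMeasurable
    · filter_upwards [hbound] with n hn
      exact Eventually.of_forall fun φ _ => hn φ
    · filter_upwards [ae_cos_ne γ] with φ hφ hφ'
      rw [Set.uIoc_of_le (by linarith [Real.pi_pos])] at hφ'
      exact (tendsto_residueTerm hp.beta_ne_zero hγ hL0 hLd hmc0 (hφ hφ')).mono_left inf_le_left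
  rw [intervalIntegral.integral_const_mul, integral_arc_eq_beadKernel hγ hp.beta_ne_zero hs hxξ h,
    hm0] at hres
  have hsum := (hfar.const_mul (1 / (2 * (Real.pi : ℂ)) ^ 2)).add hres
  rw [mul_zero, zero_add] at hsum
  refine hsum.congr' ?_
  filter_upwards [ht.eventually (eventually_forall_circle hroot),
    ht.eventually (eventually_forall_circle hLre), ht.eventually (eventually_forall_circle hDne),
    ht.eventually hsmall, ht.eventually hmeas, hbound,
    ht.eventually (hp.eventually_integrableOn_torusIntegrand hq hγ)]
    with n h1 h2 h3 h4 h5 h6 h7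
  have hpi : -Real.pi ≤ Real.pi := by linarith [Real.pi_pos]
  rw [setIntegral_torus (h7.1 _ _), ← intervalIntegral.integral_const_mul,
    ← intervalIntegral.integral_const_mul, ← intervalIntegral.integral_add]
  · refine intervalIntegral.integral_congr_ae ?_
    filter_upwards [h7.2] with φ hφ hφ'
    rw [Set.uIoc_of_le hpi] at hφ'
    -- otherwise the circle of radius `exp (β γ t)` would contain the root
    have hlb : (L (n.1 * Complex.exp (Complex.I * φ))).re ≠ β * γ * n.1 := by
      intro heq
      set l := L (n.1 * Complex.exp (Complex.I * φ)) with hl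
      set ζ := Complex.exp l with hζ
      have e1 : (torusMap (Real.exp (β * γ * n.1)) n.1 (ζ.arg, φ)) =
          (ζ, n.1 * Complex.exp (Complex.I * φ)) := by
        unfold torusMap
        congr 1
        have := Complex.norm_mul_exp_arg_mul_I ζ
        rw [hζ, Complex.norm_exp, heq] at this
        rw [mul_comm Complex.I]
        exact this
      refine hφ hφ' ζ.arg ⟨Complex.neg_pi_lt_arg _, Complex.arg_le_pi _⟩ ?_
      rw [e1]
      refine (h1 φ ζ (Complex.exp_ne_zero _) ?_).2 rfl
      rw [hζ, Complex.norm_exp, Real.log_exp]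
      exact (h2 φ).le
    have key := hp.inner_integral_eq hq (h1 φ) (h2 φ) (h3 φ) h4 hlb hs n.2
    have e2 : ∀ θ : ℝ, torusIntegrand p q (β * γ * n.1) n.1 (x + 1) n.2 (θ, φ) =
        Complex.exp (Complex.I * φ) ^ (x + 1) * (Complex.exp (Complex.I * θ) ^ (-n.2) *
          (q (Real.exp (β * γ * n.1) * Complex.exp (Complex.I * θ),
              n.1 * Complex.exp (Complex.I * φ)) /
            p (Real.exp (β * γ * n.1) * Complex.exp (Complex.I * θ),
              n.1 * Complex.exp (Complex.I * φ)))) := by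
      intro θ
      unfold torusIntegrand torusMap
      ring
    simp only [e2]
    rw [intervalIntegral.integral_const_mul, key]
    unfold farIntegrand residueTerm
    have hpi0 : (Real.pi : ℂ) ≠ 0 := by exact_mod_cast Real.pi_ne_zero
    simp only [hm, hD]
    generalize (∫ θ in (-Real.pi)..Real.pi, _ : ℂ) = J
    field_simp
  · refine (Continuous.intervalIntegrable ?_ _ _).const_mul _
    exact hp.continuous_farIntegrand hq fun φ => hfarne _ (h1 φ) (h2 φ)
  · refine (intervalIntegrable_const (c := ‖m 0‖ + 1)).mono_fun' (h5 n.2).aestronglyMeasurable ?_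
    exact Eventually.of_forall h6

/-- The scaling limit of the torus integral. If `x < 0`, the sign of `y` is that of `β ξ` whenever
`ξ ≠ 0`, so the arcs fit the half-plane in which the integrand decays. -/
lemma tendsto_torusIntegral (hp : SimpleTentacle p a β)
    (hq : ∀ x : ℂ × ℂ, x.1 ≠ 0 → ContDiffAt ℂ 1 q x) {γ : ℝ} (hγ : γ ∈ Set.Ioo (-1 : ℝ) 1)
    {x : ℤ} {ξ : ℝ} (hxξ : x ≠ -1 ∨ ξ ≠ 0) :
    Tendsto (fun n : ℝ × ℤ => 1 / (2 * (Real.pi : ℂ)) ^ 2 *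
        ∫ θ in PeriodicBipartiteGraph.torus, torusIntegrand p q (β * γ * n.1) n.1 (x + 1) n.2 θ)
      (scalingLimit β γ ξ)
      (𝓝 (q (1, 0) / a * (-(|β| / β : ℝ) * (Real.sqrt (1 - γ ^ 2) * beadKernel γ x ξ)))) := by
  have side : ∀ s : ℝ, (s = 1 ∨ s = -1) → Tendsto (fun n : ℝ × ℤ => 1 / (2 * (Real.pi : ℂ)) ^ 2 *
        ∫ θ in PeriodicBipartiteGraph.torus, torusIntegrand p q (β * γ * n.1) n.1 (x + 1) n.2 θ)
      (scalingLimit β γ ξ ⊓ 𝓟 {n | 0 ≤ s * (n.2 : ℝ)})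
      (𝓝 (q (1, 0) / a * (-(|β| / β : ℝ) * (Real.sqrt (1 - γ ^ 2) * beadKernel γ x ξ)))) := by
    intro s hs
    rcases eq_or_neBot (scalingLimit β γ ξ ⊓ 𝓟 {n | 0 ≤ s * (n.2 : ℝ)}) with hbot | hbot
    · rw [hbot]; exact tendsto_bot
    · refine hp.tendsto_torusIntegral_side hq hγ hs hxξ (Or.inr ?_)
      have hlim : Tendsto (fun n : ℝ × ℤ => s * β * (n.1 * β * n.2 * Real.sqrt (1 - γ ^ 2)))
          (scalingLimit β γ ξ ⊓ 𝓟 {n | 0 ≤ s * (n.2 : ℝ)}) (𝓝 (s * β * ξ)) :=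
        ((tendsto_comap.mono_left inf_le_right).mono_left inf_le_left).const_mul _
      refine ge_of_tendsto hlim ?_
      have ht : Tendsto (fun n : ℝ × ℤ => n.1) (scalingLimit β γ ξ ⊓ 𝓟 {n | 0 ≤ s * (n.2 : ℝ)})
        (𝓝[>] 0) := (tendsto_comap.mono_left inf_le_left).mono_left inf_le_left
      filter_upwards [ht.eventually self_mem_nhdsWithin,
        mem_inf_of_right (mem_principal_self _)] with n hn hn'
      have h1 : 0 < n.1 := hn
      have h2 : 0 ≤ s * (n.2 : ℝ) := hn'
      have h3 : s * β * (n.1 * β * n.2 * Real.sqrt (1 - γ ^ 2)) =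
          β ^ 2 * n.1 * (s * n.2) * Real.sqrt (1 - γ ^ 2) := by ring
      rw [h3]
      positivity
  refine ((side 1 (Or.inl rfl)).sup (side (-1) (Or.inr rfl))).mono_left ?_
  rw [← inf_sup_left, sup_principal]
  refine le_inf le_rfl ?_
  rw [le_principal_iff]
  refine univ_mem' fun n => ?_
  rcases le_total 0 (n.2 : ℝ) with h | h
  · left; change 0 ≤ 1 * (n.2 : ℝ); linarith
  · right; change 0 ≤ -1 * (n.2 : ℝ); linarith

end SimpleTentacle

/-! ### Frozen threads -/

lemma fderiv_comp_mul_fst {F : ℂ × ℂ → ℂ} {r : ℂ} (hF : DifferentiableAt ℂ F (r, 0)) (h k : ℂ) :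
    fderiv ℂ (fun v : ℂ × ℂ => F (r * v.1, v.2)) (1, 0) (h, k) =
      r * h * fderiv ℂ F (r, 0) (1, 0) + k * fderiv ℂ F (r, 0) (0, 1) := by
  have hg : HasFDerivAt (fun v : ℂ × ℂ => (r * v.1, v.2))
      ((r • ContinuousLinearMap.fst ℂ ℂ ℂ).prod (ContinuousLinearMap.snd ℂ ℂ ℂ))
      ((1 : ℂ), (0 : ℂ)) :=
    ((ContinuousLinearMap.fst ℂ ℂ ℂ).hasFDerivAt.const_mul r).prodMk
      (ContinuousLinearMap.snd ℂ ℂ ℂ).hasFDerivAt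
  have hF' : HasFDerivAt F (fderiv ℂ F (r, 0)) (r * 1, 0) := by
    rw [mul_one]
    exact hF.hasFDerivAt
  have hB := HasFDerivAt.comp ((1 : ℂ), (0 : ℂ)) hF' hg
  have hlin : (r * h, k) = (r * h) • ((1 : ℂ), (0 : ℂ)) + k • ((0 : ℂ), (1 : ℂ)) := by simp
  change fderiv ℂ (F ∘ fun v : ℂ × ℂ => (r * v.1, v.2)) (1, 0) (h, k) = _
  rw [hB.fderiv]
  change fderiv ℂ F (r, 0) (r * h, k) = _
  rw [hlin, map_add, map_smul, map_smul, smul_eq_mul, smul_eq_mul]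

namespace PeriodicBipartiteGraph

variable {V E : Type*} {G : PeriodicBipartiteGraph V E} {δ : ℤ} {c : ℝ}
variable [Fintype V] [Fintype E] [DecidableEq V]

/-- The polynomial `w ^ (-δ) P` in the rescaled variable `z / exp c`. -/
def FrozenThread.tentacleP (T : G.FrozenThread δ) (c : ℝ) (v : ℂ × ℂ) : ℂ :=
  (T.kastThread ((Real.exp c : ℝ) * v.1 : ℂ) v.2).det

/-- The polynomial `w ^ (-δ - 1) Q_e` in the rescaled variable `z / exp c`. -/
def FrozenThread.tentacleQ (T : G.FrozenThread δ) (c : ℝ) (e : E) (v : ℂ × ℂ) : ℂ :=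
  T.cofactorQuot e ((Real.exp c : ℝ) * v.1 : ℂ) v.2

lemma FrozenThread.d2_normP (T : G.FrozenThread δ) (hδ : G.IsLowerSide δ) :
    (G.normP δ).d2 (Real.exp c) 0 =
      ∑ e, (T.crossing e : ℝ) * G.kast e * T.cofactorQuot e (Real.exp c) 0 := by
  unfold Laurent.d2
  simp only [T.normP_eval hδ (Real.exp_pos c).ne']
  exact (T.hasDerivAt_det_kastThread _ _).deriv

lemma FrozenThread.d1_normP (T : G.FrozenThread δ) (hδ : G.IsLowerSide δ) :
    (G.normP δ).d1 (Real.exp c) 0 =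
      deriv (fun s : ℝ => (T.kastThread s (0 : ℝ)).det) (Real.exp c) := by
  unfold Laurent.d1
  refine EventuallyEq.deriv_eq ?_
  filter_upwards [eventually_ne_nhds (Real.exp_pos c).ne'] with s hs
  exact T.normP_eval hδ hs 0

omit [Fintype V] [Fintype E] [DecidableEq V] in
lemma FrozenThread.pow_crossingNat (T : G.FrozenThread δ) {e : E} (he : 0 < T.crossing e)
    {𝕜 : Type*} [Field 𝕜] (w : 𝕜) : w ^ T.crossingNat e = w * w ^ (T.crossingNat e - 1) := by
  have h : 0 < T.crossingNat e := by
    rw [← T.coe_crossingNat e] at he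
    exact_mod_cast he
  rw [← pow_succ', Nat.sub_add_cancel h]

lemma FrozenThread.d2_normQ (T : G.FrozenThread δ) (hδ : G.IsLowerSide δ) {e : E}
    (he : 0 < T.crossing e) :
    (G.normQ δ e).d2 (Real.exp c) 0 = T.cofactorQuot e (Real.exp c) 0 := by
  have hcont : ContinuousAt (fun s : ℝ => T.cofactorQuot e (Real.exp c) s) 0 := by
    have h1 : ContinuousAt (fun s : ℝ => T.cofactorQuot e ((Real.exp c : ℝ) : ℂ) (s : ℂ)) 0 :=
      ContinuousAt.comp (f := fun s : ℝ => (((Real.exp c : ℝ) : ℂ), (s : ℂ)))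
        (g := fun x : ℂ × ℂ => T.cofactorQuot e x.1 x.2)
        (T.contDiffAt_cofactorQuot e _ (by simp [Complex.exp_ne_zero])).continuousAt (by fun_prop)
    have h2 := Complex.continuous_re.continuousAt.comp h1
    refine h2.congr (Eventually.of_forall fun s => ?_)
    simp [T.cofactorQuot_ofReal, -Complex.ofReal_exp]
  have heq : (fun s : ℝ => (G.normQ δ e).eval (Real.exp c) s) =
      fun s => s * T.cofactorQuot e (Real.exp c) s := by
    funext s
    rw [T.normQ_eval hδ e (Real.exp_pos c).ne', T.pow_crossingNat he]
    unfold FrozenThread.cofactorQuot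
    ring
  unfold Laurent.d2
  rw [heq]
  refine HasDerivAt.deriv ?_
  rw [hasDerivAt_iff_tendsto_slope]
  refine (hcont.tendsto.mono_left nhdsWithin_le_nhds).congr' ?_
  filter_upwards [self_mem_nhdsWithin] with s hs
  have hs' : s ≠ 0 := hs
  simp [slope_def_field]
  field_simp

lemma FrozenThread.fderiv_tentacleP (T : G.FrozenThread δ) (hδ : G.IsLowerSide δ)
    (hc : G.IsTentacle δ c) (h k : ℂ) :
    fderiv ℂ (T.tentacleP c) (1, 0) (h, k) =
      Real.exp c * h * (G.normP δ).d1 (Real.exp c) 0 + k * (G.normP δ).d2 (Real.exp c) 0 := by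
  set F : ℂ × ℂ → ℂ := fun x => (T.kastThread x.1 x.2).det with hF
  set r : ℝ := Real.exp c with hr
  have hr0 : (r : ℂ) ≠ 0 := by exact_mod_cast (Real.exp_pos c).ne'
  have hA : HasFDerivAt F (fderiv ℂ F (r, 0)) ((r : ℂ), (0 : ℂ)) :=
    ((T.contDiffAt_det_kastThread (r, 0) hr0).differentiableAt (by norm_num)).hasFDerivAt
  set A := fderiv ℂ F (r, 0)
  have e1 : A (1, 0) = (G.normP δ).d1 r 0 := by
    have h1 : HasDerivAt (fun s : ℂ => F (s, 0)) (A (1, 0)) r :=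
      hA.comp_hasDerivAt_of_eq (f := fun s : ℂ => (s, (0 : ℂ))) (r : ℂ)
        ((hasDerivAt_id _).prodMk (hasDerivAt_const _ _)) rfl
    have hd : DifferentiableAt ℝ (fun s : ℝ => (T.kastThread s (0 : ℝ)).det) r :=
      differentiableAt_of_deriv_ne_zero (by rw [← T.d1_normP hδ]; exact hc.simple)
    rw [T.d1_normP hδ]
    refine h1.comp_ofReal.unique ?_
    refine (hd.hasDerivAt.ofReal_comp).congr_of_eventuallyEq (Eventually.of_forall fun s => ?_)
    have := T.det_kastThread_ofReal s 0
    rwa [Complex.ofReal_zero] at this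
  have e2 : A (0, 1) = (G.normP δ).d2 r 0 := by
    have h1 : HasDerivAt (fun s : ℂ => F (r, s)) (A (0, 1)) ((0 : ℝ) : ℂ) :=
      hA.comp_hasDerivAt_of_eq (f := fun s : ℂ => ((r : ℂ), s)) ((0 : ℝ) : ℂ)
        ((hasDerivAt_const _ _).prodMk (hasDerivAt_id _)) (by simp)
    rw [T.d2_normP hδ]
    refine h1.comp_ofReal.unique ?_
    refine ((T.hasDerivAt_det_kastThread r 0).ofReal_comp).congr_of_eventuallyEq
      (Eventually.of_forall fun s => ?_)
    exact T.det_kastThread_ofReal r s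
  have h1 := fderiv_comp_mul_fst hA.differentiableAt h k
  rw [e1, e2] at h1
  exact h1

lemma IsTentacle.exp_mul_d1_mul_beta (hc : G.IsTentacle δ c) :
    Real.exp c * (G.normP δ).d1 (Real.exp c) 0 * G.beta δ c = -(G.normP δ).d2 (Real.exp c) 0 := by
  have h1 := hc.simple
  have h2 := (Real.exp_pos c).ne'
  unfold beta
  rw [Real.exp_neg]
  field_simp

/-- In the variable `z / exp c`, the polynomial `P` satisfies the hypotheses under which the
scaling limit of the torus integrals has been computed. -/
lemma FrozenThread.simpleTentacle (T : G.FrozenThread δ) (hδ : G.IsLowerSide δ)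
    (hc : G.IsTentacle δ c) :
    SimpleTentacle (T.tentacleP c)
      ((Real.exp c * (G.normP δ).d1 (Real.exp c) 0 : ℝ) : ℂ) (G.beta δ c) where
  contDiffAt x hx := by
    refine ContDiffAt.comp (g := fun x : ℂ × ℂ => (T.kastThread x.1 x.2).det)
      (f := fun v : ℂ × ℂ => (((Real.exp c : ℝ) : ℂ) * v.1, v.2)) x
      (T.contDiffAt_det_kastThread _ (mul_ne_zero (by simp [Complex.exp_ne_zero]) hx)) ?_
    exact (contDiffAt_const.mul contDiffAt_fst).prodMk contDiffAt_snd
  root := by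
    have h := T.det_kastThread_ofReal (Real.exp c) 0
    rw [← T.normP_eval hδ (Real.exp_pos c).ne' 0, hc.root] at h
    unfold FrozenThread.tentacleP
    simpa using h
  a_ne_zero := by exact_mod_cast mul_ne_zero (Real.exp_pos c).ne' hc.simple
  beta_ne_zero h := by
    have h1 := hc.exp_mul_d1_mul_beta
    rw [h, mul_zero] at h1
    exact hc.nondegenerate (neg_eq_zero.1 h1.symm)
  fderiv_eq h k := by
    rw [T.fderiv_tentacleP hδ hc]
    have h1 : ((Real.exp c : ℝ) : ℂ) * ((G.normP δ).d1 (Real.exp c) 0 : ℝ) * (G.beta δ c : ℝ) =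
        -((G.normP δ).d2 (Real.exp c) 0 : ℝ) := by exact_mod_cast hc.exp_mul_d1_mul_beta
    rw [Complex.ofReal_mul]
    linear_combination k * h1
  unique z hz h := by
    have he : ((Real.exp c : ℝ) : ℂ) ≠ 0 := by exact_mod_cast (Real.exp_pos c).ne'
    have hz0 : z ≠ 0 := by
      rintro rfl
      simp at hz
    have h1 := hc.asymptote_distinct ((Real.exp c : ℝ) * z)
      (by rw [norm_mul, hz, mul_one, Complex.norm_real, Real.norm_of_nonneg (Real.exp_pos c).le])
      (by rw [T.normP_eval hδ (mul_ne_zero he hz0)]; exact h)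
    exact mul_left_cancel₀ he (by rw [h1, mul_one])

lemma FrozenThread.contDiffAt_tentacleQ (T : G.FrozenThread δ) (e : E) (x : ℂ × ℂ)
    (hx : x.1 ≠ 0) : ContDiffAt ℂ 1 (T.tentacleQ c e) x := by
  refine ContDiffAt.comp (g := fun x : ℂ × ℂ => T.cofactorQuot e x.1 x.2)
    (f := fun v : ℂ × ℂ => (((Real.exp c : ℝ) : ℂ) * v.1, v.2)) x
    (T.contDiffAt_cofactorQuot e _ (mul_ne_zero (by simp [Complex.exp_ne_zero]) hx)) ?_
  exact (contDiffAt_const.mul contDiffAt_fst).prodMk contDiffAt_snd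

/-- The integrand of the coupling function, in the gauge of the thread. The factor `t` is the
factor `w` of `Q_e`. -/
lemma FrozenThread.edgeMonomial_mul_invKastIntegrand (T : G.FrozenThread δ) {e : E}
    (he : 0 < T.crossing e) (b : ℝ) {t : ℝ} (ht : 0 < t) (u : ℤ × ℤ) (θ : ℝ × ℝ) :
    (G.edgeMonomial e).eval (Complex.exp (c + b : ℝ)) (Complex.exp (Real.log t : ℝ)) *
        G.invKastIntegrand (c + b) (Real.log t) (G.black e) (G.white e) (u + G.shift e) θ =
      t * SimpleTentacle.torusIntegrand (T.tentacleP c) (T.tentacleQ c e) b t (u.1 + 1) u.2 θ := by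
  have hlog : Complex.exp (Real.log t : ℝ) = t := by
    rw [← Complex.ofReal_exp, Real.exp_log ht]
  have hX : Complex.exp (Complex.I * θ.1) ≠ 0 := Complex.exp_ne_zero _
  have hY : Complex.exp (Complex.I * θ.2) ≠ 0 := Complex.exp_ne_zero _
  have ht' : (t : ℂ) ≠ 0 := by exact_mod_cast ht.ne'
  have key := T.edge_mul_inv e
    (Complex.exp (c + b : ℝ) * Complex.exp (Complex.I * θ.1))
    (t * Complex.exp (Complex.I * θ.2)) (mul_ne_zero ht' hY)
  have hexp : Complex.exp (c + b : ℝ) * Complex.exp (Complex.I * θ.1) =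
      (Real.exp c : ℝ) * ((Real.exp b : ℝ) * Complex.exp (Complex.I * θ.1)) := by
    rw [Complex.ofReal_add, Complex.exp_add, Complex.ofReal_exp, Complex.ofReal_exp]
    ring
  unfold invKastIntegrand SimpleTentacle.torusIntegrand SimpleTentacle.torusMap
  rw [hlog]
  simp only [edgeMonomial, Laurent.eval_single, map_one, one_mul, Prod.fst_add, Prod.snd_add,
    neg_add, zpow_add₀ hX, zpow_add₀ hY, zpow_one]
  rw [mul_zpow, mul_zpow] at key
  calc _ = Complex.exp (Complex.I * θ.1) ^ (-u.2) * Complex.exp (Complex.I * θ.2) ^ u.1 * _ := ?_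
    _ = Complex.exp (Complex.I * θ.1) ^ (-u.2) * Complex.exp (Complex.I * θ.2) ^ u.1 * _ :=
      congrArg _ key
    _ = _ := ?_
  · ring
  · unfold FrozenThread.tentacleP FrozenThread.tentacleQ FrozenThread.cofactorQuot
    rw [T.pow_crossingNat he, ← mul_zpow, hexp]
    ring

/-- Absolute convergence for small `t`. -/
lemma FrozenThread.eventually_integrableOn_invKastIntegrand (T : G.FrozenThread δ)
    (hδ : G.IsLowerSide δ) (hc : G.IsTentacle δ c) {γ : ℝ} (hγ : γ ∈ Set.Ioo (-1 : ℝ) 1) {e : E}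
    (he : 0 < T.crossing e) :
    ∀ᶠ t : ℝ in 𝓝[>] 0, ∀ u : ℤ × ℤ,
      IntegrableOn (G.invKastIntegrand (c + G.beta δ c * γ * t) (Real.log t)
        (G.black e) (G.white e) u) torus := by
  filter_upwards [(T.simpleTentacle hδ hc).eventually_integrableOn_torusIntegrand
    (T.contDiffAt_tentacleQ e) hγ, self_mem_nhdsWithin] with t h ht u
  have ht : 0 < t := ht
  set C := (G.edgeMonomial e).eval (Complex.exp (c + G.beta δ c * γ * t : ℝ))
    (Complex.exp (Real.log t : ℝ)) with hC
  have hC0 : C ≠ 0 := by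
    rw [hC, edgeMonomial, Laurent.eval_single, map_one, one_mul]
    exact mul_ne_zero (zpow_ne_zero _ (Complex.exp_ne_zero _))
      (zpow_ne_zero _ (Complex.exp_ne_zero _))
  refine IntegrableOn.congr_fun
    ((h.1 ((u - G.shift e).1 + 1) (u - G.shift e).2).const_mul (C⁻¹ * t)) (fun θ _ => ?_)
    (measurableSet_Ioc.prod measurableSet_Ioc)
  have := T.edgeMonomial_mul_invKastIntegrand (c := c) he (G.beta δ c * γ * t) ht
    (u - G.shift e) θ
  rw [sub_add_cancel, ← hC] at this
  rw [mul_assoc, ← this, inv_mul_cancel_left₀ hC0]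

lemma FrozenThread.couplingInTentacle_div (T : G.FrozenThread δ) {e : E} (he : 0 < T.crossing e)
    (γ : ℝ) {t : ℝ} (ht : 0 < t) (u : ℤ × ℤ) :
    G.couplingInTentacle δ c γ t e u / (t : ℂ) = 1 / (2 * (Real.pi : ℂ)) ^ 2 * ∫ θ in torus,
      SimpleTentacle.torusIntegrand (T.tentacleP c) (T.tentacleQ c e) (G.beta δ c * γ * t) t
        (u.1 + 1) u.2 θ := by
  have ht' : (t : ℂ) ≠ 0 := by exact_mod_cast ht.ne'
  unfold couplingInTentacle coupling invKast
  rw [mul_left_comm, ← integral_const_mul]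
  simp only [T.edgeMonomial_mul_invKastIntegrand he _ ht]
  rw [integral_const_mul]
  field_simp

lemma FrozenThread.tendsto_couplingInTentacle_div (T : G.FrozenThread δ)
    (hδ : G.IsLowerSide δ) (hc : G.IsTentacle δ c) {γ : ℝ} (hγ : γ ∈ Set.Ioo (-1 : ℝ) 1) {e : E}
    (he : 0 < T.crossing e) {x : ℤ} {ξ : ℝ} (hxξ : x ≠ -1 ∨ ξ ≠ 0) :
    Tendsto (fun p : ℝ × ℤ => G.couplingInTentacle δ c γ p.1 e (x, p.2) / (p.1 : ℂ))
      (scalingLimit (G.beta δ c) γ ξ)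
      (𝓝 (|G.beta δ c| * Real.sqrt (1 - γ ^ 2) * G.rho δ c e * beadKernel γ x ξ)) := by
  have hp := T.simpleTentacle hδ hc
  have h := hp.tendsto_torusIntegral (T.contDiffAt_tentacleQ (c := c) e) hγ hxξ
  have ht : Tendsto (fun n : ℝ × ℤ => n.1) (scalingLimit (G.beta δ c) γ ξ) (𝓝[>] 0) :=
    tendsto_comap.mono_left inf_le_left
  have hval : T.tentacleQ c e (1, 0) = ((G.normQ δ e).d2 (Real.exp c) 0 : ℝ) := by
    rw [T.d2_normQ hδ he, ← T.cofactorQuot_ofReal]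
    simp [FrozenThread.tentacleQ]
  have hlim : T.tentacleQ c e (1, 0) / ((Real.exp c * (G.normP δ).d1 (Real.exp c) 0 : ℝ) : ℂ) *
        (-(|G.beta δ c| / G.beta δ c : ℝ) * (Real.sqrt (1 - γ ^ 2) * beadKernel γ x ξ)) =
      |G.beta δ c| * Real.sqrt (1 - γ ^ 2) * G.rho δ c e * beadKernel γ x ξ := by
    have hb := hp.beta_ne_zero
    have h1 : G.rho δ c e = -((G.normQ δ e).d2 (Real.exp c) 0 /
        (Real.exp c * (G.normP δ).d1 (Real.exp c) 0) / G.beta δ c) := by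
      unfold rho
      rw [div_div, hc.exp_mul_d1_mul_beta, div_neg, neg_neg]
    rw [hval, h1]
    push_cast
    ring
  rw [← hlim]
  refine h.congr' ?_
  filter_upwards [ht.eventually self_mem_nhdsWithin] with n hn
  exact (T.couplingInTentacle_div he γ hn (x, n.2)).symm

lemma FrozenThread.crossing_mul_rho (T : G.FrozenThread δ) (hδ : G.IsLowerSide δ) {e : E}
    (he : 0 < T.crossing e) : (T.crossing e : ℝ) * G.rho δ c e = G.rho δ c e := by
  rcases eq_or_ne (T.crossing e) 1 with h | h
  · simp [h]
  · have h0 : T.crossingNat e - 1 ≠ 0 := by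
      have := T.coe_crossingNat e
      omega
    have : G.rho δ c e = 0 := by
      unfold rho
      rw [T.d2_normQ hδ he]
      simp [FrozenThread.cofactorQuot, h0]
    rw [this, mul_zero]

/-- The proportions `K_e ρ_e` of the defects, counted with the crossing numbers, add up to `1`. -/
lemma FrozenThread.sum_crossing_mul_kast_mul_rho (T : G.FrozenThread δ) (hδ : G.IsLowerSide δ)
    (hc : G.IsTentacle δ c) : ∑ e, (T.crossing e : ℝ) * (G.kast e * G.rho δ c e) = 1 := by
  have h := T.d2_normP hδ (c := c)
  rw [← div_self hc.nondegenerate]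
  nth_rw 1 [h]
  rw [Finset.sum_div]
  refine Finset.sum_congr rfl fun e _ => ?_
  rcases (T.crossing_nonneg e).eq_or_lt with he | he
  · simp [← he]
  · unfold rho
    rw [T.d2_normQ hδ he]
    ring

end PeriodicBipartiteGraph

lemma beadKernel_zero_zero (γ : ℝ) : beadKernel γ 0 0 = 1 / Real.pi := by
  have hpi : (Real.pi : ℂ) ≠ 0 := by exact_mod_cast Real.pi_ne_zero
  simp only [beadKernel, le_refl, if_true, beadIntegrand]
  simp
  field_simp
  norm_num

/-- Convergence of the improper integral that defines the bead kernel. -/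
lemma tendsto_beadTail {γ : ℝ} (hγ : γ ∈ Set.Ioo (-1 : ℝ) 1) {x : ℤ} {ξ : ℝ}
    (hxξ : x ≠ -1 ∨ ξ ≠ 0) (hx : x < 0) :
    Tendsto (beadTail γ x ξ) (atTop ×ˢ atTop) (𝓝 (-beadKernel γ x ξ)) := by
  rcases le_total 0 ξ with h | h
  · exact (beadKernel_eq_arc_right hγ hxξ (Or.inr h)).1 hx
  · exact (beadKernel_eq_arc_left hγ hxξ (Or.inr h)).1 hx

lemma tendsto_scalingLimit_zero (β γ : ℝ) :
    Tendsto (fun t : ℝ => (t, (0 : ℤ))) (𝓝[>] 0) (scalingLimit β γ 0) := by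
  unfold scalingLimit
  rw [tendsto_inf, tendsto_comap_iff, tendsto_comap_iff]
  refine ⟨tendsto_id, ?_⟩
  have : ((fun p : ℝ × ℤ => p.1 * β * p.2 * Real.sqrt (1 - γ ^ 2)) ∘ fun t : ℝ => (t, (0 : ℤ))) =
      fun _ => 0 := by
    funext t; simp
  rw [this]
  exact tendsto_const_nhds

namespace PeriodicBipartiteGraph

variable {V E : Type*} {G : PeriodicBipartiteGraph V E} {δ : ℤ} {c : ℝ}
variable [Fintype V] [Fintype E] [DecidableEq V]

lemma FrozenThread.tendsto_crossing_mul_edgeProb_div (T : G.FrozenThread δ)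
    (hδ : G.IsLowerSide δ) (hc : G.IsTentacle δ c) {γ : ℝ} (hγ : γ ∈ Set.Ioo (-1 : ℝ) 1) (e : E) :
    Tendsto (fun t : ℝ => T.crossing e * G.edgeProbInTentacle δ c γ t e / (t : ℂ)) (𝓝[>] 0)
      (𝓝 (|G.beta δ c| * Real.sqrt (1 - γ ^ 2) / Real.pi *
        (((T.crossing e : ℝ) * (G.kast e * G.rho δ c e) : ℝ) : ℂ))) := by
  rcases (T.crossing_nonneg e).eq_or_lt with he | he
  · simp [← he]
  · have h := (T.tendsto_couplingInTentacle_div hδ hc hγ he (x := 0) (ξ := 0)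
      (Or.inl (by norm_num))).comp (tendsto_scalingLimit_zero _ γ)
    have h' := h.const_mul ((T.crossing e : ℂ) * G.kast e)
    rw [beadKernel_zero_zero] at h'
    convert h' using 2
    · simp only [edgeProbInTentacle, edgeProb, Function.comp_apply, couplingInTentacle]
      rw [← mul_assoc, mul_div_assoc]
      rfl
    · push_cast
      ring

lemma FrozenThread.tendsto_proportion (T : G.FrozenThread δ)
    (hδ : G.IsLowerSide δ) (hc : G.IsTentacle δ c) {γ : ℝ} (hγ : γ ∈ Set.Ioo (-1 : ℝ) 1) {e : E}
    (he : 0 < T.crossing e) :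
    Tendsto (fun t : ℝ => T.crossing e * G.edgeProbInTentacle δ c γ t e /
        ∑ e' : E, T.crossing e' * G.edgeProbInTentacle δ c γ t e')
      (𝓝[>] 0) (𝓝 (G.kast e * G.rho δ c e : ℂ)) := by
  set C : ℂ := |G.beta δ c| * Real.sqrt (1 - γ ^ 2) / Real.pi with hC
  have hC0 : C ≠ 0 := by
    have h1 : |G.beta δ c| * Real.sqrt (1 - γ ^ 2) / Real.pi ≠ 0 :=
      div_ne_zero (mul_ne_zero (abs_ne_zero.2 (T.simpleTentacle hδ hc).beta_ne_zero)
        (sqrt_one_sub_sq_pos hγ).ne') Real.pi_ne_zero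
    rw [hC]
    exact_mod_cast h1
  have hsum := tendsto_finsetSum Finset.univ
    fun e' _ => T.tendsto_crossing_mul_edgeProb_div hδ hc hγ e'
  rw [← Finset.mul_sum, ← Complex.ofReal_sum, T.sum_crossing_mul_kast_mul_rho hδ hc,
    Complex.ofReal_one, mul_one] at hsum
  have hdiv := (T.tendsto_crossing_mul_edgeProb_div hδ hc hγ e).div hsum hC0
  rw [mul_left_comm, T.crossing_mul_rho hδ he, mul_div_cancel_left₀ _ hC0,
    Complex.ofReal_mul] at hdiv
  refine hdiv.congr' ?_
  filter_upwards [self_mem_nhdsWithin] with t ht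
  have ht' : (t : ℂ) ≠ 0 := by exact_mod_cast (show 0 < t from ht).ne'
  simp only [Pi.div_apply]
  rw [← Finset.sum_div, div_div_div_cancel_right₀ ht']

end PeriodicBipartiteGraph

end BeadDimer

end

open BeadDimer in
theorem mainTheorem4 {V E : Type*} [Fintype V] [DecidableEq V] [Fintype E]
    (G : PeriodicBipartiteGraph V E) (δ : ℤ) (hδ : G.IsLowerSide δ)
    (T : G.FrozenThread δ) (c : ℝ) (hc : G.IsTentacle δ c)
    (γ : ℝ) (hγ : γ ∈ Set.Ioo (-1 : ℝ) 1)
    (e : E) (he : 0 < T.crossing e) :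
    -- the integral that defines the inverse Kasteleyn operator converges absolutely
    (∀ᶠ t : ℝ in 𝓝[>] 0, ∀ u : ℤ × ℤ,
      IntegrableOn (G.invKastIntegrand (c + G.beta δ c * γ * t) (Real.log t)
        (G.black e) (G.white e) u) PeriodicBipartiteGraph.torus) ∧
    -- asymptotics in the scaling limit
    (∀ (x : ℤ) (ξ : ℝ), (x ≠ -1 ∨ ξ ≠ 0) →
      (x < 0 → Tendsto (beadTail γ x ξ) (atTop ×ˢ atTop) (𝓝 (-beadKernel γ x ξ))) ∧
      Tendsto (fun p : ℝ × ℤ => G.couplingInTentacle δ c γ p.1 e (x, p.2) / (p.1 : ℂ))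
        (scalingLimit (G.beta δ c) γ ξ)
        (𝓝 (|G.beta δ c| * Real.sqrt (1 - γ ^ 2) * G.rho δ c e * beadKernel γ x ξ))) ∧
    -- `K_e ρ_e` is the limiting proportion of edges of type `e` among the defects along the thread
    Tendsto (fun t : ℝ => T.crossing e * G.edgeProbInTentacle δ c γ t e /
        ∑ e' : E, T.crossing e' * G.edgeProbInTentacle δ c γ t e')
      (𝓝[>] 0) (𝓝 (G.kast e * G.rho δ c e : ℂ)) :=
  ⟨T.eventually_integrableOn_invKastIntegrand hδ hc hγ he,
    fun _ _ hxξ => ⟨tendsto_beadTail hγ hxξ, T.tendsto_couplingInTentacle_div hδ hc hγ he hxξ⟩,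
    T.tendsto_proportion hδ hc hγ he⟩
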